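/- Let $\Omega\subset\mathbb R^3$ be open and bounded with smooth boundary $\Gamma$ (near each boundary point, $\Omega$ is a strict sublevel set $\{\varphi<0\}$ of a smooth function $\varphi$ with $\nabla\varphi\neq0$), with outer unit normal field $n$ and surface measure $\mathrm ds$. Let $\xi_1(s),\xi_2(s)$ be an orthonormal basis of the tangent plane $T_s\Gamma$ depending measurably on $s\in\Gamma$, and let $d_i,b_i:\Gamma\to\mathbb R^3$ $(i=1,2)$ be measurable fields with $d_i(s),b_i(s)\in T_{n(s)}S^2=n(s)^\perp$. The tangential derivative $(D_\Gamma F)(s)$ of a field $F$ on $\Gamma$ is extended by zero to the normal line. Let $\beta,\lambda\in\mathbb R$, let $\ell(u(\Omega),\Omega)\in\mathbb R$ be a loss term depending on the domain (directly and through a state $u(\Omega)$), and let $$\mathcal L(\Omega,d,b)=\ell(u(\Omega),\Omega)+\beta\int_\Gamma(|d_1|^2+|d_2|^2)^{1/2}\,\mathrm ds+\frac\lambda2\sum_{i=1}^2\int_\Gamma|d_i-(D_\Gamma n)\xi_i-b_i|^2\,\mathrm ds$$ be the rescaled augmented Lagrangian; its two kinds of surface integrals are assumed to converge. Let $D\supset\overline\Omega$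 be open. For a smooth vector field $V:D\to\mathbb R^3$ let $T_\varepsilon(x)=x+\varepsilon V(x)$ and $\Omega_\varepsilon=T_\varepsilon(\Omega)$, with boundary $\Gamma_\varepsilon$ and normal $n_\varepsilon$. On $\Gamma_\varepsilon$ (for small $|\varepsilon|$) the fields $d_i,b_i$ are replaced by $d_i\circ T_\varepsilon^{-1}$, $b_i\circ T_\varepsilon^{-1}$, and $\xi_i$ by the frame $\xi_{i,\varepsilon}$ whose value at $T_\varepsilon(s)$ results from $DT_\varepsilon(s)\xi_1(s),DT_\varepsilon(s)\xi_2(s)$ by the Gram--Schmidt process; this defines $\mathcal L(\varepsilon)$. The shape derivative in the direction $V$ is the limit $\mathrm d\mathcal L[V]=\lim_{\varepsilon\searrow0}(\mathcal L(\varepsilon)-\mathcal L(0))/\varepsilon$, and likewise $\mathrm d\ell[V]$ for $\ell(u(\Omega_\varepsilon),\Omega_\varepsilon)$. Shape differentiability means that this limit exists for all smooth $V:D\to\mathbb R^3$ and is linear and continuous in $V$ (for locally uniform convergence of all derivatives on $D$). **Theorem.** Suppose that $d_1,d_2$ do not vanish simultaneously on $\Gamma$ except possibly on a set of measure zero. (a)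 If the loss term is shape differentiable, then $\mathcal L$ is shape differentiable. (b) Let $V$ be a smooth vector field on $D$. The surface integrals in $\mathcal L(\varepsilon)$ converge for all sufficiently small $\varepsilon>0$. For every $s\in\Gamma$, the material derivative $$\mathrm d\big((D_\Gamma n)\xi_i\big)[V](s)=\frac{\mathrm d}{\mathrm d\varepsilon}\Big|_{\varepsilon=0}\big((D_{\Gamma_\varepsilon}n_\varepsilon)\,\xi_{i,\varepsilon}\big)(T_\varepsilon(s))$$ exists and equals $$D_\Gamma(\mathrm dn[V])\,\xi_i-(D_\Gamma n)(D_\Gamma V)\,\xi_i+(D_\Gamma n)(\mathrm d\xi_i[V]),$$ where $\mathrm dn[V]=-(D_\Gamma V)^\top n$, $\mathrm d\xi_1[V]=(DV)\xi_1-(\xi_1^\top(DV)\xi_1)\xi_1$ and $\mathrm d\xi_2[V]=(DV)\xi_2-(\xi_2^\top(DV)\xi_2)\xi_2-(\xi_1^\top(DV+DV^\top)\xi_2)\xi_1$. If the loss term has a shape derivative $\mathrm d\ell[V]$ in the direction $V$ (in particular, if it is shape differentiable), then $\mathrm d\mathcal L[V]$ exists and $$\begin{aligned}\mathrm d\mathcal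 L[V]={}&\mathrm d\ell[V]+\beta\int_\Gamma(\operatorname{div}_\Gamma V)\,(|d_1|^2+|d_2|^2)^{1/2}\,\mathrm ds+\frac\lambda2\sum_{i=1}^2\int_\Gamma(\operatorname{div}_\Gamma V)\,|d_i-(D_\Gamma n)\xi_i-b_i|^2\,\mathrm ds\\&+\lambda\sum_{i=1}^2\int_\Gamma\big\langle d_i-(D_\Gamma n)\xi_i-b_i,\;-\mathrm d\big((D_\Gamma n)\xi_i\big)[V]\big\rangle\,\mathrm ds,\end{aligned}$$ where $\operatorname{div}_\Gamma V=\operatorname{div}V-n^\top(DV)n$ and all integrals on the right-hand side converge. -/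

import Mathlib

open MeasureTheory Filter Topology
open scoped ContDiff

noncomputable section

namespace SplitBregman

/-- Euclidean space `ℝ³`. -/
abbrev E3 : Type := EuclideanSpace ℝ (Fin 3)

/-! ### Smoothly bounded sets, their boundary surface and its normal field -/

/-- `Ω ⊂ ℝ³` is open and bounded, with smooth boundary: near every boundary point, `Ω` is a strict
sublevel set of a smooth function without critical points.  In particular `frontier Ω` is a compact
embedded smooth surface without boundary, with `Ω` locally on one side of it. -/
structure IsSmoothDomain (Ω : Set E3) : Prop where
  isOpen : IsOpen Ω
  isBounded : Bornology.IsBounded Ω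
  exists_defining : ∀ s ∈ frontier Ω, ∃ (U : Set E3) (φ : E3 → ℝ), IsOpen U ∧ s ∈ U ∧
    ContDiffOn ℝ ∞ φ U ∧ (∀ x ∈ U, fderiv ℝ φ x ≠ 0) ∧ Ω ∩ U = {x ∈ U | φ x < 0}

/-- The surface measure on `Γ = frontier Ω`: two-dimensional Hausdorff measure, normalized so that
it agrees with area on planes. -/
def surfaceMeasure (Ω : Set E3) : Measure E3 :=
  (Measure.euclideanHausdorffMeasure 2 : Measure E3).restrict (frontier Ω)

/-- `ν` is the outer unit normal of `Ω` at `s`: a unit vector such that, from `s`, all directions in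
the open half space opposite to `ν` lead into `Ω`, and all those in the open half space of `ν` lead
out of `closure Ω`.  There is at most one such vector. -/
def IsOuterUnitNormal (Ω : Set E3) (s ν : E3) : Prop :=
  ‖ν‖ = 1 ∧
  (∀ v : E3, inner ℝ ν v < 0 → ∀ᶠ t : ℝ in 𝓝[>] 0, s + t • v ∈ Ω) ∧
  (∀ v : E3, 0 < inner ℝ ν v → ∀ᶠ t : ℝ in 𝓝[>] 0, s + t • v ∉ closure Ω)

/-- The outer unit normal field `n` of `Ω` (only its values on `frontier Ω` matter). -/
def outerNormal (Ω : Set E3) (s : E3) : E3 :=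
  Classical.epsilon (IsOuterUnitNormal Ω s)

/-- Orthogonal projection `I - n nᵀ` of `ℝ³` onto the tangent plane of `Γ` at `s`. -/
def tangentProj (Ω : Set E3) (s : E3) : E3 →L[ℝ] E3 :=
  ContinuousLinearMap.id ℝ E3 -
    (innerSL ℝ (outerNormal Ω s)).smulRight (outerNormal Ω s)

/-- The tangential derivative `(D_Γ F)(s)` of a field `F` on `Γ = frontier Ω`, extended by zero to
the normal line.  It uses only the values of `F` on `Γ`: the derivative of `F` within the set `Γ` is
uniquely determined on the tangent plane, which is where the projection lands. -/
def tangentialDeriv (Ω : Set E3) (F : E3 → E3) (s : E3) : E3 →L[ℝ] E3 :=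
  (fderivWithin ℝ F (frontier Ω) s).comp (tangentProj Ω s)

/-- The tangential divergence `div_Γ V = div V - nᵀ (DV) n`. -/
def surfaceDiv (Ω : Set E3) (V : E3 → E3) (s : E3) : ℝ :=
  LinearMap.trace ℝ E3 (fderiv ℝ V s : E3 →ₗ[ℝ] E3) -
    inner ℝ (outerNormal Ω s) (fderiv ℝ V s (outerNormal Ω s))

/-- `(D_Γ n) ξ` for the outer unit normal field `n` of `Ω` and a field `ξ` on `frontier Ω`. -/
def normalDeriv (Ω : Set E3) (ξ : E3 → E3) (s : E3) : E3 :=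
  tangentialDeriv Ω (outerNormal Ω) s (ξ s)

/-- `ξ₁(s), ξ₂(s)` is an orthonormal basis of the tangent plane of `frontier Ω` at `s`, for every
`s ∈ frontier Ω`. -/
def IsTangentFrame (Ω : Set E3) (ξ : Fin 2 → E3 → E3) : Prop :=
  ∀ s ∈ frontier Ω, Orthonormal ℝ (fun i => ξ i s) ∧ ∀ i, inner ℝ (outerNormal Ω s) (ξ i s) = 0

/-- A field `f` on `frontier Ω` has values in the tangent space of the unit sphere at `n(s)`, i.e.
in the orthogonal complement of `n(s)`. -/
def IsTangentialField (Ω : Set E3) (f : E3 → E3) : Prop :=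
  ∀ s ∈ frontier Ω, inner ℝ (outerNormal Ω s) (f s) = 0

/-! ### The rescaled augmented Lagrangian -/

/-- `r_i = d_i - (D_Γ n) ξ_i - b_i`. -/
def splitResidual (Ω : Set E3) (d b ξ : Fin 2 → E3 → E3) (i : Fin 2) (s : E3) : E3 :=
  d i s - normalDeriv Ω (ξ i) s - b i s

/-- `(|d₁|² + |d₂|²)^{1/2}`. -/
def splitNorm (d : Fin 2 → E3 → E3) (s : E3) : ℝ :=
  Real.sqrt (‖d 0 s‖ ^ 2 + ‖d 1 s‖ ^ 2)

/-- The rescaled augmented Lagrangian; `loss Ω` stands for `ℓ(u(Ω), Ω)`. -/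
def lagrangian (loss : Set E3 → ℝ) (β lam : ℝ) (Ω : Set E3) (d b ξ : Fin 2 → E3 → E3) : ℝ :=
  loss Ω + β * (∫ s, splitNorm d s ∂(surfaceMeasure Ω))
    + lam / 2 * (∑ i, ∫ s, ‖splitResidual Ω d b ξ i s‖ ^ 2 ∂(surfaceMeasure Ω))

/-- All surface integrals in the augmented Lagrangian converge. -/
def LagrangianIntegrable (Ω : Set E3) (d b ξ : Fin 2 → E3 → E3) : Prop :=
  Integrable (splitNorm d) (surfaceMeasure Ω) ∧
    ∀ i, Integrable (fun s => ‖splitResidual Ω d b ξ i s‖ ^ 2) (surfaceMeasure Ω)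

/-! ### Transformation of the domain and of the fields -/

/-- The perturbation of identity `T_ε(x) = x + ε V(x)`. -/
def perturb (V : E3 → E3) (ε : ℝ) (x : E3) : E3 := x + ε • V x

/-- A field `f` on `frontier Ω`, passively transformed along with `Ω`: the field `f ∘ T⁻¹` on
`T(frontier Ω)`, i.e. the field with value `f(s)` at `T(s)`. -/
def transport (Ω : Set E3) (T : E3 → E3) (f : E3 → E3) (y : E3) : E3 :=
  f (Function.invFunOn T (frontier Ω) y)

/-- The frame on `T(frontier Ω)` obtained from `ξ₁, ξ₂` by pushing forward with `DT` and
applying the Gram-Schmidt process; its value at `T(s)`, as a function of `s`. -/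
def gramSchmidtFrame (T : E3 → E3) (ξ : Fin 2 → E3 → E3) (i : Fin 2) (s : E3) : E3 :=
  let v₁ := fderiv ℝ T s (ξ 0 s)
  let e₁ := ‖v₁‖⁻¹ • v₁
  let v₂ := fderiv ℝ T s (ξ 1 s)
  let w₂ := v₂ - (inner ℝ e₁ v₂ : ℝ) • e₁
  let e₂ := ‖w₂‖⁻¹ • w₂
  ![e₁, e₂] i

/-- The perturbed frame `ξ_{i,ε}` as a field on `T(frontier Ω)`. -/
def transportedFrame (Ω : Set E3) (T : E3 → E3) (ξ : Fin 2 → E3 → E3) : Fin 2 → E3 → E3 :=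
  fun i => transport Ω T (gramSchmidtFrame T ξ i)

/-- The augmented Lagrangian on the transformed domain `T(Ω)`, with `d_i`, `b_i` passively
transformed and the perturbed frame. -/
def transformedLagrangian (loss : Set E3 → ℝ) (β lam : ℝ) (Ω : Set E3)
    (d b ξ : Fin 2 → E3 → E3) (T : E3 → E3) : ℝ :=
  lagrangian loss β lam (T '' Ω) (fun i => transport Ω T (d i)) (fun i => transport Ω T (b i))
    (transportedFrame Ω T ξ)

/-! ### Shape derivatives

A shape functional is given by its values on the transformed domains (and fields), i.e. as a
function `J` of the transformation `T`; `J id` is the value at `Ω` itself. -/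

/-- `J` has the directional shape (Eulerian) derivative `l` in the direction `V`. -/
def HasShapeDeriv (J : (E3 → E3) → ℝ) (V : E3 → E3) (l : ℝ) : Prop :=
  Tendsto (fun ε : ℝ => (J (perturb V ε) - J id) / ε) (𝓝[>] 0) (𝓝 l)

/-- `J` is shape differentiable: the directional shape derivative exists for all smooth vector
fields `V` on the hold-all `D`, and it is a linear and continuous function of `V`, with respect to
uniform convergence of all derivatives on compact subsets of `D`. -/
def ShapeDifferentiable (D : Set E3) (J : (E3 → E3) → ℝ) : Prop :=
  ∃ L : (E3 → E3) → ℝ,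
    (∀ V, ContDiffOn ℝ ∞ V D → HasShapeDeriv J V (L V)) ∧
    (∀ V W, ContDiffOn ℝ ∞ V D → ContDiffOn ℝ ∞ W D → ∀ c : ℝ,
      L (fun x => V x + c • W x) = L V + c * L W) ∧
    ∃ K ⊆ D, IsCompact K ∧ ∃ (k : ℕ) (C : ℝ), ∀ V, ContDiffOn ℝ ∞ V D → ∀ M : ℝ, 0 ≤ M →
      (∀ j ≤ k, ∀ x ∈ K, ‖iteratedFDeriv ℝ j V x‖ ≤ M) → |L V| ≤ C * M

/-! ### The explicit fields in the derivative -/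

/-- `dn[V] = -(D_Γ V)ᵀ n`. -/
def dNormal (Ω : Set E3) (V : E3 → E3) (s : E3) : E3 :=
  -(ContinuousLinearMap.adjoint (tangentialDeriv Ω V s) (outerNormal Ω s))

/-- `dξ₁[V] = (DV) ξ₁ - (ξ₁ᵀ (DV) ξ₁) ξ₁` and
`dξ₂[V] = (DV) ξ₂ - (ξ₂ᵀ (DV) ξ₂) ξ₂ - (ξ₁ᵀ (DV + DVᵀ) ξ₂) ξ₁`. -/
def dFrame (V : E3 → E3) (ξ : Fin 2 → E3 → E3) (i : Fin 2) (s : E3) : E3 :=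
  let A := fderiv ℝ V s
  let x := ξ 0 s
  let y := ξ 1 s
  ![A x - (inner ℝ x (A x) : ℝ) • x,
    A y - (inner ℝ y (A y) : ℝ) • y
      - (inner ℝ x ((A + ContinuousLinearMap.adjoint A) y) : ℝ) • x] i

/-- `d((D_Γ n) ξ_i)[V] = D_Γ(dn[V]) ξ_i - (D_Γ n)(D_Γ V) ξ_i + (D_Γ n)(dξ_i[V])`. -/
def dNormalDeriv (Ω : Set E3) (V : E3 → E3) (ξ : Fin 2 → E3 → E3) (i : Fin 2) (s : E3) : E3 :=
  tangentialDeriv Ω (dNormal Ω V) s (ξ i s)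
    - tangentialDeriv Ω (outerNormal Ω) s (tangentialDeriv Ω V s (ξ i s))
    + tangentialDeriv Ω (outerNormal Ω) s (dFrame V ξ i s)

end SplitBregman

end

open SplitBregman

noncomputable section

namespace SplitBregman

/-! ### The outer unit normal -/

/-! Everything is pulled back to the fixed surface Γ. For small ε the map `T_ε` agrees near the
closure of Ω with a homeomorphism Ψ of the whole space. The area formula
`IsSmoothDomain.surfaceMeasure_image` then turns integrals over `Γ_ε` into integrals over Γ with
density `J_ε`, the area of the parallelogram spanned by `DT_ε ξ₁` and `DT_ε ξ₂`. The transported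
fields `d_i`, `b_i` pull back to themselves, so ε enters only through `J_ε` and the pulled-back
curvature vectors `H_{i,ε}`, that is, `(D n_ε) ξ_{i,ε}` evaluated at `T_ε(s)`.

The area formula is proved without charts. Near a point of Γ, the surface and its image are both
almost isometric to linear images of a piece of the tangent plane, so their Hausdorff measures
compare up to a factor close to 1. Compactness glues these comparisons, and the factor is sent to 1.

To differentiate `H_{i,ε}`, extend n to a smooth field N. The pulled-back normal is the
normalization `G(ε, x)` of `(DT_ε)⁻ᵀ N(x)`, jointly smooth near `{0} × Γ`. Write `ξ_{i,ε} = DT_ε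
η_{i,ε}` with `η_{i,ε}` tangent to the original Γ. The chain rule cancels `DT_ε` and leaves `H_{i,ε}
= D_x G(ε, s) η_{i,ε}`. The product rule and the symmetry of second derivatives give the stated
material derivative (`hasDerivAt_normalDerivFlow`).

The frame is merely measurable in s. Therefore J and H are treated as functions of ε, a base point
and an orthonormal pair; they are smooth over a compact set of such data. Uniform bounds there
justify differentiation under the integral (`hasDerivAt_surface_integrals`). For part (a), the
integrands in the resulting formula are linear in the first two derivatives of V on Γ, with
integrable weights, which makes the derivative a continuous linear functional. -/

lemma IsOuterUnitNormal.unique {Ω : Set E3} {s ν ν' : E3} (h : IsOuterUnitNormal Ω s ν)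
    (h' : IsOuterUnitNormal Ω s ν') : ν = ν' := by
  by_contra hne
  have hlt : inner ℝ ν ν' < (1 : ℝ) := (inner_lt_one_iff_real_of_norm_eq_one h.1 h'.1).2 hne
  -- The direction `ν' - ν` leads into Ω according to `ν` and out of its closure according to `ν'`.
  have h1 : inner ℝ ν (ν' - ν) < (0 : ℝ) := by
    rw [inner_sub_right, real_inner_self_eq_norm_sq, h.1]; linarith
  have h2 : (0 : ℝ) < inner ℝ ν' (ν' - ν) := by
    rw [inner_sub_right, real_inner_self_eq_norm_sq, h'.1, real_inner_comm]; linarith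
  obtain ⟨t, ht1, ht2⟩ := ((h.2.1 _ h1).and (h'.2.2 _ h2)).exists
  exact ht2 (subset_closure ht1)

lemma IsOuterUnitNormal.outerNormal_eq {Ω : Set E3} {s ν : E3} (h : IsOuterUnitNormal Ω s ν) :
    outerNormal Ω s = ν :=
  IsOuterUnitNormal.unique (Classical.epsilon_spec (p := IsOuterUnitNormal Ω s) ⟨ν, h⟩) h

lemma eq_zero_of_mem_frontier_of_sublevel {Ω U : Set E3} {φ : E3 → ℝ} (hΩ : IsOpen Ω)
    (hU : IsOpen U) (hφ : ContinuousOn φ U) (hΩU : Ω ∩ U = {x ∈ U | φ x < 0}) {x : E3}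
    (hx : x ∈ frontier Ω) (hxU : x ∈ U) : φ x = 0 := by
  rw [hΩ.frontier_eq] at hx
  apply le_antisymm
  · by_contra! hpos
    have hn : ∀ᶠ y in 𝓝 x, 0 < φ y ∧ y ∈ U :=
      ((hφ.continuousAt (hU.mem_nhds hxU)).eventually (lt_mem_nhds hpos)).and (hU.mem_nhds hxU)
    obtain ⟨y, hy, hyΩ⟩ := mem_closure_iff_nhds.1 hx.1 _ hn
    have : y ∈ {x ∈ U | φ x < 0} := hΩU ▸ ⟨hyΩ, hy.2⟩
    exact lt_asymm hy.1 this.2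
  · by_contra! hneg
    have : x ∈ Ω ∩ U := hΩU ▸ ⟨hxU, hneg⟩
    exact hx.2 this.1

/-- Along the ray `s + t • v` the function `φ` starts at 0 with slope `c⟨ν, v⟩`, so for small `t >
0` its sign is that of `⟨ν, v⟩`. A point of `U` where `φ > 0` has a neighbourhood disjoint from Ω.
Only differentiability at `s` is required, so the lemma also applies to image domains not known to
be smooth. -/
lemma isOuterUnitNormal_of_sublevel {Ω U : Set E3} {φ : E3 → ℝ} {s ν : E3} {c : ℝ}
    (hU : IsOpen U) (hsU : s ∈ U) (hφ : ContinuousOn φ U) (hΩU : Ω ∩ U = {x ∈ U | φ x < 0})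
    (hs : φ s = 0) (hν : ‖ν‖ = 1) (hc : 0 < c) (hd : HasFDerivAt φ (c • innerSL ℝ ν) s) :
    IsOuterUnitNormal Ω s ν := by
  have hline (v : E3) : HasDerivAt (fun t : ℝ => φ (s + t • v)) (c * inner ℝ ν v) 0 := by
    have h1 : HasDerivAt (fun t : ℝ => s + t • v) v 0 := by
      simpa using ((hasDerivAt_id (0 : ℝ)).smul_const v).const_add s
    have hd' : HasFDerivAt φ (c • innerSL ℝ ν) (s + (0 : ℝ) • v) := by simpa using hd
    have h2 := hd'.comp_hasDerivAt (0 : ℝ) h1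
    simp only [_root_.smul_apply, innerSL_apply_apply, smul_eq_mul] at h2
    exact h2
  have hmem (v : E3) : ∀ᶠ t : ℝ in 𝓝[>] 0, s + t • v ∈ U := by
    have : Tendsto (fun t : ℝ => s + t • v) (𝓝[>] 0) (𝓝 s) := by
      have h : Continuous (fun t : ℝ => s + t • v) := by fun_prop
      simpa using (h.tendsto 0).mono_left nhdsWithin_le_nhds
    exact this.eventually (hU.mem_nhds hsU)
  have hslope (v : E3) := (hline v).tendsto_slope_zero_right
  refine ⟨hν, fun v hv => ?_, fun v hv => ?_⟩
  · filter_upwards [hmem v, self_mem_nhdsWithin,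
      (hslope v).eventually (gt_mem_nhds (mul_neg_of_pos_of_neg hc hv))] with t ht ht0 hlt
    have ht0 : (0 : ℝ) < t := ht0
    have : φ (s + t • v) < 0 := by
      simp only [zero_add, zero_smul, add_zero, hs, sub_zero, smul_eq_mul] at hlt
      by_contra! hge
      exact absurd hlt (not_lt.2 (mul_nonneg (inv_nonneg.2 ht0.le) hge))
    have h2 : s + t • v ∈ Ω ∩ U := hΩU ▸ ⟨ht, this⟩
    exact h2.1
  · filter_upwards [hmem v, self_mem_nhdsWithin,
      (hslope v).eventually (lt_mem_nhds (mul_pos hc hv))] with t ht ht0 hlt hcl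
    have ht0 : (0 : ℝ) < t := ht0
    have hpos : 0 < φ (s + t • v) := by
      simp only [zero_add, zero_smul, add_zero, hs, sub_zero, smul_eq_mul] at hlt
      by_contra! hge
      exact absurd hlt (not_lt.2 (mul_nonpos_of_nonneg_of_nonpos (inv_nonneg.2 ht0.le) hge))
    have hn : ∀ᶠ y in 𝓝 (s + t • v), 0 < φ y ∧ y ∈ U :=
      ((hφ.continuousAt (hU.mem_nhds ht)).eventually (lt_mem_nhds hpos)).and (hU.mem_nhds ht)
    obtain ⟨y, hy, hyΩ⟩ := mem_closure_iff_nhds.1 hcl _ hn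
    have : y ∈ {x ∈ U | φ x < 0} := hΩU ▸ ⟨hyΩ, hy.2⟩
    exact lt_asymm hy.1 this.2

/-- The vectors orthogonal to the outer unit normal are tangent to the boundary. -/
lemma IsOuterUnitNormal.mem_tangentConeAt {Ω : Set E3} {s ν v : E3}
    (h : IsOuterUnitNormal Ω s ν) (hv : inner ℝ ν v = (0 : ℝ)) :
    v ∈ tangentConeAt ℝ (frontier Ω) s := by
  -- Tilting `v` by `∓δν` gives one endpoint in Ω and one outside its closure. The segment joining
  -- them is connected, hence meets the frontier; letting `δ = 1/(k+1)` tend to 0 produces a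
  -- sequence realizing `v` in the tangent cone.
  have key (k : ℕ) : ∃ t r : ℝ, 0 < t ∧ t < 1 / ((k : ℝ) + 1) ∧ |r| ≤ 1 / ((k : ℝ) + 1) ∧
      s + t • (v + r • ν) ∈ frontier Ω := by
    set δ : ℝ := 1 / ((k : ℝ) + 1) with hδ
    have hδ0 : 0 < δ := by positivity
    have h1 := h.2.1 (v + (-δ) • ν) (by
      rw [inner_add_right, hv, inner_smul_right, real_inner_self_eq_norm_sq, h.1]; simpa using hδ0)
    have h2 := h.2.2 (v + δ • ν) (by
      rw [inner_add_right, hv, inner_smul_right, real_inner_self_eq_norm_sq, h.1]; simpa using hδ0)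
    have h3 : ∀ᶠ t : ℝ in 𝓝[>] 0, t < δ := nhdsWithin_le_nhds (gt_mem_nhds hδ0)
    obtain ⟨t, ⟨⟨ht1, ht2⟩, ht3⟩, ht0⟩ := (((h1.and h2).and h3).and self_mem_nhdsWithin).exists
    have hconn : IsPreconnected ((fun r : ℝ => s + t • (v + r • ν)) '' Set.Icc (-δ) δ) :=
      isPreconnected_Icc.image _ (by fun_prop)
    have hδδ : -δ ≤ δ := by linarith
    have hne : ((fun r : ℝ => s + t • (v + r • ν)) '' Set.Icc (-δ) δ ∩ frontier Ω).Nonempty := by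
      by_contra hemp
      have hnf : ∀ y ∈ (fun r : ℝ => s + t • (v + r • ν)) '' Set.Icc (-δ) δ, y ∈ closure Ω →
          y ∈ interior Ω := fun y hy hcl => by
        by_contra hint
        exact hemp ⟨y, hy, hcl, hint⟩
      have hl := Set.mem_image_of_mem (fun r : ℝ => s + t • (v + r • ν)) (Set.left_mem_Icc.2 hδδ)
      have hr := Set.mem_image_of_mem (fun r : ℝ => s + t • (v + r • ν)) (Set.right_mem_Icc.2 hδδ)
      obtain ⟨y, -, hy1, hy2⟩ := hconn (interior Ω) (closure Ω)ᶜ isOpen_interior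
        isClosed_closure.isOpen_compl
        (fun y hy => (em (y ∈ closure Ω)).imp (hnf y hy) id)
        ⟨_, hl, hnf _ hl (subset_closure ht1)⟩ ⟨_, hr, ht2⟩
      exact hy2 (interior_subset_closure hy1)
    obtain ⟨_, ⟨r, hr, rfl⟩, hrf⟩ := hne
    exact ⟨t, r, ht0, ht3, abs_le.2 hr, hrf⟩
  choose t r ht0 ht1 hr hmem using key
  have htl : Tendsto t atTop (𝓝 0) :=
    squeeze_zero (fun k => (ht0 k).le) (fun k => (ht1 k).le) tendsto_one_div_add_atTop_nhds_zero_nat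
  have hrl : Tendsto r atTop (𝓝 0) :=
    squeeze_zero_norm hr tendsto_one_div_add_atTop_nhds_zero_nat
  have hvl : Tendsto (fun k => v + r k • ν) atTop (𝓝 v) := by
    simpa using tendsto_const_nhds.add (hrl.smul_const ν)
  refine mem_tangentConeAt_of_seq atTop (fun k => (t k)⁻¹) (fun k => t k • (v + r k • ν)) ?_
    (Eventually.of_forall hmem) ?_
  · simpa using htl.smul hvl
  · refine hvl.congr fun k => ?_
    rw [smul_smul, inv_mul_cancel₀ (ht0 k).ne', one_smul]

lemma tangentProj_apply (Ω : Set E3) (s v : E3) :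
    tangentProj Ω s v = v - (inner ℝ (outerNormal Ω s) v : ℝ) • outerNormal Ω s := by
  simp [tangentProj]

lemma tangentProj_of_inner_eq_zero {Ω : Set E3} {s v : E3}
    (hv : inner ℝ (outerNormal Ω s) v = (0 : ℝ)) : tangentProj Ω s v = v := by
  simp [tangentProj_apply, hv]

lemma inner_outerNormal_tangentProj {Ω : Set E3} {s : E3} (h1 : ‖outerNormal Ω s‖ = 1) (v : E3) :
    inner ℝ (outerNormal Ω s) (tangentProj Ω s v) = (0 : ℝ) := by
  rw [tangentProj_apply, inner_sub_right, inner_smul_right, real_inner_self_eq_norm_sq, h1]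
  ring

/-- The tangential derivative is the restriction of the derivative of any extension. -/
lemma tangentialDeriv_eq {Ω : Set E3} {s : E3} (hs : s ∈ frontier Ω)
    (hn : IsOuterUnitNormal Ω s (outerNormal Ω s)) {F F' : E3 → E3} {A : E3 →L[ℝ] E3}
    (hF : HasFDerivAt F' A s) (hFF' : ∀ x ∈ frontier Ω, F x = F' x) :
    tangentialDeriv Ω F s = A.comp (tangentProj Ω s) := by
  have h1 : HasFDerivWithinAt F A (frontier Ω) s :=
    hF.hasFDerivWithinAt.congr hFF' (hFF' s hs)
  ext1 v
  simp only [tangentialDeriv, ContinuousLinearMap.comp_apply]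
  -- Derivatives within the surface agree on its tangent cone, which contains the range of the
  -- projection.
  exact h1.differentiableWithinAt.hasFDerivWithinAt.unique_on h1
    (hn.mem_tangentConeAt (inner_outerNormal_tangentProj hn.1 v))

/-! ### Smooth domains -/

lemma gradient_contDiffOn {U : Set E3} {φ : E3 → ℝ} (hU : IsOpen U) (hφ : ContDiffOn ℝ ∞ φ U) :
    ContDiffOn ℝ ∞ (gradient φ) U := by
  have h := hφ.fderiv_of_isOpen (m := ∞) hU (by simp)
  exact (InnerProductSpace.toDual ℝ E3).symm.contDiff.comp_contDiffOn h

/-- The normalized gradient of any local defining function is the outer normal. The derivative is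
recorded in strict form because chords with two moving endpoints are estimated later. -/
lemma IsSmoothDomain.isOuterUnitNormal_gradient {Ω U : Set E3} (hΩ : IsSmoothDomain Ω)
    {φ : E3 → ℝ} (hU : IsOpen U) (hφ : ContDiffOn ℝ ∞ φ U) (hφ0 : ∀ x ∈ U, fderiv ℝ φ x ≠ 0)
    (hΩU : Ω ∩ U = {x ∈ U | φ x < 0}) {x : E3} (hx : x ∈ frontier Ω) (hxU : x ∈ U) :
    0 < ‖gradient φ x‖ ∧ HasStrictFDerivAt φ (‖gradient φ x‖ • innerSL ℝ (outerNormal Ω x)) x ∧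
    IsOuterUnitNormal Ω x (outerNormal Ω x) ∧
      outerNormal Ω x = ‖gradient φ x‖⁻¹ • gradient φ x := by
  have hne : gradient φ x ≠ 0 := by
    intro h
    exact hφ0 x hxU (by simpa [gradient] using h)
  have hpos : 0 < ‖gradient φ x‖ := norm_pos_iff.2 hne
  have hat := hφ.contDiffAt (hU.mem_nhds hxU)
  have hd : HasStrictFDerivAt φ (‖gradient φ x‖ • innerSL ℝ (‖gradient φ x‖⁻¹ • gradient φ x)) x := by
    have h := hat.hasStrictFDerivAt (by simp)
    suffices he : ‖gradient φ x‖ • innerSL ℝ (‖gradient φ x‖⁻¹ • gradient φ x) = fderiv ℝ φ x by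
      rwa [he]
    ext1 v
    simp only [_root_.smul_apply, innerSL_apply_apply, inner_smul_left, smul_eq_mul]
    rw [← mul_assoc]
    simp only [conj_trivial, mul_inv_cancel₀ hpos.ne', one_mul]
    simp [gradient]
  have hn := isOuterUnitNormal_of_sublevel hU hxU hφ.continuousOn hΩU
    (eq_zero_of_mem_frontier_of_sublevel hΩ.isOpen hU hφ.continuousOn hΩU hx hxU)
    (by rw [norm_smul, norm_inv, norm_norm, inv_mul_cancel₀ hpos.ne']) hpos hd.hasFDerivAt
  rw [hn.outerNormal_eq]
  exact ⟨hpos, hd, hn, rfl⟩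

lemma IsSmoothDomain.isOuterUnitNormal {Ω : Set E3} (hΩ : IsSmoothDomain Ω) {s : E3}
    (hs : s ∈ frontier Ω) : IsOuterUnitNormal Ω s (outerNormal Ω s) := by
  obtain ⟨U, φ, hU, hsU, hφ, hφ0, hΩU⟩ := hΩ.exists_defining s hs
  exact (hΩ.isOuterUnitNormal_gradient hU hφ hφ0 hΩU hs hsU).2.2.1

lemma IsSmoothDomain.isCompact_frontier {Ω : Set E3} (hΩ : IsSmoothDomain Ω) :
    IsCompact (frontier Ω) :=
  hΩ.isBounded.isCompact_closure.of_isClosed_subset isClosed_frontier frontier_subset_closure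

/-- The local extensions `∇φ/‖∇φ‖` are glued by a partition of unity. The pointwise constraint is a
single value on the frontier and void elsewhere, hence convex. -/
lemma IsSmoothDomain.exists_normal_extension {Ω : Set E3} (hΩ : IsSmoothDomain Ω) :
    ∃ N : E3 → E3, ContDiff ℝ ∞ N ∧ ∀ x ∈ frontier Ω, N x = outerNormal Ω x := by
  obtain ⟨g, hg⟩ := exists_contMDiffMap_forall_mem_convex_of_local (n := ⊤) (F := E3)
    (modelWithCornersSelf ℝ E3)
    (t := fun x => {y | x ∈ frontier Ω → y = outerNormal Ω x}) (by
      intro x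
      by_cases hx : x ∈ frontier Ω
      · simp [hx]
      · simp [hx, convex_univ]) (by
      intro x
      by_cases hx : x ∈ frontier Ω
      · obtain ⟨U, φ, hU, hsU, hφ, hφ0, hΩU⟩ := hΩ.exists_defining x hx
        refine ⟨U, hU.mem_nhds hsU, fun y => ‖gradient φ y‖⁻¹ • gradient φ y, ?_, ?_⟩
        · apply ContDiffOn.contMDiffOn
          have hgr := gradient_contDiffOn hU hφ
          have hne : ∀ y ∈ U, gradient φ y ≠ 0 := fun y hy h => hφ0 y hy (by simpa [gradient] using h)
          exact ((hgr.norm ℝ hne).inv fun y hy => norm_ne_zero_iff.2 (hne y hy)).smul hgr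
        · intro y hy hyf
          exact (hΩ.isOuterUnitNormal_gradient hU hφ hφ0 hΩU hyf hy).2.2.2.symm
      · refine ⟨(frontier Ω)ᶜ, isClosed_frontier.isOpen_compl.mem_nhds hx, fun _ => 0,
          contMDiffOn_const, fun y hy hyf => absurd hyf hy⟩)
  exact ⟨g, g.contMDiff.contDiff, fun x hx => hg x hx⟩

/-- Chords of the boundary near `s` are almost orthogonal to the normal at `s`. -/
lemma IsSmoothDomain.exists_abs_inner_le {Ω : Set E3} (hΩ : IsSmoothDomain Ω) {s : E3}
    (hs : s ∈ frontier Ω) {δ : ℝ} (hδ : 0 < δ) :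
    ∃ W ∈ 𝓝 s, ∀ x ∈ W, ∀ y ∈ W, x ∈ frontier Ω → y ∈ frontier Ω →
      |inner ℝ (outerNormal Ω s) (x - y)| ≤ δ * ‖x - y‖ := by
  obtain ⟨U, φ, hU, hsU, hφ, hφ0, hΩU⟩ := hΩ.exists_defining s hs
  obtain ⟨hc, hd, -⟩ := hΩ.isOuterUnitNormal_gradient hU hφ hφ0 hΩU hs hsU
  set c := ‖gradient φ s‖
  -- As `φ` vanishes at both ends of a chord, strict differentiability bounds `c⟨n, x - y⟩` itself
  -- by `cδ‖x - y‖`.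
  have h := hd.isLittleO.bound (mul_pos hc hδ)
  rw [nhds_prod_eq] at h
  obtain ⟨W, hW, hWh⟩ := eventually_prod_self_iff'.1 h
  refine ⟨{x | x ∈ W} ∩ U, inter_mem hW (hU.mem_nhds hsU), fun x hx y hy hxf hyf => ?_⟩
  have h1 := hWh x hx.1 y hy.1
  have h0 {z : E3} := eq_zero_of_mem_frontier_of_sublevel (x := z) hΩ.isOpen hU hφ.continuousOn hΩU
  rw [h0 hxf hx.2, h0 hyf hy.2] at h1
  simp only [sub_self, zero_sub, norm_neg, _root_.smul_apply, innerSL_apply_apply,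
    smul_eq_mul, norm_mul, Real.norm_eq_abs, abs_of_pos hc] at h1
  rw [mul_assoc] at h1
  exact le_of_mul_le_mul_left h1 hc

/-! ### Areas of parallelograms -/

/-- The area of the parallelogram spanned by two vectors. -/
def gramArea (x y : E3) : ℝ := Real.sqrt (‖x‖ ^ 2 * ‖y‖ ^ 2 - (inner ℝ x y) ^ 2)

/-- The linear parametrization of the plane spanned by two vectors. -/
def planeMap (x y : E3) : EuclideanSpace ℝ (Fin 2) →ₗ[ℝ] E3 where
  toFun z := z 0 • x + z 1 • y
  map_add' z w := by simp only [PiLp.add_apply, add_smul]; abel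
  map_smul' c z := by simp only [PiLp.smul_apply, smul_eq_mul, mul_smul, smul_add, RingHom.id_apply]

lemma planeMap_apply (x y : E3) (z : EuclideanSpace ℝ (Fin 2)) :
    planeMap x y z = z 0 • x + z 1 • y := rfl

lemma normDet_planeMap (x y : E3) : (planeMap x y).normDet = gramArea x y := by
  have h := (planeMap x y).normDet_sq_eq_det_gram (EuclideanSpace.basisFun (Fin 2) ℝ)
  rw [Matrix.det_fin_two] at h
  simp only [Matrix.gram_apply, planeMap_apply, EuclideanSpace.basisFun_apply,
    PiLp.single_apply, RCLike.ofReal_real_eq_id, id_eq] at h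
  simp only [↓reduceIte, one_smul, zero_ne_one, one_ne_zero, zero_smul, add_zero, zero_add,
    real_inner_self_eq_norm_sq] at h
  rw [real_inner_comm y x, ← sq (inner ℝ y x)] at h
  rw [gramArea, real_inner_comm, ← h, Real.sqrt_sq (LinearMap.normDet_nonneg _)]

lemma euclideanHausdorffMeasure_image_planeMap (x y : E3) (s : Set (EuclideanSpace ℝ (Fin 2))) :
    (Measure.euclideanHausdorffMeasure 2 : Measure E3) (planeMap x y '' s)
      = ENNReal.ofReal (gramArea x y) * volume s := by
  have h := (planeMap x y).euclideanHausdorffMeasure_image_eq_normDet_mul_volume s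
  rwa [finrank_euclideanSpace_fin, normDet_planeMap] at h

lemma gramArea_pos_iff (x y : E3) : 0 < gramArea x y ↔ Function.Injective (planeMap x y) := by
  rw [← normDet_planeMap, lt_iff_le_and_ne, ← LinearMap.ker_eq_bot, ne_comm, ne_eq,
    LinearMap.normDet_eq_zero_iff_ker_ne_bot, not_not]
  simp [LinearMap.normDet_nonneg]

lemma exists_orthonormalBasis_of_frame {a b n : E3} (ha : ‖a‖ = 1) (hb : ‖b‖ = 1) (hn : ‖n‖ = 1)
    (hab : inner ℝ a b = (0 : ℝ)) (hna : inner ℝ n a = (0 : ℝ)) (hnb : inner ℝ n b = (0 : ℝ)) :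
    ∃ w : OrthonormalBasis (Fin 3) ℝ E3, w 0 = a ∧ w 1 = b ∧ w 2 = n := by
  have hv : Orthonormal ℝ ((Set.univ : Set (Fin 3)).domRestrict ![a, b, n]) := by
    rw [orthonormal_iff_ite]
    have h1 := real_inner_comm a b
    have h2 := real_inner_comm n a
    have h3 := real_inner_comm n b
    rintro ⟨i, -⟩ ⟨j, -⟩
    fin_cases i <;> fin_cases j <;> simp [Set.domRestrict_apply, *]
  obtain ⟨w, hw⟩ := hv.exists_orthonormalBasis_extension_of_card_eq (by simp)
  exact ⟨w, hw 0 trivial, hw 1 trivial, hw 2 trivial⟩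

/-- The squared area of the image under `L` of the unit square in the plane orthogonal to `n`,
expressed without a basis of that plane. -/
def planeJacobianSq (L : E3 →L[ℝ] E3) (n : E3) : ℝ :=
  let S := (ContinuousLinearMap.adjoint L).comp L
  ((LinearMap.trace ℝ E3 (S : E3 →ₗ[ℝ] E3) - inner ℝ n (S n)) ^ 2
    - LinearMap.trace ℝ E3 (S.comp S : E3 →L[ℝ] E3) + 2 * ‖S n‖ ^ 2 - (inner ℝ n (S n)) ^ 2) / 2

/-- In the basis `a, b, n`, the combination in `planeJacobianSq` reduces to the 2×2 minor of `S =
LᵀL` on the plane of `a, b`, which is the Gram determinant. The frame has disappeared from the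
right-hand side, so the Jacobian varies continuously along the surface even where the frame jumps
(`continuousOn_gramArea`). -/
lemma gramArea_map {L : E3 →L[ℝ] E3} {a b n : E3} (ha : ‖a‖ = 1) (hb : ‖b‖ = 1) (hn : ‖n‖ = 1)
    (hab : inner ℝ a b = (0 : ℝ)) (hna : inner ℝ n a = (0 : ℝ)) (hnb : inner ℝ n b = (0 : ℝ)) :
    gramArea (L a) (L b) = Real.sqrt (planeJacobianSq L n) := by
  obtain ⟨w, rfl, rfl, rfl⟩ := exists_orthonormalBasis_of_frame ha hb hn hab hna hnb
  set S := (ContinuousLinearMap.adjoint L).comp L with hS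
  have hin (x y : E3) : inner ℝ x (S y) = (inner ℝ (L x) (L y) : ℝ) := by
    simp [hS, ContinuousLinearMap.adjoint_inner_right]
  have hin2 (x : E3) : inner ℝ x (S (S x)) = ‖S x‖ ^ 2 := by
    rw [hin, ← real_inner_self_eq_norm_sq, hin, real_inner_comm]
  have hsq (x : E3) : ‖S x‖ ^ 2 = (inner ℝ (w 0) (S x)) ^ 2 + (inner ℝ (w 1) (S x)) ^ 2
      + (inner ℝ (w 2) (S x)) ^ 2 := by
    rw [← w.sum_sq_norm_inner_right, Fin.sum_univ_three]
    simp only [Real.norm_eq_abs, sq_abs]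
  rw [gramArea, planeJacobianSq]
  congr 1
  simp only [← hS]
  rw [LinearMap.trace_eq_sum_inner _ w, LinearMap.trace_eq_sum_inner _ w, Fin.sum_univ_three,
    Fin.sum_univ_three]
  simp only [ContinuousLinearMap.coe_coe, ContinuousLinearMap.comp_apply, hin2]
  rw [hsq (w 0), hsq (w 1), hsq (w 2)]
  simp only [hin, real_inner_self_eq_norm_sq]
  rw [real_inner_comm (L (w 0)) (L (w 1)), real_inner_comm (L (w 0)) (L (w 2)),
    real_inner_comm (L (w 1)) (L (w 2))]
  ring

lemma continuous_trace : Continuous fun A : E3 →L[ℝ] E3 => LinearMap.trace ℝ E3 (A : E3 →ₗ[ℝ] E3) :=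
  LinearMap.continuous_of_finiteDimensional
    ((LinearMap.trace ℝ E3).comp (ContinuousLinearMap.coeLM ℝ))

lemma continuous_planeJacobianSq : Continuous fun p : (E3 →L[ℝ] E3) × E3 =>
    planeJacobianSq p.1 p.2 := by
  have hS : Continuous fun p : (E3 →L[ℝ] E3) × E3 =>
      (ContinuousLinearMap.adjoint p.1).comp p.1 :=
    (ContinuousLinearMap.adjoint.continuous.comp continuous_fst).clm_comp continuous_fst
  have h1 := continuous_trace.comp hS
  have h2 := continuous_trace.comp (hS.clm_comp hS)
  have h3 := hS.clm_apply continuous_snd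
  have h4 := continuous_snd.inner (𝕜 := ℝ) h3
  exact (((((h1.sub h4).pow 2).sub h2).add (continuous_const.mul (h3.norm.pow 2))).sub
    (h4.pow 2)).div_const 2

/-! ### Comparison of Hausdorff measures -/

/-- On `A`, `f` factors through `g` by a `K`-Lipschitz map, which multiplies `d`-dimensional measure
by at most `K ^ d`. Injectivity of `g` is not needed: equal values of `g` force equal values of `f`.
-/
lemma euclideanHausdorffMeasure_image_le {α Y Z : Type*} [MetricSpace Y]
    [MetricSpace Z] [MeasurableSpace Y] [BorelSpace Y] [MeasurableSpace Z]
    [BorelSpace Z] {f : α → Y} {g : α → Z} {A : Set α} {K : NNReal} (d : ℕ)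
    (h : ∀ x ∈ A, ∀ y ∈ A, dist (f x) (f y) ≤ K * dist (g x) (g y)) :
    (Measure.euclideanHausdorffMeasure d : Measure Y) (f '' A)
      ≤ (K : ENNReal) ^ d * (Measure.euclideanHausdorffMeasure d : Measure Z) (g '' A) := by
  rcases isEmpty_or_nonempty α with hα | hα
  · simp [Set.eq_empty_of_isEmpty A]
  set i := Function.invFunOn g A
  have hi : ∀ x ∈ A, i (g x) ∈ A ∧ g (i (g x)) = g x := fun x hx =>
    ⟨Function.invFunOn_mem ⟨x, hx, rfl⟩, Function.invFunOn_eq ⟨x, hx, rfl⟩⟩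
  have hlip : LipschitzOnWith K (f ∘ i) (g '' A) := by
    refine LipschitzOnWith.of_dist_le_mul ?_
    rintro _ ⟨x, hx, rfl⟩ _ ⟨y, hy, rfl⟩
    have := h _ (hi x hx).1 _ (hi y hy).1
    rwa [(hi x hx).2, (hi y hy).2] at this
  have himg : f '' A = (f ∘ i) '' (g '' A) := by
    rw [Set.image_image]
    refine Set.image_congr fun x hx => ?_
    have := h x hx _ (hi x hx).1
    rw [(hi x hx).2, dist_self, mul_zero] at this
    exact dist_le_zero.1 this
  rw [himg, Measure.euclideanHausdorffMeasure_def, Measure.euclideanHausdorffMeasure_def,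
    Measure.smul_apply, Measure.smul_apply]
  have := hlip.hausdorffMeasure_image_le (d := d) (by simp)
  rw [ENNReal.rpow_natCast] at this
  rw [mul_smul_comm]
  gcongr

/-- A comparison of measures that holds locally near a compact set, up to factors close to `1`. -/
lemma le_of_locally_le {X : Type*} [TopologicalSpace X] [MeasurableSpace X] [OpensMeasurableSpace X]
    {ν ρ : Measure X} {K : Set X} (hK : IsCompact K) (hν : ν Kᶜ = 0)
    (h : ∀ c : NNReal, 1 < c → ∀ x ∈ K, ∃ W ∈ 𝓝 x, ∀ A, MeasurableSet A → A ⊆ W →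
      ν A ≤ c * ρ A) : ν ≤ ρ := by
  have key (c : NNReal) (hc : 1 < c) : ∃ S ⊇ K, MeasurableSet S ∧ ∀ A, MeasurableSet A → A ⊆ S →
      ν A ≤ c * ρ A := by
    refine hK.induction_on (p := fun K => ∃ S ⊇ K, MeasurableSet S ∧ ∀ A, MeasurableSet A → A ⊆ S →
      ν A ≤ c * ρ A) ?_ ?_ ?_ ?_
    · exact ⟨∅, le_rfl, MeasurableSet.empty, fun A _ hA => by simp [Set.subset_empty_iff.1 hA]⟩
    · rintro s t hst ⟨S, hS, h⟩
      exact ⟨S, hst.trans hS, h⟩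
    -- A measurable subset of `S ∪ T` splits into its parts inside and outside `S`, so gluing two
    -- pieces preserves the constant `c`.
    · rintro s t ⟨S, hS, hSm, h1⟩ ⟨T, hT, hTm, h2⟩
      refine ⟨S ∪ T, Set.union_subset_union hS hT, hSm.union hTm, fun A hA hAST => ?_⟩
      rw [← measure_inter_add_sdiff A hSm, ← measure_inter_add_sdiff (μ := ρ) A hSm, mul_add]
      refine add_le_add (h1 _ (hA.inter hSm) Set.inter_subset_right)
        (h2 _ (hA.diff hSm) fun x hx => (hAST hx.1).resolve_left hx.2)
    · intro x hx
      obtain ⟨W, hW, hWA⟩ := h c hc x hx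
      refine ⟨interior W, mem_nhdsWithin_of_mem_nhds (interior_mem_nhds.2 hW), interior W, le_rfl,
        isOpen_interior.measurableSet, fun A hA hAW => hWA A hA (hAW.trans interior_subset)⟩
  refine Measure.le_iff.2 fun A hA => ?_
  have hc (c : NNReal) (hc : 1 < c) : ν A ≤ c * ρ A := by
    obtain ⟨S, hKS, hS, hSA⟩ := key c hc
    calc ν A ≤ ν (A ∩ S) + ν (A \ S) := by rw [measure_inter_add_sdiff A hS]
      _ = ν (A ∩ S) := by
        rw [measure_mono_null (μ := ν) (fun x (hx : x ∈ A \ S) hxK => hx.2 (hKS hxK)) hν, add_zero]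
      _ ≤ c * ρ (A ∩ S) := hSA _ (hA.inter hS) Set.inter_subset_right
      _ ≤ c * ρ A := by gcongr; exact Set.inter_subset_left
  have hlim : Tendsto (fun c : NNReal => (c : ENNReal) * ρ A) (𝓝[>] 1) (𝓝 (((1 : NNReal) : ENNReal) * ρ A)) := by
    refine ENNReal.Tendsto.mul_const ?_ (Or.inl (by simp))
    exact (ENNReal.continuous_coe.tendsto 1).mono_left nhdsWithin_le_nhds
  have := ge_of_tendsto hlim (eventually_nhdsWithin_of_forall fun c hc' => hc c hc')
  simpa using this

/-! ### The area formula for images of the boundary surface -/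

/-- Coordinates with respect to two vectors. -/
def planeCoord (x y : E3) : E3 →ₗ[ℝ] EuclideanSpace ℝ (Fin 2) where
  toFun v := !₂[inner ℝ x v, inner ℝ y v]
  map_add' v w := by ext i; fin_cases i <;> simp [inner_add_right]
  map_smul' c v := by ext i; fin_cases i <;> simp [inner_smul_right]

lemma planeMap_planeCoord {L : E3 →L[ℝ] E3} {a b n : E3} (ha : ‖a‖ = 1) (hb : ‖b‖ = 1)
    (hn : ‖n‖ = 1) (hab : inner ℝ a b = (0 : ℝ)) (hna : inner ℝ n a = (0 : ℝ))
    (hnb : inner ℝ n b = (0 : ℝ)) (v : E3) :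
    planeMap (L a) (L b) (planeCoord a b v) = L (v - (inner ℝ n v : ℝ) • n) := by
  obtain ⟨w, rfl, rfl, rfl⟩ := exists_orthonormalBasis_of_frame ha hb hn hab hna hnb
  have h := w.sum_repr' v
  rw [Fin.sum_univ_three] at h
  rw [← eq_sub_of_add_eq h]
  simp [planeMap_apply, planeCoord]

/-- Two unit tangent vectors that are orthogonal to each other, at a point with unit normal `n`. -/
structure IsFrameAt (n a b : E3) : Prop where
  norm_normal : ‖n‖ = 1
  norm_fst : ‖a‖ = 1
  norm_snd : ‖b‖ = 1
  inner_fst_snd : inner ℝ a b = (0 : ℝ)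
  inner_normal_fst : inner ℝ n a = (0 : ℝ)
  inner_normal_snd : inner ℝ n b = (0 : ℝ)

lemma IsSmoothDomain.isFrameAt {Ω : Set E3} (hΩ : IsSmoothDomain Ω) {ξ : Fin 2 → E3 → E3}
    (hξ : IsTangentFrame Ω ξ) {s : E3} (hs : s ∈ frontier Ω) :
    IsFrameAt (outerNormal Ω s) (ξ 0 s) (ξ 1 s) :=
  ⟨(hΩ.isOuterUnitNormal hs).1, (hξ s hs).1.1 0, (hξ s hs).1.1 1, (hξ s hs).1.2 (by simp),
    (hξ s hs).2 0, (hξ s hs).2 1⟩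

lemma IsFrameAt.planeMap_planeCoord {n a b : E3} (h : IsFrameAt n a b) (L : E3 →L[ℝ] E3) (v : E3) :
    planeMap (L a) (L b) (planeCoord a b v) = L (v - (inner ℝ n v : ℝ) • n) :=
  SplitBregman.planeMap_planeCoord h.2 h.3 h.1 h.4 h.5 h.6 v

lemma IsFrameAt.gramArea_map {n a b : E3} (h : IsFrameAt n a b) (L : E3 →L[ℝ] E3) :
    gramArea (L a) (L b) = Real.sqrt (planeJacobianSq L n) :=
  SplitBregman.gramArea_map h.2 h.3 h.1 h.4 h.5 h.6

lemma IsFrameAt.gramArea_map_pos {n a b : E3} (h : IsFrameAt n a b) {L : E3 →L[ℝ] E3}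
    (hL : Function.Injective L) : 0 < gramArea (L a) (L b) := by
  rw [gramArea_pos_iff]
  refine (injective_iff_map_eq_zero _).2 fun z hz => ?_
  have hz' : L (z 0 • a + z 1 • b) = L 0 := by
    rw [map_zero, ← hz, planeMap_apply]; simp
  have h0 := hL hz'
  have h1 := congrArg (fun v => inner ℝ a v) h0
  have h2 := congrArg (fun v => inner ℝ b v) h0
  have hba := h.4
  rw [real_inner_comm] at hba
  simp only [inner_add_right, inner_smul_right, real_inner_self_eq_norm_sq, h.2, h.4, h.3, hba,
    inner_zero_right] at h1 h2
  ext i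
  fin_cases i
  · simpa using h1
  · simpa using h2

lemma IsFrameAt.gramArea_eq_one {n a b : E3} (h : IsFrameAt n a b) : gramArea a b = 1 := by
  simp [gramArea, h.2, h.3, h.4]

/-- Near `s`, a map acts on chords of the boundary almost like the restriction of its derivative at
`s` to the tangent plane. -/
lemma IsSmoothDomain.exists_norm_sub_le {Ω : Set E3} (hΩ : IsSmoothDomain Ω) {s : E3}
    (hs : s ∈ frontier Ω) {Ψ : E3 → E3} {L : E3 →L[ℝ] E3} (hΨ : HasStrictFDerivAt Ψ L s)
    (hL : Function.Injective L) {κ : ℝ} (hκ : 1 < κ) :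
    ∃ W ∈ 𝓝 s, ∀ x ∈ W ∩ frontier Ω, ∀ y ∈ W ∩ frontier Ω,
      ‖Ψ x - Ψ y‖ ≤ κ * ‖L (tangentProj Ω s (x - y))‖ ∧
      ‖L (tangentProj Ω s (x - y))‖ ≤ κ * ‖Ψ x - Ψ y‖ := by
  obtain ⟨K, hK, hKL⟩ := (L : E3 →ₗ[ℝ] E3).exists_antilipschitzWith (LinearMap.ker_eq_bot.2 hL)
  have hanti (v : E3) : ‖v‖ ≤ K * ‖L v‖ := by
    simpa using hKL.le_mul_dist v 0
  have hK : (0 : ℝ) < K := hK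
  set η : ℝ := 1 - 1 / κ with hη
  have hκ0 : 0 < κ := by linarith
  have hη0 : 0 < η := by
    have : 1 / κ < 1 := by rw [div_lt_one hκ0]; exact hκ
    linarith
  -- The bound `δ ≤ 1/2` yields `‖e‖ ≤ 2‖p‖ ≤ 2K‖L p‖` for a chord `e` with tangential part `p`. The
  -- other bound makes the total error `δ(1 + ‖L‖)‖e‖` at most `η‖L p‖`. The choice `η = 1 - 1/κ`
  -- gives `1 + η ≤ κ` and `κ(1 - η) = 1`, one for each inequality.
  set δ : ℝ := min (1 / 2) (η / (2 * K * (1 + ‖L‖))) with hδ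
  have hden : 0 < 2 * K * (1 + ‖L‖) := by positivity
  have hδ0 : 0 < δ := by rw [hδ]; positivity
  have hδ1 : δ ≤ 1 / 2 := min_le_left _ _
  have hδ2 : δ * (2 * K * (1 + ‖L‖)) ≤ η := by
    rw [← le_div_iff₀ hden]; exact min_le_right _ _
  obtain ⟨W1, hW1, hW1s⟩ := hΩ.exists_abs_inner_le hs hδ0
  have hb := hΨ.isLittleO.bound hδ0
  rw [nhds_prod_eq] at hb
  obtain ⟨W2, hW2, hW2s⟩ := eventually_prod_self_iff'.1 hb
  refine ⟨W1 ∩ W2, inter_mem hW1 hW2, fun x hx y hy => ?_⟩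
  have h1 := hW1s x hx.1.1 y hy.1.1 hx.2 hy.2
  have h2 := hW2s x hx.1.2 y hy.1.2
  simp only at h2
  set e := x - y
  have hn1 : ‖outerNormal Ω s‖ = 1 := (hΩ.isOuterUnitNormal hs).1
  set p := tangentProj Ω s e with hp
  have hep : ‖e - p‖ ≤ δ * ‖e‖ := by
    rw [hp, tangentProj_apply, sub_sub_cancel, norm_smul, hn1, mul_one]
    exact h1
  have he : ‖e‖ ≤ 2 * K * ‖L p‖ := by
    have h3 : ‖e‖ ≤ ‖e - p‖ + ‖p‖ := by simpa using norm_add_le (e - p) p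
    have h4 := hanti p
    nlinarith [norm_nonneg e]
  have hdiff : ‖(Ψ x - Ψ y) - L p‖ ≤ η * ‖L p‖ := by
    calc ‖(Ψ x - Ψ y) - L p‖ = ‖((Ψ x - Ψ y) - L e) + L (e - p)‖ := by
          rw [map_sub L e p, sub_add_sub_cancel]
      _ ≤ ‖(Ψ x - Ψ y) - L e‖ + ‖L (e - p)‖ := norm_add_le _ _
      _ ≤ δ * ‖e‖ + ‖L‖ * (δ * ‖e‖) := by
          gcongr
          exact (L.le_opNorm _).trans (by gcongr)
      _ = δ * (1 + ‖L‖) * ‖e‖ := by ring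
      _ ≤ δ * (1 + ‖L‖) * (2 * K * ‖L p‖) := by gcongr
      _ = δ * (2 * K * (1 + ‖L‖)) * ‖L p‖ := by ring
      _ ≤ η * ‖L p‖ := by gcongr
  have hκη : κ * η = κ - 1 := by rw [hη]; field_simp
  have hηκ : 1 + η ≤ κ := by nlinarith
  constructor
  · have : ‖Ψ x - Ψ y‖ ≤ ‖(Ψ x - Ψ y) - L p‖ + ‖L p‖ := by
      simpa using norm_add_le ((Ψ x - Ψ y) - L p) (L p)
    nlinarith [norm_nonneg (L p)]
  · have : ‖L p‖ ≤ ‖(Ψ x - Ψ y) - L p‖ + ‖Ψ x - Ψ y‖ := by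
      have := norm_sub_le (Ψ x - Ψ y) ((Ψ x - Ψ y) - L p)
      rw [sub_sub_cancel] at this
      linarith
    have h5 : (1 - η) * ‖L p‖ ≤ ‖Ψ x - Ψ y‖ := by linarith
    have h6 : κ * (1 - η) = 1 := by linarith
    calc ‖L p‖ = κ * ((1 - η) * ‖L p‖) := by rw [← mul_assoc, h6, one_mul]
      _ ≤ κ * ‖Ψ x - Ψ y‖ := by gcongr

/-- Near `s` on the surface, distances under `Ψ` and under its linear model `planeMap (L a) (L b) ∘
planeCoord a b` differ by a factor of at most `κ`, so two-dimensional measures differ by at most `κ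
^ 2`. The model carries planar Lebesgue measure to a constant multiple of area. -/
lemma IsSmoothDomain.exists_area_image_le {Ω : Set E3} (hΩ : IsSmoothDomain Ω) {s a b : E3}
    (hs : s ∈ frontier Ω) (hab : IsFrameAt (outerNormal Ω s) a b)
    {Ψ : E3 → E3} {L : E3 →L[ℝ] E3} (hΨ : HasStrictFDerivAt Ψ L s)
    (hL : Function.Injective L) {κ : NNReal} (hκ : 1 < κ) :
    ∃ W ∈ 𝓝 s, ∀ A ⊆ W ∩ frontier Ω,
      (Measure.euclideanHausdorffMeasure 2 : Measure E3) (Ψ '' A) ≤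
        κ ^ 2 * (ENNReal.ofReal (gramArea (L a) (L b)) * volume (planeCoord a b '' A)) ∧
      ENNReal.ofReal (gramArea (L a) (L b)) * volume (planeCoord a b '' A) ≤
        κ ^ 2 * (Measure.euclideanHausdorffMeasure 2 : Measure E3) (Ψ '' A) := by
  obtain ⟨W, hW, hWs⟩ := hΩ.exists_norm_sub_le hs hΨ hL (κ := κ) (by exact_mod_cast hκ)
  refine ⟨W, hW, fun A hA => ?_⟩
  have hg (x y : E3) : dist (planeMap (L a) (L b) (planeCoord a b x))
      (planeMap (L a) (L b) (planeCoord a b y)) = ‖L (tangentProj Ω s (x - y))‖ := by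
    rw [dist_eq_norm, ← map_sub, ← map_sub, hab.planeMap_planeCoord, tangentProj_apply]
  rw [← euclideanHausdorffMeasure_image_planeMap, Set.image_image]
  constructor
  · refine euclideanHausdorffMeasure_image_le 2 fun x hx y hy => ?_
    rw [hg, dist_eq_norm]
    exact (hWs x (hA hx) y (hA hy)).1
  · refine euclideanHausdorffMeasure_image_le 2 fun x hx y hy => ?_
    rw [hg, dist_eq_norm]
    exact (hWs x (hA hx) y (hA hy)).2

/-- Taking `Ψ` to be the identity bounds the area near a point by a multiple of the area of a
bounded planar set; compactness of the frontier does the rest. -/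
lemma IsSmoothDomain.isFiniteMeasure_surfaceMeasure {Ω : Set E3} (hΩ : IsSmoothDomain Ω)
    {ξ : Fin 2 → E3 → E3} (hξ : IsTangentFrame Ω ξ) : IsFiniteMeasure (surfaceMeasure Ω) := by
  refine ⟨?_⟩
  rw [surfaceMeasure, Measure.restrict_apply_univ]
  refine hΩ.isCompact_frontier.measure_lt_top_of_nhdsWithin fun s hs => ?_
  have hf := hΩ.isFrameAt hξ hs
  obtain ⟨W, hW, hWA⟩ := hΩ.exists_area_image_le hs hf (hasStrictFDerivAt_id s)
    Function.injective_id one_lt_two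
  refine ⟨W ∩ frontier Ω, Filter.inter_mem (mem_nhdsWithin_of_mem_nhds hW) self_mem_nhdsWithin, ?_⟩
  have h := (hWA _ le_rfl).1
  rw [Set.image_id] at h
  refine h.trans_lt (ENNReal.mul_lt_top (by finiteness) (ENNReal.mul_lt_top (by finiteness) ?_))
  refine (measure_mono (Set.image_mono Set.inter_subset_right)).trans_lt ?_
  exact (hΩ.isCompact_frontier.image
    (LinearMap.continuous_of_finiteDimensional _)).measure_lt_top

lemma IsSmoothDomain.continuousOn_gramArea {Ω : Set E3} (hΩ : IsSmoothDomain Ω)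
    {ξ : Fin 2 → E3 → E3} (hξ : IsTangentFrame Ω ξ) {L : E3 → E3 →L[ℝ] E3}
    (hLc : ContinuousOn L (frontier Ω)) :
    ContinuousOn (fun s => gramArea (L s (ξ 0 s)) (L s (ξ 1 s))) (frontier Ω) := by
  obtain ⟨N, hN, hNn⟩ := hΩ.exists_normal_extension
  have h0 : ContinuousOn (fun s => (L s, N s)) (frontier Ω) :=
    hLc.prodMk hN.continuous.continuousOn
  refine (continuous_planeJacobianSq.comp_continuousOn h0).sqrt.congr fun s hs => ?_
  simp only [Function.comp_apply]
  rw [(hΩ.isFrameAt hξ hs).gramArea_map, hNn s hs]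

/-- The area formula. -/
theorem IsSmoothDomain.surfaceMeasure_image {Ω : Set E3} (hΩ : IsSmoothDomain Ω)
    {ξ : Fin 2 → E3 → E3} (hξ : IsTangentFrame Ω ξ) (Ψ : E3 ≃ₜ E3) {L : E3 → E3 →L[ℝ] E3}
    (hΨ : ∀ s ∈ frontier Ω, HasStrictFDerivAt Ψ (L s) s)
    (hL : ∀ s ∈ frontier Ω, Function.Injective (L s)) (hLc : ContinuousOn L (frontier Ω)) :
    surfaceMeasure (Ψ '' Ω) = ((surfaceMeasure Ω).withDensity fun s =>
      ENNReal.ofReal (gramArea (L s (ξ 0 s)) (L s (ξ 1 s)))).map Ψ := by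
  set J : E3 → ENNReal := fun s => ENNReal.ofReal (gramArea (L s (ξ 0 s)) (L s (ξ 1 s))) with hJ
  set μ := surfaceMeasure Ω with hμ
  have hfm : MeasurableSet (frontier Ω) := isClosed_frontier.measurableSet
  have hJc := hΩ.continuousOn_gramArea hξ hLc
  -- The image area is transferred back, so that two measures concentrated on the same compact
  -- surface are compared.
  set ν := (surfaceMeasure (Ψ '' Ω)).map Ψ.symm with hν
  have hνA (A : Set E3) (hA : MeasurableSet A) : ν A =
      (Measure.euclideanHausdorffMeasure 2 : Measure E3) (Ψ '' (A ∩ frontier Ω)) := by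
    rw [hν, Measure.map_apply Ψ.symm.continuous.measurable hA, surfaceMeasure,
      Measure.restrict_apply' isClosed_frontier.measurableSet, ← Ψ.image_frontier,
      ← Ψ.image_eq_preimage_symm, Set.image_inter Ψ.injective]
  have hμA (A : Set E3) (hA : MeasurableSet A) : μ A =
      (Measure.euclideanHausdorffMeasure 2 : Measure E3) (A ∩ frontier Ω) := by
    rw [hμ, surfaceMeasure, Measure.restrict_apply' hfm]
  have hloc (c : NNReal) (hc : 1 < c) (s : E3) (hs : s ∈ frontier Ω) : ∃ W ∈ 𝓝 s,
      ∀ A, MeasurableSet A → A ⊆ W →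
        ν A ≤ c * μ.withDensity J A ∧ μ.withDensity J A ≤ c * ν A := by
    -- The fifth power counts the losses: `κ ^ 2` between `Ψ` and its linear model, `κ ^ 2` between
    -- the surface and its tangent plane, and one `κ` for the variation of the Jacobian near `s`.
    obtain ⟨κ, hκ, hκc⟩ : ∃ κ : NNReal, 1 < κ ∧ κ ^ 5 ≤ c := by
      have : Tendsto (fun κ : NNReal => κ ^ 5) (𝓝[>] 1) (𝓝 1) := by
        have h : Continuous (fun κ : NNReal => κ ^ 5) := by fun_prop
        simpa using (h.tendsto 1).mono_left nhdsWithin_le_nhds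
      obtain ⟨κ, h1, h2⟩ := ((this.eventually (gt_mem_nhds hc)).and self_mem_nhdsWithin).exists
      exact ⟨κ, h2, h1.le⟩
    have hf := hΩ.isFrameAt hξ hs
    obtain ⟨W1, hW1, h1⟩ := hΩ.exists_area_image_le hs hf (hΨ s hs) (hL s hs) hκ
    obtain ⟨W2, hW2, h2⟩ := hΩ.exists_area_image_le hs hf (hasStrictFDerivAt_id s)
      Function.injective_id hκ
    have hJs := hf.gramArea_map_pos (hL s hs)
    set j := gramArea (L s (ξ 0 s)) (L s (ξ 1 s)) with hj
    have hκ0 : (0 : ℝ) < κ := by positivity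
    have hκ1 : (1 : ℝ) < κ := by exact_mod_cast hκ
    have hW3 : ∀ᶠ x in 𝓝[frontier Ω] s, gramArea (L x (ξ 0 x)) (L x (ξ 1 x)) < κ * j ∧
        j < κ * gramArea (L x (ξ 0 x)) (L x (ξ 1 x)) := by
      have hc1 := hJc s hs
      refine (hc1.eventually (gt_mem_nhds ?_)).and
        ((tendsto_const_nhds.mul hc1).eventually (lt_mem_nhds ?_))
      · exact lt_mul_of_one_lt_left hJs hκ1
      · exact lt_mul_of_one_lt_left hJs hκ1
    rw [eventually_nhdsWithin_iff] at hW3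
    refine ⟨W1 ∩ W2 ∩ _, inter_mem (inter_mem hW1 hW2) hW3, fun A hA hAW => ?_⟩
    have hA1 := h1 (A ∩ frontier Ω) (Set.inter_subset_inter_left _ fun x hx => (hAW hx).1.1)
    have hA2 := h2 (A ∩ frontier Ω) (Set.inter_subset_inter_left _ fun x hx => (hAW hx).1.2)
    rw [← hνA A hA] at hA1
    rw [Set.image_id, ← hμA A hA] at hA2
    simp only [ContinuousLinearMap.id_apply, hf.gramArea_eq_one, ENNReal.ofReal_one, one_mul] at hA2
    set vol := volume (planeCoord (ξ 0 s) (ξ 1 s) '' (A ∩ frontier Ω))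
    have hint : μ.withDensity J A = ∫⁻ x in A ∩ frontier Ω, J x ∂(Measure.euclideanHausdorffMeasure 2) := by
      rw [withDensity_apply _ hA, hμ, surfaceMeasure, Measure.restrict_restrict hA]
    have hle1 : μ.withDensity J A ≤ κ * ENNReal.ofReal j * μ A := by
      rw [hint, hμA A hA, ← setLIntegral_const]
      refine setLIntegral_mono measurable_const fun x hx => ?_
      rw [hJ, ← ENNReal.ofReal_coe_nnreal, ← ENNReal.ofReal_mul hκ0.le]
      exact ENNReal.ofReal_le_ofReal ((hAW hx.1).2 hx.2).1.le
    have hle2 : ENNReal.ofReal j * μ A ≤ κ * μ.withDensity J A := by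
      rw [hint, hμA A hA, ← setLIntegral_const, ← lintegral_const_mul' _ _ (by simp)]
      refine setLIntegral_mono' (hA.inter hfm) fun x hx => ?_
      rw [hJ, ← ENNReal.ofReal_coe_nnreal, ← ENNReal.ofReal_mul hκ0.le]
      exact ENNReal.ofReal_le_ofReal ((hAW hx.1).2 hx.2).2.le
    have hκc' : (κ : ENNReal) ^ 5 ≤ c := by exact_mod_cast hκc
    constructor
    · calc ν A ≤ κ ^ 2 * (ENNReal.ofReal j * vol) := hA1.1
        _ ≤ κ ^ 2 * (ENNReal.ofReal j * (κ ^ 2 * μ A)) := by gcongr; exact hA2.2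
        _ = κ ^ 4 * (ENNReal.ofReal j * μ A) := by ring
        _ ≤ κ ^ 4 * (κ * μ.withDensity J A) := by gcongr
        _ = κ ^ 5 * μ.withDensity J A := by ring
        _ ≤ c * μ.withDensity J A := by gcongr
    · calc μ.withDensity J A ≤ κ * ENNReal.ofReal j * μ A := hle1
        _ ≤ κ * ENNReal.ofReal j * (κ ^ 2 * vol) := by gcongr; exact hA2.1
        _ = κ ^ 3 * (ENNReal.ofReal j * vol) := by ring
        _ ≤ κ ^ 3 * (κ ^ 2 * ν A) := mul_le_mul' le_rfl hA1.2
        _ = κ ^ 5 * ν A := by ring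
        _ ≤ c * ν A := by gcongr
  have hρ0 : μ.withDensity J (frontier Ω)ᶜ = 0 := by
    refine withDensity_absolutelyContinuous _ _ ?_
    rw [hμA _ hfm.compl]; simp
  have hν0 : ν (frontier Ω)ᶜ = 0 := by rw [hνA _ hfm.compl]; simp
  have heq : ν = μ.withDensity J := by
    apply le_antisymm
    · refine le_of_locally_le hΩ.isCompact_frontier hν0 fun c hc s hs => ?_
      obtain ⟨W, hW, h⟩ := hloc c hc s hs
      exact ⟨W, hW, fun A hA hAW => (h A hA hAW).1⟩
    · refine le_of_locally_le hΩ.isCompact_frontier hρ0 fun c hc s hs => ?_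
      obtain ⟨W, hW, h⟩ := hloc c hc s hs
      exact ⟨W, hW, fun A hA hAW => (h A hA hAW).2⟩
  rw [← heq, hν, Measure.map_map Ψ.continuous.measurable Ψ.symm.continuous.measurable]
  simp

/-! ### Perturbations of the identity -/

/-- For small `ε`, the perturbation of the identity agrees near a compact set with a homeomorphism
of the whole space. -/
lemma exists_homeomorph_eq_perturb {D K : Set E3} (hD : IsOpen D) (hK : IsCompact K) (hKD : K ⊆ D)
    {V : E3 → E3} (hV : ContDiffOn ℝ ∞ V D) :
    ∃ W, IsOpen W ∧ K ⊆ W ∧ ∀ᶠ ε : ℝ in 𝓝 0, ∃ Ψ : E3 ≃ₜ E3, ∀ x ∈ W, Ψ x = perturb V ε x := by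
  obtain ⟨K', hK', hKK', hK'D⟩ := exists_compact_between hK hD hKD
  obtain ⟨χ, hχ1, hχ0, -⟩ := exists_contMDiffMap_one_nhds_of_subset_interior (n := ⊤)
    (modelWithCornersSelf ℝ E3) hK.isClosed hKK'
  have hχ : ContDiff ℝ ∞ χ := χ.contMDiff.contDiff
  -- The cutoff makes the field globally Lipschitz with some constant `C`. For `|ε| C < 1` the map
  -- `id + εV'` is a small Lipschitz perturbation of the identity, hence a homeomorphism of the
  -- space.
  set V' : E3 → E3 := fun x => χ x • V x with hV'
  have hV's : ContDiff ℝ ∞ V' := by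
    rw [contDiff_iff_contDiffAt]
    intro x
    by_cases hx : x ∈ D
    · exact hχ.contDiffAt.smul (hV.contDiffAt (hD.mem_nhds hx))
    · have : V' =ᶠ[𝓝 x] fun _ => 0 := by
        filter_upwards [hK'.isClosed.isOpen_compl.mem_nhds fun h => hx (hK'D h)] with y hy
        simp [hV', hχ0 y hy]
      exact contDiffAt_const.congr_of_eventuallyEq this
  have hcs : HasCompactSupport V' := HasCompactSupport.intro hK' fun x hx => by simp [hV', hχ0 x hx]
  obtain ⟨C, hC⟩ := ContDiff.lipschitzWith_of_hasCompactSupport (𝕂 := ℝ) hcs hV's (by simp)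
  obtain ⟨W, hWo, hKW, hW⟩ := eventually_nhdsSet_iff_exists.1 hχ1
  refine ⟨W, hWo, hKW, ?_⟩
  have hsmall : ∀ᶠ ε : ℝ in 𝓝 0, ‖ε‖₊ * C < 1 := by
    have h : Continuous fun ε : ℝ => ‖ε‖₊ * C := by fun_prop
    have := h.tendsto 0
    simp only [nnnorm_zero, zero_mul] at this
    exact this.eventually (gt_mem_nhds one_pos)
  filter_upwards [hsmall] with ε hε
  have happ : ApproximatesLinearOn (perturb V' ε) ((ContinuousLinearEquiv.refl ℝ E3 : E3 ≃L[ℝ] E3) : E3 →L[ℝ] E3)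
      Set.univ (‖ε‖₊ * C) := by
    intro x _ y _
    have h1 : perturb V' ε x - perturb V' ε y - (x - y) = ε • (V' x - V' y) := by
      simp only [perturb, smul_sub]; abel
    have h2 := hC.norm_sub_le x y
    simp only [ContinuousLinearEquiv.coe_refl, ContinuousLinearMap.id_apply, h1, norm_smul]
    push_cast
    rw [mul_assoc]
    gcongr
  refine ⟨happ.toHomeomorph _ (Or.inr ?_), fun x hx => ?_⟩
  · simpa using hε
  · have : happ.toHomeomorph _ (Or.inr (by simpa using hε)) x = perturb V' ε x := rfl
    rw [this, perturb, perturb, hV']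
    simp [hW x hx]

/-! ### Normals and tangential derivatives on transformed domains -/

/-- The unit normal transforms by the inverse transpose of the derivative. -/
def pushNormal (L : E3 →L[ℝ] E3) (n : E3) : E3 :=
  ‖ContinuousLinearMap.adjoint (Ring.inverse L) n‖⁻¹ • ContinuousLinearMap.adjoint (Ring.inverse L) n

lemma exists_equiv_of_isUnit {L : E3 →L[ℝ] E3} (hL : IsUnit L) :
    ∃ e : E3 ≃L[ℝ] E3, (e : E3 →L[ℝ] E3) = L ∧ (e.symm : E3 →L[ℝ] E3) = Ring.inverse L := by
  obtain ⟨u, rfl⟩ := hL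
  refine ⟨ContinuousLinearEquiv.unitsEquiv ℝ E3 u, rfl, ?_⟩
  rw [Ring.inverse_unit]
  rfl

/-- The function `φ ∘ Ψ⁻¹` defines the image domain near `Ψ s`, and its gradient there is a positive
multiple of `L⁻ᵀ n`. -/
lemma IsSmoothDomain.isOuterUnitNormal_image {Ω : Set E3} (hΩ : IsSmoothDomain Ω) {s : E3}
    (hs : s ∈ frontier Ω) (Ψ : E3 ≃ₜ E3) {L : E3 →L[ℝ] E3} (hL : IsUnit L)
    (hΨ : HasFDerivAt Ψ L s) :
    IsOuterUnitNormal (Ψ '' Ω) (Ψ s) (pushNormal L (outerNormal Ω s)) := by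
  obtain ⟨e, rfl, he⟩ := exists_equiv_of_isUnit hL
  obtain ⟨U, φ, hU, hsU, hφ, hφ0, hΩU⟩ := hΩ.exists_defining s hs
  obtain ⟨hc, hd, hn, -⟩ := hΩ.isOuterUnitNormal_gradient hU hφ hφ0 hΩU hs hsU
  rw [pushNormal, ← he]
  set c := ‖gradient φ s‖
  set n := outerNormal Ω s
  set q := ContinuousLinearMap.adjoint (e.symm : E3 →L[ℝ] E3) n with hq
  have hqpos : 0 < ‖q‖ := by
    rw [norm_pos_iff]
    intro h0
    have h1 : inner ℝ q (e n) = (1 : ℝ) := by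
      rw [hq, ContinuousLinearMap.adjoint_inner_left]
      simp [hn.1, n]
    rw [h0, inner_zero_left] at h1
    exact zero_ne_one h1
  have hsymm : HasFDerivAt Ψ.symm (e.symm : E3 →L[ℝ] E3) (Ψ s) := by
    refine HasFDerivAt.of_local_left_inverse (f := Ψ) Ψ.symm.continuous.continuousAt ?_ ?_
    · simpa using hΨ
    · exact Eventually.of_forall fun y => Ψ.apply_symm_apply y
  have hd' : HasFDerivAt φ (c • innerSL ℝ n) (Ψ.symm (Ψ s)) := by simpa using hd.hasFDerivAt
  have hcomp := hd'.comp (Ψ s) hsymm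
  refine isOuterUnitNormal_of_sublevel (U := Ψ '' U) (φ := φ ∘ Ψ.symm) (c := c * ‖q‖)
    (Ψ.isOpenMap U hU) ⟨s, hsU, rfl⟩ ?_ ?_ ?_ ?_ (mul_pos hc hqpos) ?_
  · refine hφ.continuousOn.comp Ψ.symm.continuous.continuousOn ?_
    rintro _ ⟨x, hx, rfl⟩
    simpa using hx
  · rw [← Set.image_inter Ψ.injective, hΩU]
    ext y
    constructor
    · rintro ⟨x, ⟨hx, hx0⟩, rfl⟩
      exact ⟨⟨x, hx, rfl⟩, by simpa using hx0⟩
    · rintro ⟨⟨x, hx, rfl⟩, hx0⟩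
      exact ⟨x, ⟨hx, by simpa using hx0⟩, rfl⟩
  · simpa using eq_zero_of_mem_frontier_of_sublevel hΩ.isOpen hU hφ.continuousOn hΩU hs hsU
  · rw [norm_smul, norm_inv, norm_norm, inv_mul_cancel₀ hqpos.ne']
  · have hA : (c * ‖q‖) • innerSL ℝ (‖q‖⁻¹ • q) = (c • innerSL ℝ n).comp (e.symm : E3 →L[ℝ] E3) := by
      ext1 v
      simp only [_root_.smul_apply, innerSL_apply_apply, real_inner_smul_left,
        ContinuousLinearMap.comp_apply, smul_eq_mul]
      rw [hq, ContinuousLinearMap.adjoint_inner_left, ← hq]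
      field_simp
    rwa [hA]

/-- The derivative of the normal field of the transformed domain along the image of a tangent vector
`v`; here `G` extends the transformed normal field, pulled back to `Ω`. -/
lemma IsSmoothDomain.tangentialDeriv_outerNormal_image {Ω : Set E3} (hΩ : IsSmoothDomain Ω)
    {s : E3} (hs : s ∈ frontier Ω) (Ψ : E3 ≃ₜ E3) {L : E3 → E3 →L[ℝ] E3}
    (hL : ∀ x ∈ frontier Ω, IsUnit (L x)) (hΨ : ∀ x ∈ frontier Ω, HasFDerivAt Ψ (L x) x)
    {G : E3 → E3} {A : E3 →L[ℝ] E3} (hG : HasFDerivAt G A s)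
    (hGn : ∀ x ∈ frontier Ω, G x = pushNormal (L x) (outerNormal Ω x)) {v : E3}
    (hv : inner ℝ (outerNormal Ω s) v = (0 : ℝ)) :
    tangentialDeriv (Ψ '' Ω) (outerNormal (Ψ '' Ω)) (Ψ s) (L s v) = A v := by
  have hn (x : E3) (hx : x ∈ frontier Ω) := hΩ.isOuterUnitNormal_image hx Ψ (hL x hx) (hΨ x hx)
  obtain ⟨e, he, he'⟩ := exists_equiv_of_isUnit (hL s hs)
  have hsymm : HasFDerivAt Ψ.symm (e.symm : E3 →L[ℝ] E3) (Ψ s) := by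
    refine HasFDerivAt.of_local_left_inverse (f := Ψ) Ψ.symm.continuous.continuousAt ?_ ?_
    · simpa [he] using hΨ s hs
    · exact Eventually.of_forall fun y => Ψ.apply_symm_apply y
  have hG' : HasFDerivAt G A (Ψ.symm (Ψ s)) := by simpa using hG
  have hcomp := hG'.comp (Ψ s) hsymm
  have hsΨ : Ψ s ∈ frontier (Ψ '' Ω) := by
    rw [← Ψ.image_frontier]; exact ⟨s, hs, rfl⟩
  have hν := hn s hs
  rw [← hν.outerNormal_eq] at hν
  -- `G ∘ Ψ⁻¹` extends the new normal field and has derivative `A L⁻¹` at `Ψ s`; on the tangent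
  -- vector `L v` this is `A v`.
  rw [tangentialDeriv_eq hsΨ hν hcomp]
  · have h0 : inner ℝ (outerNormal (Ψ '' Ω) (Ψ s)) (L s v) = (0 : ℝ) := by
      rw [(hn s hs).outerNormal_eq, pushNormal, real_inner_smul_left,
        ContinuousLinearMap.adjoint_inner_left, ← he', ← he]
      simp [hv]
    rw [ContinuousLinearMap.comp_apply, tangentProj_of_inner_eq_zero h0, ← he]
    simp
  · rw [← Ψ.image_frontier]
    rintro _ ⟨x, hx, rfl⟩
    rw [(hn x hx).outerNormal_eq, Function.comp_apply, Ψ.symm_apply_apply, hGn x hx]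

/-! ### The transformed normal field and frame as smooth functions of the parameter -/

/-- Taking adjoints, as a real linear map. -/
def adjointR : (E3 →L[ℝ] E3) →L[ℝ] (E3 →L[ℝ] E3) :=
  LinearMap.mkContinuous
    { toFun := fun A => ContinuousLinearMap.adjoint A
      map_add' := fun A B => map_add _ A B
      map_smul' := fun c A => by simp } 1 (fun A => by simp)

@[simp] lemma adjointR_apply (A : E3 →L[ℝ] E3) : adjointR A = ContinuousLinearMap.adjoint A := rfl

/-- The derivative of `perturb V ε` at `x`, as a function of `(ε, x)`. -/
def perturbDeriv (V : E3 → E3) (p : ℝ × E3) : E3 →L[ℝ] E3 := 1 + p.1 • fderiv ℝ V p.2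

lemma perturbDeriv_zero (V : E3 → E3) (x : E3) : perturbDeriv V (0, x) = 1 :=
  (congrArg (1 + ·) (zero_smul ℝ (fderiv ℝ V x))).trans (add_zero 1)

lemma hasFDerivAt_perturb {V : E3 → E3} {x : E3} (hV : ContDiffAt ℝ ∞ V x) (ε : ℝ) :
    HasStrictFDerivAt (perturb V ε) (perturbDeriv V (ε, x)) x :=
  (hasStrictFDerivAt_id x).add ((hV.hasStrictFDerivAt (by simp)).const_smul ε)

lemma contDiffAt_perturbDeriv {V : E3 → E3} {x : E3} (hV : ContDiffAt ℝ ∞ V x) (ε : ℝ) :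
    ContDiffAt ℝ ∞ (perturbDeriv V) (ε, x) := by
  have h1 : ContDiffAt ℝ ∞ (fderiv ℝ V) x := hV.fderiv_right (by simp)
  exact contDiffAt_const.add (contDiffAt_fst.smul (h1.comp (ε, x) contDiffAt_snd))

/-- The transformed normal field, pulled back to the original domain, with the normal field of the
latter extended by `N`. -/
def normalFlow (V N : E3 → E3) (p : ℝ × E3) : E3 := pushNormal (perturbDeriv V p) (N p.2)

lemma normalFlow_zero (V N : E3 → E3) (x : E3) : normalFlow V N (0, x) = ‖N x‖⁻¹ • N x := by
  have h : ContinuousLinearMap.adjoint (1 : E3 →L[ℝ] E3) = 1 := ContinuousLinearMap.adjoint_id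
  simp [normalFlow, pushNormal, perturbDeriv_zero, h]

/-- Inversion is smooth near the identity and normalization is smooth away from 0. The smoothness is
joint in ε and x, as the later exchange of derivatives requires. -/
lemma contDiffAt_normalFlow {V N : E3 → E3} {x : E3} (hV : ContDiffAt ℝ ∞ V x)
    (hN : ContDiffAt ℝ ∞ N x) (hNx : N x ≠ 0) : ContDiffAt ℝ ∞ (normalFlow V N) (0, x) := by
  have h1 : ContDiffAt ℝ ∞ Ring.inverse (perturbDeriv V (0, x)) := by
    rw [perturbDeriv_zero]
    exact contDiffAt_ringInverse ℝ (1 : (E3 →L[ℝ] E3)ˣ)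
  have h2 : ContDiffAt ℝ ∞ (fun p => adjointR (Ring.inverse (perturbDeriv V p)) (N p.2)) (0, x) :=
    (adjointR.contDiff.contDiffAt.comp _
      (h1.comp (0, x) (contDiffAt_perturbDeriv hV 0))).clm_apply (hN.comp (0, x) contDiffAt_snd)
  have h3 : adjointR (Ring.inverse (perturbDeriv V (0, x))) (N x) ≠ 0 := by
    have h : ContinuousLinearMap.adjoint (1 : E3 →L[ℝ] E3) = 1 := ContinuousLinearMap.adjoint_id
    simpa [perturbDeriv_zero, h] using hNx
  exact ((h2.norm ℝ h3).inv (norm_ne_zero_iff.2 h3)).smul h2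

lemma hasDerivAt_norm_of_norm_eq_one {f : ℝ → E3} {f' : E3} {t : ℝ} (hf : HasDerivAt f f' t)
    (h1 : ‖f t‖ = 1) : HasDerivAt (fun r => ‖f r‖) (inner ℝ (f t) f') t := by
  have h := hf.norm_sq.sqrt (by simp [h1])
  simp only [Real.sqrt_sq (norm_nonneg _), h1] at h
  simpa using h

lemma hasDerivAt_inv_norm_of_norm_eq_one {f : ℝ → E3} {f' : E3} {t : ℝ} (hf : HasDerivAt f f' t)
    (h1 : ‖f t‖ = 1) : HasDerivAt (fun r => ‖f r‖⁻¹) (-inner ℝ (f t) f') t := by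
  have h := (hasDerivAt_norm_of_norm_eq_one hf h1).inv (by rw [h1]; exact one_ne_zero)
  simpa [h1] using! h

lemma hasDerivAt_one_add_smul {R : Type*} [NormedRing R] [NormedAlgebra ℝ R] (B : R) (t : ℝ) :
    HasDerivAt (fun ε : ℝ => 1 + ε • B) B t := by
  simpa using! ((hasDerivAt_id t).smul_const B).const_add 1

lemma hasDerivAt_ringInverse_one_add_smul {R : Type*} [NormedRing R] [NormedAlgebra ℝ R]
    [CompleteSpace R] (B : R) : HasDerivAt (fun ε : ℝ => Ring.inverse (1 + ε • B)) (-B) 0 := by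
  have h1 : HasFDerivAt Ring.inverse (-ContinuousLinearMap.mulLeftRight ℝ R 1 1)
      (1 + (0 : ℝ) • B) := by
    simpa using hasFDerivAt_ringInverse (𝕜 := ℝ) (1 : Rˣ)
  simpa using! h1.comp_hasDerivAt (0 : ℝ) (hasDerivAt_one_add_smul B 0)

lemma hasDerivAt_perturbDeriv (V : E3 → E3) (x : E3) (t : ℝ) :
    HasDerivAt (fun ε => perturbDeriv V (ε, x)) (fderiv ℝ V x) t :=
  hasDerivAt_one_add_smul (fderiv ℝ V x) t

/-- The inverse of `1 + εDV` has derivative `-DV`, which contributes `-(DV)ᵀ n`. Differentiating the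
normalizing factor cancels the normal component of that vector. -/
lemma hasDerivAt_normalFlow (V N : E3 → E3) {x : E3} (hN : ‖N x‖ = 1) :
    HasDerivAt (fun ε => normalFlow V N (ε, x))
      (-(ContinuousLinearMap.adjoint (fderiv ℝ V x) (N x)) +
        (inner ℝ (N x) (fderiv ℝ V x (N x)) : ℝ) • N x) 0 := by
  have hadj : ContinuousLinearMap.adjoint (1 : E3 →L[ℝ] E3) = 1 := ContinuousLinearMap.adjoint_id
  have h2 : HasDerivAt (fun ε => Ring.inverse (perturbDeriv V (ε, x))) (-fderiv ℝ V x) 0 :=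
    hasDerivAt_ringInverse_one_add_smul (fderiv ℝ V x)
  have h3 := (adjointR.hasFDerivAt.comp_hasDerivAt (0 : ℝ) h2).clm_apply (hasDerivAt_const (0 : ℝ) (N x))
  have h0 : adjointR (Ring.inverse (perturbDeriv V (0, x))) (N x) = N x := by
    simp [perturbDeriv_zero, hadj]
  have h4 := hasDerivAt_inv_norm_of_norm_eq_one h3 ((congrArg norm h0).trans hN)
  have h5 := h4.smul h3
  refine h5.congr_deriv ?_
  simp only [Function.comp_apply, h0, hN]
  simp [ContinuousLinearMap.adjoint_inner_right, real_inner_comm]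

/-- The frame of Gram-Schmidt vectors, pulled back by the derivative of the perturbation, as a
function of `(ε, x, a, b)`, where `a, b` is the frame at `x`. -/
def frameFlow (V : E3 → E3) (i : Fin 2) (p : ℝ × E3 × E3 × E3) : E3 :=
  let L := perturbDeriv V (p.1, p.2.1)
  let v₁ := L p.2.2.1
  let e₁ := ‖v₁‖⁻¹ • v₁
  let v₂ := L p.2.2.2
  let w₂ := v₂ - (inner ℝ e₁ v₂ : ℝ) • e₁
  ![‖v₁‖⁻¹ • p.2.2.1, ‖w₂‖⁻¹ • (p.2.2.2 - ((inner ℝ e₁ v₂ : ℝ) * ‖v₁‖⁻¹) • p.2.2.1)] i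

/-- Pulled back by `DT_ε`, the Gram–Schmidt frame is a combination of `ξ₁, ξ₂`, hence lies in the
fixed tangent plane of Γ (`inner_frameFlow`). This is what lets the chain rule remove `DT_ε`. -/
lemma perturbDeriv_frameFlow {V : E3 → E3} {s : E3} (hV : ContDiffAt ℝ ∞ V s) (ε : ℝ)
    (ξ : Fin 2 → E3 → E3) (i : Fin 2) :
    perturbDeriv V (ε, s) (frameFlow V i (ε, s, ξ 0 s, ξ 1 s)) =
      gramSchmidtFrame (perturb V ε) ξ i s := by
  have h := (hasFDerivAt_perturb hV ε).hasFDerivAt.fderiv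
  fin_cases i
  · simp [frameFlow, gramSchmidtFrame, h]
  · simp [frameFlow, gramSchmidtFrame, h, mul_smul]

lemma inner_frameFlow {V : E3 → E3} {n a b : E3} (ha : inner ℝ n a = (0 : ℝ))
    (hb : inner ℝ n b = (0 : ℝ)) (i : Fin 2) (ε : ℝ) (x : E3) :
    inner ℝ n (frameFlow V i (ε, x, a, b)) = (0 : ℝ) := by
  fin_cases i <;> simp [frameFlow, inner_smul_right, inner_sub_right, ha, hb]

/-- A pair of orthonormal vectors over a point of a set. -/
def frameSet (K : Set E3) : Set (E3 × E3 × E3) :=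
  {q | q.1 ∈ K ∧ ‖q.2.1‖ = 1 ∧ ‖q.2.2‖ = 1 ∧ inner ℝ q.2.1 q.2.2 = (0 : ℝ)}

/-- Since the frame need not depend continuously on the point, uniformity over the surface comes
from letting base point and frame vectors vary independently in this compact set. -/
lemma isCompact_frameSet {K : Set E3} (hK : IsCompact K) : IsCompact (frameSet K) := by
  refine (hK.prod ((isCompact_sphere (0 : E3) 1).prod (isCompact_sphere (0 : E3) 1))).of_isClosed_subset
    ?_ ?_
  · refine (hK.isClosed.preimage continuous_fst).inter (IsClosed.inter ?_ (IsClosed.inter ?_ ?_))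
    · exact isClosed_eq (by fun_prop) continuous_const
    · exact isClosed_eq (by fun_prop) continuous_const
    · exact isClosed_eq (by fun_prop) continuous_const
  · rintro ⟨x, a, b⟩ ⟨h1, h2, h3, -⟩
    exact ⟨h1, by simpa using h2, by simpa using h3⟩

lemma contDiffAt_frameFlow {V : E3 → E3} {q : E3 × E3 × E3} (hV : ContDiffAt ℝ ∞ V q.1)
    (ha : ‖q.2.1‖ = 1) (hb : ‖q.2.2‖ = 1) (hab : inner ℝ q.2.1 q.2.2 = (0 : ℝ)) (i : Fin 2) :
    ContDiffAt ℝ ∞ (frameFlow V i) (0, q) := by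
  obtain ⟨x, a, b⟩ := q
  have hL : ContDiffAt ℝ ∞ (fun p : ℝ × E3 × E3 × E3 => perturbDeriv V (p.1, p.2.1)) (0, x, a, b) :=
    (contDiffAt_perturbDeriv hV 0).comp (f := fun p : ℝ × E3 × E3 × E3 => (p.1, p.2.1)) (0, x, a, b)
      (contDiffAt_fst.prodMk (contDiffAt_fst.comp _ contDiffAt_snd))
  have hA : ContDiffAt ℝ ∞ (fun p : ℝ × E3 × E3 × E3 => p.2.2.1) (0, x, a, b) := by fun_prop
  have hB : ContDiffAt ℝ ∞ (fun p : ℝ × E3 × E3 × E3 => p.2.2.2) (0, x, a, b) := by fun_prop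
  have hv1 := hL.clm_apply hA
  have hv2 := hL.clm_apply hB
  have h1 : (1 : E3 →L[ℝ] E3) a ≠ 0 := by
    rw [one_apply_eq_self, ← norm_ne_zero_iff, ha]; exact one_ne_zero
  have hn1 := (hv1.norm ℝ (by simpa [perturbDeriv_zero] using h1)).inv
    (by simpa [perturbDeriv_zero] using h1)
  have he1 := hn1.smul hv1
  have hc := he1.inner ℝ hv2
  have hw := hv2.sub (hc.smul he1)
  have h2 : ‖(1 : E3 →L[ℝ] E3) b‖ ≠ 0 := by
    rw [one_apply_eq_self, hb]; exact one_ne_zero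
  have hw0 : perturbDeriv V (0, x) b - (inner ℝ (‖perturbDeriv V (0, x) a‖⁻¹ • perturbDeriv V (0, x) a)
      (perturbDeriv V (0, x) b) : ℝ) • (‖perturbDeriv V (0, x) a‖⁻¹ • perturbDeriv V (0, x) a) ≠ 0 := by
    simp only at hab ha
    rw [← norm_ne_zero_iff]
    simpa [perturbDeriv_zero, hab, ha] using h2
  fin_cases i
  · exact hn1.smul hA
  · exact ((hw.norm ℝ hw0).inv (norm_ne_zero_iff.2 hw0)).smul (hB.sub ((hc.mul hn1).smul hA))

lemma frameFlow_zero (V : E3 → E3) {x a b : E3} (ha : ‖a‖ = 1) (hb : ‖b‖ = 1)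
    (hab : inner ℝ a b = (0 : ℝ)) (i : Fin 2) : frameFlow V i (0, x, a, b) = ![a, b] i := by
  fin_cases i <;> simp [frameFlow, perturbDeriv_zero, ha, hb, hab]

/-- Since `ξ_ε = (1 + εDV) η_ε`, the velocity of the pulled-back frame `η_ε` at 0 is that of `ξ_ε`
minus `(DV) ξ`. -/
lemma hasDerivAt_frameFlow (V : E3 → E3) {s : E3} {ξ : Fin 2 → E3 → E3} (ha : ‖ξ 0 s‖ = 1)
    (hb : ‖ξ 1 s‖ = 1) (hab : inner ℝ (ξ 0 s) (ξ 1 s) = (0 : ℝ)) (i : Fin 2) :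
    HasDerivAt (fun ε => frameFlow V i (ε, s, ξ 0 s, ξ 1 s))
      (dFrame V ξ i s - fderiv ℝ V s (ξ i s)) 0 := by
  have hba : inner ℝ (ξ 1 s) (ξ 0 s) = (0 : ℝ) := by rw [real_inner_comm]; exact hab
  have hv (v : E3) : HasDerivAt (fun ε => perturbDeriv V (ε, s) v) (fderiv ℝ V s v) 0 := by
    simpa using! (hasDerivAt_perturbDeriv V s 0).clm_apply (hasDerivAt_const (0 : ℝ) v)
  have hv0 (v : E3) : perturbDeriv V (0, s) v = v := by simp [perturbDeriv_zero]
  have hn1 := hasDerivAt_inv_norm_of_norm_eq_one (hv (ξ 0 s)) (by rw [hv0, ha])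
  have he1 := hn1.smul (hv (ξ 0 s))
  have hc := he1.inner ℝ (hv (ξ 1 s))
  have hw := (hv (ξ 1 s)).sub (hc.smul he1)
  have hn2 := hasDerivAt_inv_norm_of_norm_eq_one hw (by simp [hv0, ha, hab, hb])
  fin_cases i
  · have h := hn1.smul_const (ξ 0 s)
    refine h.congr_deriv ?_
    simp [dFrame, hv0]
  · have h := hn2.smul ((hc.mul hn1).smul_const (ξ 0 s) |>.const_sub (ξ 1 s))
    refine h.congr_deriv ?_
    simp [dFrame, hv0, ha, hab, hba, inner_add_left, inner_add_right, inner_sub_right, inner_smul_left, inner_smul_right,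
      ContinuousLinearMap.adjoint_inner_right, hb]
    module

/-! ### Derivatives at the unperturbed domain -/

/-- The derivative of the transformed normal field along the transformed frame, as a function of
`(ε, x, a, b)`, where `a, b` is the frame at `x`. -/
def normalDerivFlow (V N : E3 → E3) (i : Fin 2) (p : ℝ × E3 × E3 × E3) : E3 :=
  fderiv ℝ (normalFlow V N) (p.1, p.2.1) (0, frameFlow V i p)

/-- The surface Jacobian of the perturbation, as a function of `(ε, x, a, b)`, where `a, b` is the
frame at `x`. -/
def areaFlow (V : E3 → E3) (p : ℝ × E3 × E3 × E3) : ℝ :=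
  gramArea (perturbDeriv V (p.1, p.2.1) p.2.2.1) (perturbDeriv V (p.1, p.2.1) p.2.2.2)

lemma contDiffAt_normalDerivFlow {V N : E3 → E3} {q : E3 × E3 × E3} (hV : ContDiffAt ℝ ∞ V q.1)
    (hN : ContDiffAt ℝ ∞ N q.1) (hNx : N q.1 ≠ 0) (ha : ‖q.2.1‖ = 1) (hb : ‖q.2.2‖ = 1)
    (hab : inner ℝ q.2.1 q.2.2 = (0 : ℝ)) (i : Fin 2) :
    ContDiffAt ℝ ∞ (normalDerivFlow V N i) (0, q) := by
  have h1 : ContDiffAt ℝ ∞ (fderiv ℝ (normalFlow V N)) (0, q.1) :=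
    (contDiffAt_normalFlow hV hN hNx).fderiv_right (by simp)
  have h2 : ContDiffAt ℝ ∞ (fun p : ℝ × E3 × E3 × E3 =>
      fderiv ℝ (normalFlow V N) (p.1, p.2.1)) (0, q) :=
    h1.comp (f := fun p : ℝ × E3 × E3 × E3 => (p.1, p.2.1)) (0, q)
      (contDiffAt_fst.prodMk (contDiffAt_fst.comp _ contDiffAt_snd))
  exact h2.clm_apply (contDiffAt_const.prodMk (contDiffAt_frameFlow hV ha hb hab i))

lemma contDiffAt_areaFlow {V : E3 → E3} {q : E3 × E3 × E3} (hV : ContDiffAt ℝ ∞ V q.1)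
    (ha : ‖q.2.1‖ = 1) (hb : ‖q.2.2‖ = 1) (hab : inner ℝ q.2.1 q.2.2 = (0 : ℝ)) :
    ContDiffAt ℝ ∞ (areaFlow V) (0, q) := by
  obtain ⟨x, a, b⟩ := q
  have hL : ContDiffAt ℝ ∞ (fun p : ℝ × E3 × E3 × E3 => perturbDeriv V (p.1, p.2.1)) (0, x, a, b) :=
    (contDiffAt_perturbDeriv hV 0).comp (f := fun p : ℝ × E3 × E3 × E3 => (p.1, p.2.1)) (0, x, a, b)
      (contDiffAt_fst.prodMk (contDiffAt_fst.comp _ contDiffAt_snd))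
  have hA : ContDiffAt ℝ ∞ (fun p : ℝ × E3 × E3 × E3 => p.2.2.1) (0, x, a, b) := by fun_prop
  have hB : ContDiffAt ℝ ∞ (fun p : ℝ × E3 × E3 × E3 => p.2.2.2) (0, x, a, b) := by fun_prop
  have hv1 := hL.clm_apply hA
  have hv2 := hL.clm_apply hB
  refine (((hv1.norm_sq ℝ).mul (hv2.norm_sq ℝ)).sub ((hv1.inner ℝ hv2).pow 2)).sqrt ?_
  simp only at ha hb hab
  simp [perturbDeriv_zero, ha, hb, hab]

/-- The right-hand side is the ε-derivative found in `hasDerivAt_normalFlow`. With an extension `N`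
in place of the normal it also makes sense off the surface, so it can be differentiated there. -/
lemma dNormal_eq {Ω : Set E3} {s : E3} (hs : s ∈ frontier Ω)
    (hn : IsOuterUnitNormal Ω s (outerNormal Ω s)) {V : E3 → E3} {B : E3 →L[ℝ] E3}
    (hV : HasFDerivAt V B s) :
    dNormal Ω V s = -(ContinuousLinearMap.adjoint B (outerNormal Ω s)) +
      (inner ℝ (outerNormal Ω s) (B (outerNormal Ω s)) : ℝ) • outerNormal Ω s := by
  rw [dNormal, tangentialDeriv_eq hs hn hV fun _ _ => rfl, neg_eq_iff_eq_neg]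
  refine ext_inner_right ℝ fun w => ?_
  rw [ContinuousLinearMap.adjoint_inner_left, neg_add, neg_neg, inner_add_left,
    ContinuousLinearMap.adjoint_inner_left, ContinuousLinearMap.comp_apply, tangentProj_apply,
    map_sub, map_smul, inner_sub_right, inner_smul_right, inner_neg_left, real_inner_smul_left]
  ring

lemma surfaceDiv_eq {Ω : Set E3} {s a b : E3} (hf : IsFrameAt (outerNormal Ω s) a b)
    (V : E3 → E3) : surfaceDiv Ω V s = inner ℝ a (fderiv ℝ V s a) + inner ℝ b (fderiv ℝ V s b) := by
  obtain ⟨w, h0, h1, h2⟩ := exists_orthonormalBasis_of_frame hf.2 hf.3 hf.1 hf.4 hf.5 hf.6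
  rw [surfaceDiv, LinearMap.trace_eq_sum_inner _ w, Fin.sum_univ_three, h0, h1, h2]
  simp

/-- At ε = 0 the Gram matrix is the identity, so the derivative of the root of its determinant is
half the trace of its derivative, `⟨a, DV a⟩ + ⟨b, DV b⟩`. -/
lemma hasDerivAt_areaFlow {Ω : Set E3} {s a b : E3} (hf : IsFrameAt (outerNormal Ω s) a b)
    (V : E3 → E3) : HasDerivAt (fun ε => areaFlow V (ε, s, a, b)) (surfaceDiv Ω V s) 0 := by
  have hv (v : E3) : HasDerivAt (fun ε => perturbDeriv V (ε, s) v) (fderiv ℝ V s v) 0 := by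
    simpa using! (hasDerivAt_perturbDeriv V s 0).clm_apply (hasDerivAt_const (0 : ℝ) v)
  have hv0 (v : E3) : perturbDeriv V (0, s) v = v := by simp [perturbDeriv_zero]
  have h := (((hv a).norm_sq.mul (hv b).norm_sq).sub (((hv a).inner ℝ (hv b)).pow 2)).sqrt
    (by simp [hv0, hf.2, hf.3, hf.4])
  refine h.congr_deriv ?_
  rw [surfaceDiv_eq hf]
  simp [hv0, hf.2, hf.3, hf.4]
  ring

/-- `N` is a smooth extension of the outer unit normal field. -/
structure IsNormalExtension (Ω : Set E3) (N : E3 → E3) : Prop where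
  contDiff : ContDiff ℝ ∞ N
  eq_outerNormal : ∀ x ∈ frontier Ω, N x = outerNormal Ω x

lemma IsNormalExtension.norm_eq_one {Ω : Set E3} (hΩ : IsSmoothDomain Ω) {N : E3 → E3}
    (hN : IsNormalExtension Ω N) {x : E3} (hx : x ∈ frontier Ω) : ‖N x‖ = 1 := by
  rw [hN.eq_outerNormal x hx]; exact (hΩ.isOuterUnitNormal hx).1

lemma IsNormalExtension.ne_zero {Ω : Set E3} (hΩ : IsSmoothDomain Ω) {N : E3 → E3}
    (hN : IsNormalExtension Ω N) {x : E3} (hx : x ∈ frontier Ω) : N x ≠ 0 :=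
  norm_ne_zero_iff.1 (by rw [hN.norm_eq_one hΩ hx]; exact one_ne_zero)

lemma hasDerivAt_prodMk_left' (x : E3) (t : ℝ) :
    HasDerivAt (fun ε : ℝ => (ε, x)) ((1 : ℝ), (0 : E3)) t :=
  (hasDerivAt_id t).prodMk (hasDerivAt_const t x)

lemma tangentialDeriv_outerNormal_eq {Ω : Set E3} (hΩ : IsSmoothDomain Ω) {V N : E3 → E3}
    (hV : ∀ x ∈ frontier Ω, ContDiffAt ℝ ∞ V x) (hN : IsNormalExtension Ω N) {s : E3}
    (hs : s ∈ frontier Ω) (v : E3) : tangentialDeriv Ω (outerNormal Ω) s v =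
      fderiv ℝ (normalFlow V N) (0, s) (0, tangentProj Ω s v) := by
  have hG := contDiffAt_normalFlow (hV s hs) hN.contDiff.contDiffAt (hN.ne_zero hΩ hs)
  have hd := (hG.differentiableAt (by simp)).hasFDerivAt.comp s
    (hasFDerivAt_prodMk_right (𝕜 := ℝ) (0 : ℝ) s)
  rw [tangentialDeriv_eq hs (hΩ.isOuterUnitNormal hs) hd fun x hx => ?_]
  · rfl
  · rw [Function.comp_apply, normalFlow_zero, hN.norm_eq_one hΩ hx, hN.eq_outerNormal x hx, inv_one,
      one_smul]

/-- On the surface `dn[V]` is the ε-derivative of `normalFlow` at 0, and that expression extends it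
to a neighbourhood of the point. Its tangential derivative is therefore a mixed second derivative.
-/
lemma tangentialDeriv_dNormal_eq {Ω : Set E3} (hΩ : IsSmoothDomain Ω) {V N : E3 → E3}
    (hV : ∀ x ∈ frontier Ω, ContDiffAt ℝ ∞ V x) (hN : IsNormalExtension Ω N) {s : E3}
    (hs : s ∈ frontier Ω) (v : E3) : tangentialDeriv Ω (dNormal Ω V) s v =
      fderiv ℝ (fderiv ℝ (normalFlow V N)) (0, s) (0, tangentProj Ω s v) (1, 0) := by
  have hG (x : E3) (hx : x ∈ frontier Ω) :=
    contDiffAt_normalFlow (hV x hx) hN.contDiff.contDiffAt (hN.ne_zero hΩ hx)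
  have hG2 := (((hG s hs).fderiv_right (m := ∞) (by simp)).differentiableAt (by simp)).hasFDerivAt
  have hd := (hG2.comp s (hasFDerivAt_prodMk_right (𝕜 := ℝ) (0 : ℝ) s)).clm_apply
    (hasFDerivAt_const ((1 : ℝ), (0 : E3)) s)
  rw [tangentialDeriv_eq hs (hΩ.isOuterUnitNormal hs) hd fun x hx => ?_]
  · simp
  · have h1 := ((hG x hx).differentiableAt (by simp)).hasFDerivAt.comp_hasDerivAt (0 : ℝ)
      (hasDerivAt_prodMk_left' x 0)
    have h2 := hasDerivAt_normalFlow V N (hN.norm_eq_one hΩ hx)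
    rw [dNormal_eq hx (hΩ.isOuterUnitNormal hx)
      ((hV x hx).differentiableAt (by simp)).hasFDerivAt, ← hN.eq_outerNormal x hx]
    exact h2.unique h1

/-- A curve that stays in the tangent plane has its velocity there. -/
lemma tangentProj_deriv_frameFlow {Ω : Set E3} {ξ : Fin 2 → E3 → E3} {s : E3}
    (hf : IsFrameAt (outerNormal Ω s) (ξ 0 s) (ξ 1 s)) (V : E3 → E3) (i : Fin 2) :
    tangentProj Ω s (dFrame V ξ i s - fderiv ℝ V s (ξ i s)) =
      dFrame V ξ i s - fderiv ℝ V s (ξ i s) := by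
  refine tangentProj_of_inner_eq_zero ?_
  have h1 := (hasDerivAt_const (0 : ℝ) (outerNormal Ω s)).inner ℝ
    (hasDerivAt_frameFlow V (ξ := ξ) hf.2 hf.3 hf.4 i)
  have h2 : HasDerivAt (fun ε : ℝ => (inner ℝ (outerNormal Ω s)
      (frameFlow V i (ε, s, ξ 0 s, ξ 1 s)) : ℝ)) 0 0 := by
    simp only [inner_frameFlow hf.5 hf.6]
    exact hasDerivAt_const _ _
  simpa using h1.unique h2

/-- With `G = normalFlow V N`, the product rule gives `(∂_ε D_x G) ξ_i + (D_x G) η_i'`. Symmetry of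
the second derivative turns the first term into `D_Γ(dn[V]) ξ_i`. The second is `D_Γ n` applied to
`dξ_i[V] - (DV) ξ_i`, and `(DV) ξ_i = (D_Γ V) ξ_i` because `ξ_i` is tangent. -/
lemma hasDerivAt_normalDerivFlow {Ω : Set E3} (hΩ : IsSmoothDomain Ω) {ξ : Fin 2 → E3 → E3}
    (hξ : IsTangentFrame Ω ξ) {V N : E3 → E3} (hV : ∀ x ∈ frontier Ω, ContDiffAt ℝ ∞ V x)
    (hN : IsNormalExtension Ω N) {s : E3} (hs : s ∈ frontier Ω) (i : Fin 2) :
    HasDerivAt (fun ε => normalDerivFlow V N i (ε, s, ξ 0 s, ξ 1 s)) (dNormalDeriv Ω V ξ i s) 0 := by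
  have hf := hΩ.isFrameAt hξ hs
  have hG := contDiffAt_normalFlow (hV s hs) hN.contDiff.contDiffAt (hN.ne_zero hΩ hs)
  have hG2 := ((hG.fderiv_right (m := ∞) (by simp)).differentiableAt (by simp)).hasFDerivAt
  have hη0 : frameFlow V i (0, s, ξ 0 s, ξ 1 s) = ξ i s := by
    rw [frameFlow_zero V hf.2 hf.3 hf.4]
    fin_cases i <;> rfl
  have hη := hasDerivAt_frameFlow V (ξ := ξ) hf.2 hf.3 hf.4 i
  have h1 : HasDerivAt (fun ε : ℝ => fderiv ℝ (normalFlow V N) (ε, s))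
      (fderiv ℝ (fderiv ℝ (normalFlow V N)) (0, s) (1, 0)) 0 :=
    hG2.comp_hasDerivAt (0 : ℝ) (hasDerivAt_prodMk_left' s 0)
  have h2 : HasDerivAt (fun ε : ℝ => ((0 : ℝ), frameFlow V i (ε, s, ξ 0 s, ξ 1 s)))
      (0, dFrame V ξ i s - fderiv ℝ V s (ξ i s)) 0 := (hasDerivAt_const (0 : ℝ) (0 : ℝ)).prodMk hη
  have hmain := h1.clm_apply h2
  have hsymm : IsSymmSndFDerivAt ℝ (normalFlow V N) (0, s) :=
    hG.isSymmSndFDerivAt (by rw [minSmoothness_of_isRCLikeNormedField]; exact WithTop.coe_le_coe.2 le_top)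
  have hVs := ((hV s hs).differentiableAt (by simp)).hasFDerivAt
  have hPξ := tangentProj_of_inner_eq_zero ((hξ s hs).2 i)
  have heq : dNormalDeriv Ω V ξ i s =
      fderiv ℝ (fderiv ℝ (normalFlow V N)) (0, s) (1, 0) (0, ξ i s) +
        fderiv ℝ (normalFlow V N) (0, s) (0, dFrame V ξ i s - fderiv ℝ V s (ξ i s)) := by
    rw [dNormalDeriv, sub_add_eq_add_sub, add_sub_assoc, ← map_sub,
      tangentialDeriv_eq hs (hΩ.isOuterUnitNormal hs) hVs fun _ _ => rfl,
      ContinuousLinearMap.comp_apply, hPξ, tangentialDeriv_outerNormal_eq hΩ hV hN hs,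
      tangentProj_deriv_frameFlow hf, tangentialDeriv_dNormal_eq hΩ hV hN hs, hPξ, hsymm.eq]
  rw [heq]
  refine HasDerivAt.congr_deriv (f' := fderiv ℝ (fderiv ℝ (normalFlow V N)) (0, s) (1, 0)
    (0, frameFlow V i (0, s, ξ 0 s, ξ 1 s)) + fderiv ℝ (normalFlow V N) (0, s)
      (0, dFrame V ξ i s - fderiv ℝ V s (ξ i s))) ?_ (by rw [hη0])
  exact hmain

/-! ### The transformed Lagrangian as an integral over the original boundary -/

/-- `Ψ` is a homeomorphism of the space that agrees with `perturb V ε` near the closure of `Ω`, and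
`ε` is so small that the perturbed surface is regular. -/
structure IsGoodPerturbation (Ω : Set E3) (V N : E3 → E3) (ε : ℝ) (Ψ : E3 ≃ₜ E3) : Prop where
  eq_perturb : ∀ x ∈ closure Ω, Ψ x = perturb V ε x
  isUnit : ∀ x ∈ frontier Ω, IsUnit (perturbDeriv V (ε, x))
  hasStrictFDerivAt : ∀ x ∈ frontier Ω, HasStrictFDerivAt Ψ (perturbDeriv V (ε, x)) x
  continuousOn : ContinuousOn (fun x => perturbDeriv V (ε, x)) (frontier Ω)
  contDiffAt : ∀ x ∈ frontier Ω, ContDiffAt ℝ ∞ V x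
  differentiableAt : ∀ x ∈ frontier Ω, DifferentiableAt ℝ (normalFlow V N) (ε, x)

/-- Invertibility of `DT_ε` and the `C¹` property of `normalFlow` are open conditions valid at `(0,
x)` for each boundary point `x`; compactness makes the range of ε uniform. -/
lemma eventually_isGoodPerturbation {Ω D : Set E3} (hΩ : IsSmoothDomain Ω) (hD : IsOpen D)
    (hΩD : closure Ω ⊆ D) {V N : E3 → E3} (hV : ContDiffOn ℝ ∞ V D) (hN : IsNormalExtension Ω N) :
    ∀ᶠ ε : ℝ in 𝓝 0, ∃ Ψ, IsGoodPerturbation Ω V N ε Ψ := by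
  obtain ⟨W, hW, hΩW, hΨ⟩ := exists_homeomorph_eq_perturb hD hΩ.isBounded.isCompact_closure hΩD hV
  have hVat (x : E3) (hx : x ∈ frontier Ω) : ContDiffAt ℝ ∞ V x :=
    hV.contDiffAt (hD.mem_nhds (hΩD (frontier_subset_closure hx)))
  have hunit : ∀ᶠ ε : ℝ in 𝓝 0, ∀ x ∈ frontier Ω, IsUnit (perturbDeriv V (ε, x)) := by
    refine hΩ.isCompact_frontier.eventually_forall_of_forall_eventually fun x hx => ?_
    have hc := (contDiffAt_perturbDeriv (hVat x hx) 0).continuousAt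
    refine hc.eventually (p := IsUnit) ?_
    rw [perturbDeriv_zero]
    exact Units.isOpen.mem_nhds isUnit_one
  have hdiff : ∀ᶠ ε : ℝ in 𝓝 0, ∀ x ∈ frontier Ω,
      DifferentiableAt ℝ (normalFlow V N) (ε, x) := by
    refine hΩ.isCompact_frontier.eventually_forall_of_forall_eventually fun x hx => ?_
    have h := (contDiffAt_normalFlow (hVat x hx) hN.contDiff.contDiffAt
      (hN.ne_zero hΩ hx)).of_le (m := 1) (by simp)
    exact (h.eventually (by simp)).mono fun z hz => hz.differentiableAt (by simp)
  filter_upwards [hΨ, hunit, hdiff] with ε ⟨Ψ, h1⟩ h2 h3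
  refine ⟨Ψ, fun x hx => h1 x (hΩW hx), h2, fun x hx => ?_, fun x hx => ?_, hVat, h3⟩
  · refine (hasFDerivAt_perturb (hVat x hx) ε).congr_of_eventuallyEq ?_
    filter_upwards [hW.mem_nhds (hΩW (frontier_subset_closure hx))] with y hy
    exact (h1 y hy).symm
  · have h := (contDiffAt_perturbDeriv (hVat x hx) ε).continuousAt
    exact (h.comp (f := fun y => (ε, y)) (by fun_prop)).continuousWithinAt

lemma areaFlow_nonneg (V : E3 → E3) (p : ℝ × E3 × E3 × E3) : 0 ≤ areaFlow V p := Real.sqrt_nonneg _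

namespace IsGoodPerturbation

variable {Ω : Set E3} {V N : E3 → E3} {ε : ℝ} {Ψ : E3 ≃ₜ E3}

lemma image_eq (h : IsGoodPerturbation Ω V N ε Ψ) : perturb V ε '' Ω = Ψ '' Ω :=
  Set.image_congr fun x hx => (h.eq_perturb x (subset_closure hx)).symm

lemma transport_apply (h : IsGoodPerturbation Ω V N ε Ψ) (f : E3 → E3) {s : E3}
    (hs : s ∈ frontier Ω) : transport Ω (perturb V ε) f (Ψ s) = f s := by
  have hinj : Set.InjOn (perturb V ε) (frontier Ω) := by
    intro x hx y hy hxy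
    rw [← h.eq_perturb x (frontier_subset_closure hx),
      ← h.eq_perturb y (frontier_subset_closure hy)] at hxy
    exact Ψ.injective hxy
  rw [transport, h.eq_perturb s (frontier_subset_closure hs), hinj.leftInvOn_invFunOn hs]

/-- The perturbed frame vector is `DT_ε` of a tangent vector of Γ, and `DT_ε` cancels against the
derivative of `Ψ⁻¹`. Only the spatial derivative of `normalFlow` along the pulled-back frame
remains. -/
lemma normalDeriv_eq (h : IsGoodPerturbation Ω V N ε Ψ) (hΩ : IsSmoothDomain Ω)
    (hN : IsNormalExtension Ω N) {ξ : Fin 2 → E3 → E3} (hξ : IsTangentFrame Ω ξ) (i : Fin 2)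
    {s : E3} (hs : s ∈ frontier Ω) :
    normalDeriv (perturb V ε '' Ω) (transportedFrame Ω (perturb V ε) ξ i) (Ψ s) =
      normalDerivFlow V N i (ε, s, ξ 0 s, ξ 1 s) := by
  have hf := hΩ.isFrameAt hξ hs
  have hd : HasFDerivAt (fun x => normalFlow V N (ε, x))
      ((fderiv ℝ (normalFlow V N) (ε, s)).comp (ContinuousLinearMap.inr ℝ ℝ E3)) s :=
    (h.differentiableAt s hs).hasFDerivAt.comp s (hasFDerivAt_prodMk_right (𝕜 := ℝ) ε s)
  rw [normalDeriv, transportedFrame, h.transport_apply _ hs, h.image_eq,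
    ← perturbDeriv_frameFlow (h.contDiffAt s hs),
    hΩ.tangentialDeriv_outerNormal_image hs Ψ (L := fun x => perturbDeriv V (ε, x)) h.isUnit
      (fun x hx => (h.hasStrictFDerivAt x hx).hasFDerivAt) hd (fun x hx => ?_)
      (inner_frameFlow hf.5 hf.6 i ε s)]
  · rfl
  · rw [normalFlow, hN.eq_outerNormal x hx]

lemma surfaceMeasure_eq (h : IsGoodPerturbation Ω V N ε Ψ) (hΩ : IsSmoothDomain Ω)
    {ξ : Fin 2 → E3 → E3} (hξ : IsTangentFrame Ω ξ) :
    surfaceMeasure (perturb V ε '' Ω) = ((surfaceMeasure Ω).withDensity fun s =>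
      ENNReal.ofReal (areaFlow V (ε, s, ξ 0 s, ξ 1 s))).map Ψ := by
  rw [h.image_eq]
  refine hΩ.surfaceMeasure_image hξ Ψ (L := fun x => perturbDeriv V (ε, x)) h.hasStrictFDerivAt
    (fun s hs => ?_) h.continuousOn
  obtain ⟨e, he, -⟩ := exists_equiv_of_isUnit (h.isUnit s hs)
  simp only [← he]
  exact e.injective

lemma aemeasurable_areaFlow (h : IsGoodPerturbation Ω V N ε Ψ) (hΩ : IsSmoothDomain Ω)
    {ξ : Fin 2 → E3 → E3} (hξ : IsTangentFrame Ω ξ) :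
    AEMeasurable (fun s => ENNReal.ofReal (areaFlow V (ε, s, ξ 0 s, ξ 1 s))) (surfaceMeasure Ω) := by
  refine AEMeasurable.ennreal_ofReal ?_
  exact (hΩ.continuousOn_gramArea hξ h.continuousOn).aemeasurable
    isClosed_frontier.measurableSet

lemma integrable_iff (h : IsGoodPerturbation Ω V N ε Ψ) (hΩ : IsSmoothDomain Ω)
    {ξ : Fin 2 → E3 → E3} (hξ : IsTangentFrame Ω ξ) {f g : E3 → ℝ}
    (hfg : ∀ s ∈ frontier Ω, f (Ψ s) = g s) :
    Integrable f (surfaceMeasure (perturb V ε '' Ω)) ↔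
      Integrable (fun s => areaFlow V (ε, s, ξ 0 s, ξ 1 s) * g s) (surfaceMeasure Ω) := by
  rw [h.surfaceMeasure_eq hΩ hξ, Ψ.measurableEmbedding.integrable_map_iff,
    integrable_withDensity_iff_integrable_smul₀' (h.aemeasurable_areaFlow hΩ hξ) (by simp)]
  refine integrable_congr ?_
  filter_upwards [ae_restrict_mem isClosed_frontier.measurableSet] with s hs
  rw [Function.comp_apply, hfg s hs, smul_eq_mul, ENNReal.toReal_ofReal (areaFlow_nonneg _ _)]

lemma integral_eq (h : IsGoodPerturbation Ω V N ε Ψ) (hΩ : IsSmoothDomain Ω)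
    {ξ : Fin 2 → E3 → E3} (hξ : IsTangentFrame Ω ξ) {f g : E3 → ℝ}
    (hfg : ∀ s ∈ frontier Ω, f (Ψ s) = g s) :
    ∫ y, f y ∂(surfaceMeasure (perturb V ε '' Ω)) =
      ∫ s, areaFlow V (ε, s, ξ 0 s, ξ 1 s) * g s ∂(surfaceMeasure Ω) := by
  rw [h.surfaceMeasure_eq hΩ hξ, Ψ.measurableEmbedding.integral_map,
    integral_withDensity_eq_integral_toReal_smul₀ (h.aemeasurable_areaFlow hΩ hξ) (by simp)]
  refine integral_congr_ae ?_
  filter_upwards [ae_restrict_mem isClosed_frontier.measurableSet] with s hs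
  rw [hfg s hs, smul_eq_mul, ENNReal.toReal_ofReal (areaFlow_nonneg _ _)]

lemma splitNorm_eq (h : IsGoodPerturbation Ω V N ε Ψ) (d : Fin 2 → E3 → E3) {s : E3}
    (hs : s ∈ frontier Ω) :
    splitNorm (fun i => transport Ω (perturb V ε) (d i)) (Ψ s) = splitNorm d s := by
  simp only [splitNorm, h.transport_apply _ hs]

lemma splitResidual_eq (h : IsGoodPerturbation Ω V N ε Ψ) (hΩ : IsSmoothDomain Ω)
    (hN : IsNormalExtension Ω N) {ξ : Fin 2 → E3 → E3} (hξ : IsTangentFrame Ω ξ)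
    (d b : Fin 2 → E3 → E3) (i : Fin 2) {s : E3} (hs : s ∈ frontier Ω) :
    splitResidual (perturb V ε '' Ω) (fun i => transport Ω (perturb V ε) (d i))
      (fun i => transport Ω (perturb V ε) (b i)) (transportedFrame Ω (perturb V ε) ξ) i (Ψ s) =
      d i s - normalDerivFlow V N i (ε, s, ξ 0 s, ξ 1 s) - b i s := by
  rw [splitResidual, h.normalDeriv_eq hΩ hN hξ i hs, h.transport_apply _ hs,
    h.transport_apply _ hs]

end IsGoodPerturbation

lemma perturb_zero (V : E3 → E3) : perturb V 0 = id := by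
  funext x; simp [perturb]

lemma IsGoodPerturbation.lagrangianIntegrable_iff {Ω : Set E3} {V N : E3 → E3} {ε : ℝ} {Ψ : E3 ≃ₜ E3}
    (h : IsGoodPerturbation Ω V N ε Ψ) (hΩ : IsSmoothDomain Ω) (hN : IsNormalExtension Ω N)
    {ξ : Fin 2 → E3 → E3} (hξ : IsTangentFrame Ω ξ) (d b : Fin 2 → E3 → E3) :
    LagrangianIntegrable (perturb V ε '' Ω)
        (fun i => transport Ω (perturb V ε) (d i)) (fun i => transport Ω (perturb V ε) (b i))
        (transportedFrame Ω (perturb V ε) ξ) ↔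
      Integrable (fun s => areaFlow V (ε, s, ξ 0 s, ξ 1 s) * splitNorm d s) (surfaceMeasure Ω) ∧
      ∀ i, Integrable (fun s => areaFlow V (ε, s, ξ 0 s, ξ 1 s) *
        ‖d i s - normalDerivFlow V N i (ε, s, ξ 0 s, ξ 1 s) - b i s‖ ^ 2) (surfaceMeasure Ω) := by
  refine and_congr (h.integrable_iff hΩ hξ fun s hs => h.splitNorm_eq d hs)
    (forall_congr' fun i => h.integrable_iff hΩ hξ fun s hs => ?_)
  rw [h.splitResidual_eq hΩ hN hξ d b i hs]

lemma IsGoodPerturbation.transformedLagrangian_eq {Ω : Set E3} {V N : E3 → E3} {ε : ℝ}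
    {Ψ : E3 ≃ₜ E3} (h : IsGoodPerturbation Ω V N ε Ψ) (hΩ : IsSmoothDomain Ω)
    (hN : IsNormalExtension Ω N) {ξ : Fin 2 → E3 → E3} (hξ : IsTangentFrame Ω ξ)
    (d b : Fin 2 → E3 → E3) (loss : Set E3 → ℝ) (β lam : ℝ) :
    transformedLagrangian loss β lam Ω d b ξ (perturb V ε) = loss (perturb V ε '' Ω)
      + β * (∫ s, areaFlow V (ε, s, ξ 0 s, ξ 1 s) * splitNorm d s ∂(surfaceMeasure Ω))
      + lam / 2 * (∑ i, ∫ s, areaFlow V (ε, s, ξ 0 s, ξ 1 s) *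
        ‖d i s - normalDerivFlow V N i (ε, s, ξ 0 s, ξ 1 s) - b i s‖ ^ 2 ∂(surfaceMeasure Ω)) := by
  rw [transformedLagrangian, lagrangian,
    h.integral_eq hΩ hξ fun s hs => h.splitNorm_eq d hs]
  congr 2
  refine Finset.sum_congr rfl fun i _ => h.integral_eq hΩ hξ fun s hs => ?_
  rw [h.splitResidual_eq hΩ hN hξ d b i hs]

/-! ### Differentiation under the integral sign -/

/-- `f` depends differentiably on the parameter in `S`, with derivative `f'`, and both are bounded
by `C`. -/
structure HasBoundedDeriv {α F : Type*} [MeasurableSpace α] [NormedAddCommGroup F] [NormedSpace ℝ F]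
    (μ : Measure α) (S : Set ℝ) (C : ℝ) (f f' : ℝ → α → F) : Prop where
  aestronglyMeasurable : ∀ ε ∈ S, AEStronglyMeasurable (f ε) μ
  aestronglyMeasurable_deriv : ∀ ε ∈ S, AEStronglyMeasurable (f' ε) μ
  hasDerivAt : ∀ᵐ s ∂μ, ∀ ε ∈ S, HasDerivAt (fun ε => f ε s) (f' ε s) ε
  norm_le : ∀ᵐ s ∂μ, ∀ ε ∈ S, ‖f ε s‖ ≤ C
  norm_deriv_le : ∀ᵐ s ∂μ, ∀ ε ∈ S, ‖f' ε s‖ ≤ C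

lemma HasBoundedDeriv.integral_mul {α : Type*} [MeasurableSpace α] {μ : Measure α} {S : Set ℝ}
    {C : ℝ} {J J' : ℝ → α → ℝ} (hJ : HasBoundedDeriv μ S C J J') (hS : S ∈ 𝓝 0) {g : α → ℝ}
    (hg : Integrable g μ) :
    (∀ ε ∈ S, Integrable (fun s => J ε s * g s) μ) ∧ Integrable (fun s => J' 0 s * g s) μ ∧
      HasDerivAt (fun ε => ∫ s, J ε s * g s ∂μ) (∫ s, J' 0 s * g s ∂μ) 0 := by
  have hint (ε : ℝ) (hε : ε ∈ S) : Integrable (fun s => J ε s * g s) μ :=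
    hg.bdd_mul (hJ.1 ε hε) (c := C) (hJ.norm_le.mono fun s hs => hs ε hε)
  have h0 : (0 : ℝ) ∈ S := mem_of_mem_nhds hS
  refine ⟨hint, ?_⟩
  refine hasDerivAt_integral_of_dominated_loc_of_deriv_le (bound := fun s => C * ‖g s‖)
    (F' := fun ε s => J' ε s * g s) hS ?_ (hint 0 h0) ((hJ.2 0 h0).mul hg.1) ?_
    (hg.norm.const_mul C) ?_
  · filter_upwards [hS] with ε hε using (hint ε hε).1
  · filter_upwards [hJ.norm_deriv_le] with s hs ε hε
    rw [norm_mul]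
    gcongr
    exact hs ε hε
  · filter_upwards [hJ.hasDerivAt] with s hs ε hε
    exact (hs ε hε).mul_const _

/-- Only `k - H 0` is assumed square integrable. Since `H` is bounded by `C`, the function `w = 2‖k
- H 0‖² + 8C²` dominates `‖k - H ε‖²` for all ε in `S`, and it is integrable because the measure is
finite. The ε-derivative is dominated by a combination of `w` and `1 + w`. -/
lemma HasBoundedDeriv.integral_mul_norm_sq {α : Type*} [MeasurableSpace α] {μ : Measure α}
    [IsFiniteMeasure μ] {S : Set ℝ} {C : ℝ} {J J' : ℝ → α → ℝ} {H H' : ℝ → α → E3}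
    (hJ : HasBoundedDeriv μ S C J J') (hH : HasBoundedDeriv μ S C H H') (hS : S ∈ 𝓝 0) (hC : 0 ≤ C)
    {k : α → E3} (hk : AEStronglyMeasurable k μ) (hk2 : Integrable (fun s => ‖k s - H 0 s‖ ^ 2) μ) :
    (∀ ε ∈ S, Integrable (fun s => J ε s * ‖k s - H ε s‖ ^ 2) μ) ∧
      Integrable (fun s => (inner ℝ (k s - H 0 s) (-H' 0 s) : ℝ)) μ ∧
      HasDerivAt (fun ε => ∫ s, J ε s * ‖k s - H ε s‖ ^ 2 ∂μ)
        (∫ s, (J' 0 s * ‖k s - H 0 s‖ ^ 2 + J 0 s * (2 * inner ℝ (k s - H 0 s) (-H' 0 s))) ∂μ) 0 := by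
  have h0 : (0 : ℝ) ∈ S := mem_of_mem_nhds hS
  set w : α → ℝ := fun s => 2 * ‖k s - H 0 s‖ ^ 2 + 8 * C ^ 2 with hw
  have hwint : Integrable w μ := (hk2.const_mul 2).add (integrable_const _)
  have hwb : ∀ᵐ s ∂μ, ∀ ε ∈ S, ‖k s - H ε s‖ ^ 2 ≤ w s := by
    filter_upwards [hH.norm_le] with s hs ε hε
    have h1 : ‖k s - H ε s‖ ≤ ‖k s - H 0 s‖ + 2 * C := by
      have h2 : k s - H ε s = (k s - H 0 s) + (H 0 s - H ε s) := by abel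
      rw [h2]
      refine (norm_add_le _ _).trans ?_
      have := (norm_sub_le (H 0 s) (H ε s)).trans (add_le_add (hs 0 h0) (hs ε hε))
      linarith
    calc ‖k s - H ε s‖ ^ 2 ≤ (‖k s - H 0 s‖ + 2 * C) ^ 2 := by gcongr
      _ ≤ w s := by rw [hw]; nlinarith [sq_nonneg (‖k s - H 0 s‖ - 2 * C)]
  have hinner : ∀ᵐ s ∂μ, ∀ ε ∈ S, |inner ℝ (k s - H ε s) (-H' ε s)| ≤ C * (1 + w s) := by
    filter_upwards [hwb, hH.norm_deriv_le] with s hs hs' ε hε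
    have h1 := abs_real_inner_le_norm (k s - H ε s) (-H' ε s)
    rw [norm_neg] at h1
    have h2 : ‖k s - H ε s‖ ≤ 1 + w s := by nlinarith [hs ε hε, sq_nonneg (‖k s - H ε s‖ - 1 / 2)]
    calc _ ≤ ‖k s - H ε s‖ * ‖H' ε s‖ := h1
      _ ≤ (1 + w s) * C := mul_le_mul h2 (hs' ε hε) (norm_nonneg _) ((norm_nonneg _).trans h2)
      _ = C * (1 + w s) := mul_comm _ _
  have hmsq (ε : ℝ) (hε : ε ∈ S) : AEStronglyMeasurable (fun s => ‖k s - H ε s‖ ^ 2) μ :=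
    ((hk.sub (hH.1 ε hε)).norm).pow 2
  have hmin (ε : ℝ) (hε : ε ∈ S) :
      AEStronglyMeasurable (fun s => (inner ℝ (k s - H ε s) (-H' ε s) : ℝ)) μ :=
    (hk.sub (hH.1 ε hε)).inner (hH.2 ε hε).neg
  have hint (ε : ℝ) (hε : ε ∈ S) : Integrable (fun s => J ε s * ‖k s - H ε s‖ ^ 2) μ := by
    refine Integrable.bdd_mul (c := C) ?_ (hJ.1 ε hε) (hJ.norm_le.mono fun s hs => hs ε hε)
    refine hwint.mono' (hmsq ε hε) ?_
    filter_upwards [hwb] with s hs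
    rw [Real.norm_of_nonneg (by positivity)]
    exact hs ε hε
  refine ⟨hint, ?_, ?_⟩
  · refine (((integrable_const (1 : ℝ)).add hwint).const_mul C).mono' (hmin 0 h0) ?_
    filter_upwards [hinner] with s hs
    exact hs 0 h0
  · refine (hasDerivAt_integral_of_dominated_loc_of_deriv_le
      (bound := fun s => C * w s + C * (2 * (C * (1 + w s))))
      (F' := fun ε s => J' ε s * ‖k s - H ε s‖ ^ 2 + J ε s * (2 * inner ℝ (k s - H ε s) (-H' ε s)))
      hS ?_ (hint 0 h0) ?_ ?_ ?_ ?_).2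
    · filter_upwards [hS] with ε hε using (hint ε hε).1
    · exact ((hJ.2 0 h0).mul (hmsq 0 h0)).add ((hJ.1 0 h0).mul ((hmin 0 h0).const_mul 2))
    · filter_upwards [hwb, hinner, hJ.norm_le, hJ.norm_deriv_le] with s h1 h2 h3 h4 ε hε
      refine (norm_add_le _ _).trans (add_le_add ?_ ?_)
      · rw [norm_mul, Real.norm_of_nonneg (sq_nonneg ‖k s - H ε s‖)]
        exact mul_le_mul (h4 ε hε) (h1 ε hε) (by positivity) hC
      · rw [norm_mul, norm_mul, Real.norm_ofNat]
        refine mul_le_mul (h3 ε hε) ?_ (by positivity) hC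
        gcongr
        exact h2 ε hε
    · exact (hwint.const_mul C).add
        (((((integrable_const (1 : ℝ)).add hwint).const_mul C).const_mul 2).const_mul C)
    · filter_upwards [hJ.hasDerivAt, hH.hasDerivAt] with s h1 h2 ε hε
      have h3 := ((h2 ε hε).const_sub (k s)).norm_sq
      exact (h1 ε hε).mul h3

/-- A smooth family is uniformly `C¹` near a compact set of parameters. -/
lemma exists_bound_of_contDiffAt {Q F : Type*} [NormedAddCommGroup Q] [NormedSpace ℝ Q]
    [NormedAddCommGroup F] [NormedSpace ℝ F] {K : Set Q} (hK : IsCompact K) {f : ℝ × Q → F}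
    (hf : ∀ q ∈ K, ContDiffAt ℝ ∞ f (0, q)) :
    ∃ C : ℝ, 0 ≤ C ∧ ∀ᶠ ε : ℝ in 𝓝 0, ∀ q ∈ K, ContDiffAt ℝ 1 f (ε, q) ∧ ‖f (ε, q)‖ ≤ C ∧
      ‖fderiv ℝ f (ε, q) (1, 0)‖ ≤ C := by
  have hf1 (q : Q) (hq : q ∈ K) : ContDiffAt ℝ 1 f (0, q) := (hf q hq).of_le (by simp)
  have hc1 (q : Q) (hq : q ∈ K) : ContinuousAt (fun p => ‖f p‖) (0, q) :=
    (hf q hq).continuousAt.norm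
  have hc2 (q : Q) (hq : q ∈ K) : ContinuousAt (fun p => ‖fderiv ℝ f p (1, 0)‖) (0, q) :=
    ((((hf q hq).fderiv_right (m := ∞) (by simp)).continuousAt).clm_apply continuousAt_const).norm
  have hin (q : Q) : ContinuousAt (fun q : Q => ((0 : ℝ), q)) q := by fun_prop
  obtain ⟨C1, hC1⟩ := (hK.image_of_continuousOn (f := fun q => ‖f (0, q)‖)
    fun q hq => ((hc1 q hq).comp (f := fun q : Q => ((0 : ℝ), q)) (hin q)).continuousWithinAt).bddAbove
  obtain ⟨C2, hC2⟩ := (hK.image_of_continuousOn (f := fun q => ‖fderiv ℝ f (0, q) (1, 0)‖)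
    fun q hq => ((hc2 q hq).comp (f := fun q : Q => ((0 : ℝ), q)) (hin q)).continuousWithinAt).bddAbove
  -- The added 1 makes the bounds strict at ε = 0, so that they persist nearby.
  refine ⟨max 0 (max C1 C2 + 1), le_max_left _ _, ?_⟩
  refine hK.eventually_forall_of_forall_eventually fun q hq => ?_
  have h1 : ‖f (0, q)‖ < max C1 C2 + 1 :=
    ((hC1 ⟨q, hq, rfl⟩).trans (le_max_left _ _)).trans_lt (lt_add_one _)
  have h2 : ‖fderiv ℝ f (0, q) (1, 0)‖ < max C1 C2 + 1 :=
    ((hC2 ⟨q, hq, rfl⟩).trans (le_max_right _ _)).trans_lt (lt_add_one _)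
  filter_upwards [(hf1 q hq).eventually (by simp), (hc1 q hq).eventually (gt_mem_nhds h1),
    (hc2 q hq).eventually (gt_mem_nhds h2)] with p hp1 hp2 hp3
  exact ⟨hp1, hp2.le.trans (le_max_right _ _), hp3.le.trans (le_max_right _ _)⟩

lemma frame_mem_frameSet {Ω : Set E3} (hΩ : IsSmoothDomain Ω) {ξ : Fin 2 → E3 → E3}
    (hξ : IsTangentFrame Ω ξ) {s : E3} (hs : s ∈ frontier Ω) :
    (s, ξ 0 s, ξ 1 s) ∈ frameSet (frontier Ω) :=
  have h := hΩ.isFrameAt hξ hs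
  ⟨hs, h.2, h.3, h.4⟩

/-- Continuity on the compact set of frames suffices, since `s ↦ (s, ξ₁(s), ξ₂(s))` is measurable
and takes values there almost everywhere. -/
lemma aestronglyMeasurable_comp_frame {Ω : Set E3} (hΩ : IsSmoothDomain Ω) {ξ : Fin 2 → E3 → E3}
    (hξ : IsTangentFrame Ω ξ) (hξm : ∀ i, AEStronglyMeasurable (ξ i) (surfaceMeasure Ω))
    {F : Type*} [TopologicalSpace F] [TopologicalSpace.PseudoMetrizableSpace F]
    {f : E3 × E3 × E3 → F} (hf : ContinuousOn f (frameSet (frontier Ω))) :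
    AEStronglyMeasurable (fun s => f (s, ξ 0 s, ξ 1 s)) (surfaceMeasure Ω) := by
  have hq : AEMeasurable (fun s => (s, ξ 0 s, ξ 1 s)) (surfaceMeasure Ω) :=
    aemeasurable_id.prodMk ((hξm 0).aemeasurable.prodMk (hξm 1).aemeasurable)
  have hK := isCompact_frameSet hΩ.isCompact_frontier
  have hm : MeasurableSet (frameSet (frontier Ω)) := hK.isClosed.measurableSet
  refine AEStronglyMeasurable.comp_aemeasurable (g := f) ?_ hq
  rw [← Measure.restrict_eq_self_of_ae_mem (s := frameSet (frontier Ω)) (μ := Measure.map _ _)]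
  · exact hf.aestronglyMeasurable_of_isCompact hK hm
  · refine (ae_map_iff hq hm).2 ?_
    filter_upwards [ae_restrict_mem isClosed_frontier.measurableSet] with s hs
    exact frame_mem_frameSet hΩ hξ hs

lemma exists_hasBoundedDeriv {Ω : Set E3} (hΩ : IsSmoothDomain Ω) {ξ : Fin 2 → E3 → E3}
    (hξ : IsTangentFrame Ω ξ) (hξm : ∀ i, AEStronglyMeasurable (ξ i) (surfaceMeasure Ω))
    {F : Type*} [NormedAddCommGroup F] [NormedSpace ℝ F] {f : ℝ × E3 × E3 × E3 → F}
    (hf : ∀ q ∈ frameSet (frontier Ω), ContDiffAt ℝ ∞ f (0, q)) :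
    ∃ C : ℝ, 0 ≤ C ∧ ∃ S ∈ 𝓝 (0 : ℝ), HasBoundedDeriv (surfaceMeasure Ω) S C
      (fun ε s => f (ε, s, ξ 0 s, ξ 1 s)) (fun ε s => fderiv ℝ f (ε, s, ξ 0 s, ξ 1 s) (1, 0)) := by
  obtain ⟨C, hC, hS⟩ := exists_bound_of_contDiffAt (isCompact_frameSet hΩ.isCompact_frontier) hf
  have hin (ε : ℝ) (q : E3 × E3 × E3) : ContinuousAt (fun q => (ε, q)) q := by fun_prop
  refine ⟨C, hC, _, hS, fun ε hε => ?_, fun ε hε => ?_, ?_, ?_, ?_⟩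
  · refine aestronglyMeasurable_comp_frame hΩ hξ hξm (f := fun q => f (ε, q)) fun q hq => ?_
    exact ((hε q hq).1.continuousAt.comp (f := fun q => (ε, q)) (hin ε q)).continuousWithinAt
  · refine aestronglyMeasurable_comp_frame hΩ hξ hξm (f := fun q => fderiv ℝ f (ε, q) (1, 0))
      fun q hq => ?_
    have h := ((hε q hq).1.fderiv_right (m := 0) (by simp)).continuousAt.clm_apply
      (continuousAt_const (y := ((1 : ℝ), (0 : E3 × E3 × E3))))
    exact (h.comp (f := fun q => (ε, q)) (hin ε q)).continuousWithinAt
  all_goals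
    filter_upwards [ae_restrict_mem isClosed_frontier.measurableSet] with s hs ε hε
    obtain ⟨h1, h2, h3⟩ := hε _ (frame_mem_frameSet hΩ hξ hs)
  · exact (h1.differentiableAt (by simp)).hasFDerivAt.comp_hasDerivAt ε
      ((hasDerivAt_id ε).prodMk (hasDerivAt_const ε (s, ξ 0 s, ξ 1 s)))
  · exact h2
  · exact h3

/-! ### The shape derivative in a given direction -/

lemma HasBoundedDeriv.mono {α F : Type*} [MeasurableSpace α] [NormedAddCommGroup F] [NormedSpace ℝ F]
    {μ : Measure α} {S S' : Set ℝ} {C C' : ℝ} {f f' : ℝ → α → F} (h : HasBoundedDeriv μ S C f f')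
    (hS : S' ⊆ S) (hC : C ≤ C') : HasBoundedDeriv μ S' C' f f' where
  aestronglyMeasurable ε hε := h.1 ε (hS hε)
  aestronglyMeasurable_deriv ε hε := h.2 ε (hS hε)
  hasDerivAt := h.3.mono fun _ hs ε hε => hs ε (hS hε)
  norm_le := h.4.mono fun _ hs ε hε => (hs ε (hS hε)).trans hC
  norm_deriv_le := h.5.mono fun _ hs ε hε => (hs ε (hS hε)).trans hC

lemma areaFlow_zero {Ω : Set E3} {s a b : E3} (hf : IsFrameAt (outerNormal Ω s) a b)
    (V : E3 → E3) : areaFlow V (0, s, a, b) = 1 := by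
  simp [areaFlow, perturbDeriv_zero, hf.gramArea_eq_one]

section

variable {Ω : Set E3} {ξ : Fin 2 → E3 → E3} {V N : E3 → E3}

lemma normalDerivFlow_zero (hΩ : IsSmoothDomain Ω) (hξ : IsTangentFrame Ω ξ)
    (hV : ∀ x ∈ frontier Ω, ContDiffAt ℝ ∞ V x) (hN : IsNormalExtension Ω N) {s : E3}
    (hs : s ∈ frontier Ω) (i : Fin 2) :
    normalDerivFlow V N i (0, s, ξ 0 s, ξ 1 s) = normalDeriv Ω (ξ i) s := by
  have hf := hΩ.isFrameAt hξ hs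
  have hη0 : frameFlow V i (0, s, ξ 0 s, ξ 1 s) = ξ i s := by
    rw [frameFlow_zero V hf.2 hf.3 hf.4]
    fin_cases i <;> rfl
  rw [normalDeriv, tangentialDeriv_outerNormal_eq hΩ hV hN hs,
    tangentProj_of_inner_eq_zero ((hξ s hs).2 i), normalDerivFlow, hη0]

/-- Bounds for the surface Jacobian and the derivatives of the normals, uniform on the surface. -/
lemma exists_hasBoundedDeriv_flows (hΩ : IsSmoothDomain Ω) (hξ : IsTangentFrame Ω ξ)
    (hξm : ∀ i, AEStronglyMeasurable (ξ i) (surfaceMeasure Ω))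
    (hV : ∀ x ∈ frontier Ω, ContDiffAt ℝ ∞ V x) (hN : IsNormalExtension Ω N) :
    ∃ C : ℝ, 0 ≤ C ∧ ∃ S ∈ 𝓝 (0 : ℝ),
      HasBoundedDeriv (surfaceMeasure Ω) S C (fun ε s => areaFlow V (ε, s, ξ 0 s, ξ 1 s))
        (fun ε s => fderiv ℝ (areaFlow V) (ε, s, ξ 0 s, ξ 1 s) (1, 0)) ∧
      ∀ i, HasBoundedDeriv (surfaceMeasure Ω) S C
        (fun ε s => normalDerivFlow V N i (ε, s, ξ 0 s, ξ 1 s))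
        (fun ε s => fderiv ℝ (normalDerivFlow V N i) (ε, s, ξ 0 s, ξ 1 s) (1, 0)) := by
  obtain ⟨C, hC, S, hS, hJ⟩ := exists_hasBoundedDeriv hΩ hξ hξm (f := areaFlow V) fun q hq =>
    contDiffAt_areaFlow (hV _ hq.1) hq.2.1 hq.2.2.1 hq.2.2.2
  have hH (i : Fin 2) := exists_hasBoundedDeriv hΩ hξ hξm (f := normalDerivFlow V N i) fun q hq =>
    contDiffAt_normalDerivFlow (hV _ hq.1) hN.contDiff.contDiffAt (hN.ne_zero hΩ hq.1) hq.2.1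
      hq.2.2.1 hq.2.2.2 i
  choose C' hC' S' hS' hH using hH
  refine ⟨max C (max (C' 0) (C' 1)), le_max_of_le_left hC, S ∩ (S' 0 ∩ S' 1),
    inter_mem hS (inter_mem (hS' 0) (hS' 1)),
    hJ.mono Set.inter_subset_left (le_max_left _ _), fun i => ?_⟩
  fin_cases i
  · exact (hH 0).mono (Set.inter_subset_right.trans Set.inter_subset_left)
      ((le_max_left _ _).trans (le_max_right _ _))
  · exact (hH 1).mono (Set.inter_subset_right.trans Set.inter_subset_right)
      ((le_max_right _ _).trans (le_max_right _ _))

lemma fderiv_areaFlow (hΩ : IsSmoothDomain Ω) (hξ : IsTangentFrame Ω ξ)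
    (hV : ∀ x ∈ frontier Ω, ContDiffAt ℝ ∞ V x) {s : E3} (hs : s ∈ frontier Ω) :
    fderiv ℝ (areaFlow V) (0, s, ξ 0 s, ξ 1 s) (1, 0) = surfaceDiv Ω V s := by
  have hf := hΩ.isFrameAt hξ hs
  have h := (contDiffAt_areaFlow (q := (s, ξ 0 s, ξ 1 s)) (hV s hs) hf.2 hf.3 hf.4)
  have h3 : HasFDerivAt (areaFlow V) (fderiv ℝ (areaFlow V) (0, s, ξ 0 s, ξ 1 s))
      (0, s, ξ 0 s, ξ 1 s) := (h.differentiableAt (by simp)).hasFDerivAt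
  have h4 : HasDerivAt (fun ε : ℝ => (ε, s, ξ 0 s, ξ 1 s)) ((1 : ℝ), (0 : E3 × E3 × E3)) 0 :=
    (hasDerivAt_id (0 : ℝ)).prodMk (hasDerivAt_const (0 : ℝ) (s, ξ 0 s, ξ 1 s))
  have h2 : HasDerivAt (fun ε : ℝ => areaFlow V (ε, s, ξ 0 s, ξ 1 s))
      (fderiv ℝ (areaFlow V) (0, s, ξ 0 s, ξ 1 s) (1, 0)) 0 :=
    h3.comp_hasDerivAt_of_eq (0 : ℝ) h4 rfl
  exact h2.unique (hasDerivAt_areaFlow hf V)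

lemma fderiv_normalDerivFlow (hΩ : IsSmoothDomain Ω) (hξ : IsTangentFrame Ω ξ)
    (hV : ∀ x ∈ frontier Ω, ContDiffAt ℝ ∞ V x) (hN : IsNormalExtension Ω N) {s : E3}
    (hs : s ∈ frontier Ω) (i : Fin 2) :
    fderiv ℝ (normalDerivFlow V N i) (0, s, ξ 0 s, ξ 1 s) (1, 0) = dNormalDeriv Ω V ξ i s := by
  have hf := hΩ.isFrameAt hξ hs
  have h := (contDiffAt_normalDerivFlow (q := (s, ξ 0 s, ξ 1 s)) (hV s hs) hN.contDiff.contDiffAt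
    (hN.ne_zero hΩ hs) hf.2 hf.3 hf.4 i)
  have h3 : HasFDerivAt (normalDerivFlow V N i) (fderiv ℝ (normalDerivFlow V N i) (0, s, ξ 0 s, ξ 1 s))
      (0, s, ξ 0 s, ξ 1 s) := (h.differentiableAt (by simp)).hasFDerivAt
  have h4 : HasDerivAt (fun ε : ℝ => (ε, s, ξ 0 s, ξ 1 s)) ((1 : ℝ), (0 : E3 × E3 × E3)) 0 :=
    (hasDerivAt_id (0 : ℝ)).prodMk (hasDerivAt_const (0 : ℝ) (s, ξ 0 s, ξ 1 s))
  have h2 : HasDerivAt (fun ε : ℝ => normalDerivFlow V N i (ε, s, ξ 0 s, ξ 1 s))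
      (fderiv ℝ (normalDerivFlow V N i) (0, s, ξ 0 s, ξ 1 s) (1, 0)) 0 :=
    h3.comp_hasDerivAt_of_eq (0 : ℝ) h4 rfl
  exact h2.unique (hasDerivAt_normalDerivFlow hΩ hξ hV hN hs i)

/-- The material derivative of the derivative of the normal field along the frame. -/
lemma hasDerivAt_normalDeriv {D : Set E3} (hΩ : IsSmoothDomain Ω) (hD : IsOpen D)
    (hΩD : closure Ω ⊆ D) (hξ : IsTangentFrame Ω ξ) (hV : ContDiffOn ℝ ∞ V D) (i : Fin 2) {s : E3}
    (hs : s ∈ frontier Ω) :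
    HasDerivAt (fun ε : ℝ => normalDeriv (perturb V ε '' Ω) (transportedFrame Ω (perturb V ε) ξ i)
      (perturb V ε s)) (dNormalDeriv Ω V ξ i s) 0 := by
  obtain ⟨N, hN1, hN2⟩ := hΩ.exists_normal_extension
  have hN : IsNormalExtension Ω N := ⟨hN1, hN2⟩
  have hVat (x : E3) (hx : x ∈ frontier Ω) : ContDiffAt ℝ ∞ V x :=
    hV.contDiffAt (hD.mem_nhds (hΩD (frontier_subset_closure hx)))
  refine (hasDerivAt_normalDerivFlow hΩ hξ hVat hN hs i).congr_of_eventuallyEq ?_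
  filter_upwards [eventually_isGoodPerturbation hΩ hD hΩD hV hN] with ε ⟨Ψ, hΨ⟩
  rw [← hΨ.normalDeriv_eq hΩ hN hξ i hs, hΨ.eq_perturb s (frontier_subset_closure hs)]

variable {d b : Fin 2 → E3 → E3}

/-- Integrability and differentiability of the surface integrals in the augmented Lagrangian. -/
lemma hasDerivAt_surface_integrals (hΩ : IsSmoothDomain Ω) (hξ : IsTangentFrame Ω ξ)
    (hξm : ∀ i, AEStronglyMeasurable (ξ i) (surfaceMeasure Ω))
    (hdm : ∀ i, AEStronglyMeasurable (d i) (surfaceMeasure Ω))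
    (hbm : ∀ i, AEStronglyMeasurable (b i) (surfaceMeasure Ω))
    (hint : LagrangianIntegrable Ω d b ξ)
    (hV : ∀ x ∈ frontier Ω, ContDiffAt ℝ ∞ V x) (hN : IsNormalExtension Ω N) :
    (∀ᶠ ε : ℝ in 𝓝 0,
      Integrable (fun s => areaFlow V (ε, s, ξ 0 s, ξ 1 s) * splitNorm d s) (surfaceMeasure Ω) ∧
      ∀ i, Integrable (fun s => areaFlow V (ε, s, ξ 0 s, ξ 1 s) *
        ‖d i s - normalDerivFlow V N i (ε, s, ξ 0 s, ξ 1 s) - b i s‖ ^ 2) (surfaceMeasure Ω)) ∧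
    Integrable (fun s => surfaceDiv Ω V s * splitNorm d s) (surfaceMeasure Ω) ∧
    (∀ i, Integrable (fun s => surfaceDiv Ω V s * ‖splitResidual Ω d b ξ i s‖ ^ 2)
      (surfaceMeasure Ω)) ∧
    (∀ i, Integrable (fun s => (inner ℝ (splitResidual Ω d b ξ i s) (-dNormalDeriv Ω V ξ i s) : ℝ))
      (surfaceMeasure Ω)) ∧
    HasDerivAt (fun ε : ℝ => ∫ s, areaFlow V (ε, s, ξ 0 s, ξ 1 s) * splitNorm d s ∂(surfaceMeasure Ω))
      (∫ s, surfaceDiv Ω V s * splitNorm d s ∂(surfaceMeasure Ω)) 0 ∧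
    ∀ i, HasDerivAt (fun ε : ℝ => ∫ s, areaFlow V (ε, s, ξ 0 s, ξ 1 s) *
        ‖d i s - normalDerivFlow V N i (ε, s, ξ 0 s, ξ 1 s) - b i s‖ ^ 2 ∂(surfaceMeasure Ω))
      ((∫ s, surfaceDiv Ω V s * ‖splitResidual Ω d b ξ i s‖ ^ 2 ∂(surfaceMeasure Ω)) +
        2 * ∫ s, (inner ℝ (splitResidual Ω d b ξ i s) (-dNormalDeriv Ω V ξ i s) : ℝ)
          ∂(surfaceMeasure Ω)) 0 := by
  have := hΩ.isFiniteMeasure_surfaceMeasure hξ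
  have hΓ := ae_restrict_mem (μ := (Measure.euclideanHausdorffMeasure 2 : Measure E3))
    (isClosed_frontier (s := Ω)).measurableSet
  obtain ⟨C, hC, S, hS, hJ, hH⟩ := exists_hasBoundedDeriv_flows hΩ hξ hξm hV hN
  have hr (i : Fin 2) : ∀ s ∈ frontier Ω, d i s - b i s -
      normalDerivFlow V N i (0, s, ξ 0 s, ξ 1 s) = splitResidual Ω d b ξ i s := fun s hs => by
    rw [normalDerivFlow_zero hΩ hξ hV hN hs, splitResidual, sub_right_comm]
  have hJ0 : ∀ s ∈ frontier Ω, areaFlow V (0, s, ξ 0 s, ξ 1 s) = 1 := fun s hs =>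
    areaFlow_zero (hΩ.isFrameAt hξ hs) V
  have hJ'0 := fun s hs => fderiv_areaFlow (s := s) hΩ hξ hV hs
  have hH'0 (i : Fin 2) := fun s hs => fderiv_normalDerivFlow (s := s) hΩ hξ hV hN hs i
  obtain ⟨h1, h2, h3⟩ := hJ.integral_mul hS hint.1
  -- Here `k = d_i - b_i` and `H` is the pulled-back `(D n_ε) ξ_{i,ε}`, so `k - H 0` is the
  -- residual, square integrable by hypothesis.
  have hb (i : Fin 2) := hJ.integral_mul_norm_sq (hH i) hS hC ((hdm i).sub (hbm i))
    ((hint.2 i).congr (by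
      filter_upwards [hΓ] with s hs
      rw [Pi.sub_apply, hr i s hs]))
  have hcomm (i : Fin 2) (ε : ℝ) (s : E3) :
      d i s - normalDerivFlow V N i (ε, s, ξ 0 s, ξ 1 s) - b i s =
        (d i - b i) s - normalDerivFlow V N i (ε, s, ξ 0 s, ξ 1 s) := by
    rw [sub_right_comm, Pi.sub_apply]
  have h0 : (0 : ℝ) ∈ S := mem_of_mem_nhds hS
  have hdiv (i : Fin 2) : Integrable (fun s => surfaceDiv Ω V s * ‖splitResidual Ω d b ξ i s‖ ^ 2)
      (surfaceMeasure Ω) := by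
    refine ((hJ.integral_mul hS (hint.2 i)).2.1).congr ?_
    filter_upwards [hΓ] with s hs
    rw [hJ'0 s hs]
  have hinn (i : Fin 2) : Integrable (fun s => (inner ℝ (splitResidual Ω d b ξ i s)
      (-dNormalDeriv Ω V ξ i s) : ℝ)) (surfaceMeasure Ω) := by
    refine (hb i).2.1.congr ?_
    filter_upwards [hΓ] with s hs
    rw [Pi.sub_apply, hr i s hs, hH'0 i s hs]
  refine ⟨?_, ?_, hdiv, hinn, ?_, fun i => ?_⟩
  · filter_upwards [hS] with ε hε
    refine ⟨h1 ε hε, fun i => ?_⟩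
    simp only [hcomm]
    exact (hb i).1 ε hε
  · refine h2.congr ?_
    filter_upwards [hΓ] with s hs
    rw [hJ'0 s hs]
  · refine h3.congr_deriv (integral_congr_ae ?_)
    filter_upwards [hΓ] with s hs
    rw [hJ'0 s hs]
  · simp only [hcomm]
    refine (hb i).2.2.congr_deriv ?_
    rw [← integral_const_mul, ← integral_add (hdiv i) ((hinn i).const_mul 2)]
    refine integral_congr_ae ?_
    filter_upwards [hΓ] with s hs
    rw [Pi.sub_apply, hr i s hs, hH'0 i s hs, hJ'0 s hs, hJ0 s hs, one_mul]

lemma hasShapeDeriv_transformedLagrangian {D : Set E3} (hΩ : IsSmoothDomain Ω) (hD : IsOpen D)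
    (hΩD : closure Ω ⊆ D) (hξ : IsTangentFrame Ω ξ)
    (hξm : ∀ i, AEStronglyMeasurable (ξ i) (surfaceMeasure Ω))
    (hdm : ∀ i, AEStronglyMeasurable (d i) (surfaceMeasure Ω))
    (hbm : ∀ i, AEStronglyMeasurable (b i) (surfaceMeasure Ω))
    (hint : LagrangianIntegrable Ω d b ξ) (hV : ContDiffOn ℝ ∞ V D) (loss : Set E3 → ℝ)
    (β lam dℓ : ℝ) (hℓ : HasShapeDeriv (fun T => loss (T '' Ω)) V dℓ) :
    HasShapeDeriv (transformedLagrangian loss β lam Ω d b ξ) V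
      (dℓ + β * (∫ s, surfaceDiv Ω V s * splitNorm d s ∂(surfaceMeasure Ω))
        + lam / 2 * (∑ i, ∫ s, surfaceDiv Ω V s * ‖splitResidual Ω d b ξ i s‖ ^ 2
            ∂(surfaceMeasure Ω))
        + lam * (∑ i, ∫ s, (inner ℝ (splitResidual Ω d b ξ i s) (-dNormalDeriv Ω V ξ i s) : ℝ)
            ∂(surfaceMeasure Ω))) := by
  obtain ⟨N, hN1, hN2⟩ := hΩ.exists_normal_extension
  have hN : IsNormalExtension Ω N := ⟨hN1, hN2⟩
  have hVat (x : E3) (hx : x ∈ frontier Ω) : ContDiffAt ℝ ∞ V x :=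
    hV.contDiffAt (hD.mem_nhds (hΩD (frontier_subset_closure hx)))
  obtain ⟨-, -, -, -, h1, h2⟩ := hasDerivAt_surface_integrals (b := b) hΩ hξ hξm hdm hbm hint hVat hN
  have hgood := eventually_isGoodPerturbation hΩ hD hΩD hV hN
  have hs := (h1.const_mul β).add ((HasDerivAt.fun_sum fun i (_ : i ∈ Finset.univ) => h2 i).const_mul
    (lam / 2))
  have hsum := hℓ.add hs.tendsto_slope_zero_right
  unfold HasShapeDeriv
  have hlim : (dℓ + β * (∫ s, surfaceDiv Ω V s * splitNorm d s ∂(surfaceMeasure Ω))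
        + lam / 2 * (∑ i, ∫ s, surfaceDiv Ω V s * ‖splitResidual Ω d b ξ i s‖ ^ 2
            ∂(surfaceMeasure Ω))
        + lam * (∑ i, ∫ s, (inner ℝ (splitResidual Ω d b ξ i s) (-dNormalDeriv Ω V ξ i s) : ℝ)
            ∂(surfaceMeasure Ω))) = dℓ + (β * (∫ s, surfaceDiv Ω V s * splitNorm d s ∂(surfaceMeasure Ω))
        + lam / 2 * (∑ i, ((∫ s, surfaceDiv Ω V s * ‖splitResidual Ω d b ξ i s‖ ^ 2
            ∂(surfaceMeasure Ω)) + 2 * ∫ s, (inner ℝ (splitResidual Ω d b ξ i s)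
              (-dNormalDeriv Ω V ξ i s) : ℝ) ∂(surfaceMeasure Ω)))) := by
    rw [Finset.sum_add_distrib, ← Finset.mul_sum]
    ring
  rw [hlim]
  refine hsum.congr' ?_
  -- The value at `id` is also written through the pulled-back formula, at ε = 0, so the surface
  -- terms in the difference quotient come from a single function of ε.
  obtain ⟨Ψ₀, hΨ₀⟩ := hgood.self_of_nhds
  have hid := hΨ₀.transformedLagrangian_eq hΩ hN hξ d b loss β lam
  rw [perturb_zero] at hid
  filter_upwards [nhdsWithin_le_nhds hgood] with ε ⟨Ψ, hΨ⟩
  rw [hΨ.transformedLagrangian_eq hΩ hN hξ d b loss β lam, hid]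
  simp only [zero_add, smul_eq_mul, Pi.add_apply]
  ring

end

/-! ### Linearity and continuity of the shape derivative -/

/-- `L` is a linear functional on the smooth vector fields on `D`, continuous with respect to
uniform convergence of all derivatives on compact subsets of `D`. -/
structure IsContinuousLinearFunctional (D : Set E3) (L : (E3 → E3) → ℝ) : Prop where
  map_add_smul : ∀ V W, ContDiffOn ℝ ∞ V D → ContDiffOn ℝ ∞ W D → ∀ c : ℝ,
    L (fun x => V x + c • W x) = L V + c * L W
  bound : ∃ K ⊆ D, IsCompact K ∧ ∃ (k : ℕ) (C : ℝ), ∀ V, ContDiffOn ℝ ∞ V D → ∀ M : ℝ, 0 ≤ M →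
    (∀ j ≤ k, ∀ x ∈ K, ‖iteratedFDeriv ℝ j V x‖ ≤ M) → |L V| ≤ C * M

namespace IsContinuousLinearFunctional

variable {D : Set E3} {L L' : (E3 → E3) → ℝ}

lemma add (h : IsContinuousLinearFunctional D L) (h' : IsContinuousLinearFunctional D L') :
    IsContinuousLinearFunctional D fun V => L V + L' V where
  map_add_smul V W hV hW c := by
    rw [h.1 V W hV hW, h'.1 V W hV hW]; ring
  bound := by
    obtain ⟨K, hK, hKc, k, C, hL⟩ := h.2
    obtain ⟨K', hK', hKc', k', C', hL'⟩ := h'.2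
    refine ⟨K ∪ K', Set.union_subset hK hK', hKc.union hKc', max k k', C + C',
      fun V hV M hM hVM => (abs_add_le _ _).trans ?_⟩
    rw [add_mul]
    exact add_le_add
      (hL V hV M hM fun j hj x hx => hVM j (hj.trans (le_max_left _ _)) x (Or.inl hx))
      (hL' V hV M hM fun j hj x hx => hVM j (hj.trans (le_max_right _ _)) x (Or.inr hx))

lemma const_mul (h : IsContinuousLinearFunctional D L) (a : ℝ) :
    IsContinuousLinearFunctional D fun V => a * L V where
  map_add_smul V W hV hW c := by
    rw [h.1 V W hV hW]; ring
  bound := by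
    obtain ⟨K, hK, hKc, k, C, hL⟩ := h.2
    refine ⟨K, hK, hKc, k, |a| * C, fun V hV M hM hVM => ?_⟩
    rw [abs_mul, mul_assoc]
    exact mul_le_mul_of_nonneg_left (hL V hV M hM hVM) (abs_nonneg a)

/-- Reduces continuity of the functional to a pointwise estimate: the integrand at `s` may involve
finitely many derivatives of `V` at `s`, with an integrable weight `g`, whose integral becomes the
constant. -/
lemma of_integral {μ : Measure E3} {K : Set E3} {φ : (E3 → E3) → E3 → ℝ} {g : E3 → ℝ} {k : ℕ}
    (hK : IsCompact K) (hKD : K ⊆ D) (hμ : ∀ᵐ s ∂μ, s ∈ K)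
    (hφ : ∀ V, ContDiffOn ℝ ∞ V D → Integrable (φ V) μ)
    (hlin : ∀ V W, ContDiffOn ℝ ∞ V D → ContDiffOn ℝ ∞ W D → ∀ c : ℝ, ∀ s ∈ K,
      φ (fun x => V x + c • W x) s = φ V s + c * φ W s)
    (hg : Integrable g μ)
    (hbound : ∀ V, ContDiffOn ℝ ∞ V D → ∀ M : ℝ, 0 ≤ M → ∀ s ∈ K,
      (∀ j ≤ k, ‖iteratedFDeriv ℝ j V s‖ ≤ M) → |φ V s| ≤ g s * M) :
    IsContinuousLinearFunctional D fun V => ∫ s, φ V s ∂μ where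
  map_add_smul V W hV hW c := by
    rw [← integral_const_mul, ← integral_add (hφ V hV) ((hφ W hW).const_mul c)]
    exact integral_congr_ae (hμ.mono fun s hs => hlin V W hV hW c s hs)
  bound := by
    refine ⟨K, hKD, hK, k, ∫ s, g s ∂μ, fun V hV M hM hVM => ?_⟩
    rw [← integral_mul_const, ← Real.norm_eq_abs]
    exact norm_integral_le_of_norm_le (hg.mul_const M) (hμ.mono fun s hs =>
      hbound V hV M hM s hs fun j hj => hVM j hj s hs)

end IsContinuousLinearFunctional

/-- The derivative of `x ↦ -(DV)ᵀ N + ⟨N, (DV) N⟩ N` in the direction `v`, in terms of `A = DV`,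
`A' = D(DV) v`, `n = N` and `m = (DN) v`. -/
def normalVariation (A A' : E3 →L[ℝ] E3) (n m : E3) : E3 :=
  -(adjointR A' n + adjointR A m) +
    ((inner ℝ n (A n) : ℝ) • m +
      ((inner ℝ n (A' n + A m) : ℝ) + (inner ℝ m (A n) : ℝ)) • n)

lemma hasFDerivAt_normalVariation {B : E3 → E3 →L[ℝ] E3} {B' : E3 →L[ℝ] E3 →L[ℝ] E3} {N : E3 → E3}
    {N' : E3 →L[ℝ] E3} {s : E3} (hB : HasFDerivAt B B' s) (hN : HasFDerivAt N N' s) :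
    ∃ Q : E3 →L[ℝ] E3, HasFDerivAt
      (fun x => -(adjointR (B x) (N x)) + (inner ℝ (N x) (B x (N x)) : ℝ) • N x) Q s ∧
      ∀ v, Q v = normalVariation (B s) (B' v) (N s) (N' v) := by
  have h1 : HasFDerivAt (fun x => adjointR (B x)) (adjointR.comp B') s :=
    adjointR.hasFDerivAt.comp s hB
  have h2 := (h1.clm_apply hN).fun_neg
  have h3 := (hN.inner ℝ (hB.clm_apply hN)).smul hN
  refine ⟨_, h2.fun_add h3, fun v => ?_⟩
  simp [normalVariation]
  rw [add_comm (B s (N' v)) (B' v (N s))]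
  abel

/-- The derivative `dNormalDeriv` in terms of `A = DV`, `A' = D(DV) ξ_i`, the normal `n`, the
derivative `N'` of an extension of the normal field, and the frame. -/
def shapeVariation (A A' : E3 →L[ℝ] E3) (n : E3) (N' : E3 →L[ℝ] E3) (e : Fin 2 → E3) (i : Fin 2) :
    E3 :=
  normalVariation A A' n (N' (e i)) - N' (A (e i) - (inner ℝ n (A (e i)) : ℝ) • n) +
    N' (![A (e 0) - (inner ℝ (e 0) (A (e 0)) : ℝ) • e 0,
      A (e 1) - (inner ℝ (e 1) (A (e 1)) : ℝ) • e 1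
        - (inner ℝ (e 0) ((A + adjointR A) (e 1)) : ℝ) • e 0] i -
      (inner ℝ n (![A (e 0) - (inner ℝ (e 0) (A (e 0)) : ℝ) • e 0,
      A (e 1) - (inner ℝ (e 1) (A (e 1)) : ℝ) • e 1
        - (inner ℝ (e 0) ((A + adjointR A) (e 1)) : ℝ) • e 0] i) : ℝ) • n)

/-- Once the surface fields are replaced by extensions, `V` enters only through its first two
derivatives at `s`. Linearity and the bound in `V` become algebra in `A` and `A'`. -/
lemma dNormalDeriv_eq_shapeVariation {Ω : Set E3} (hΩ : IsSmoothDomain Ω)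
    {ξ : Fin 2 → E3 → E3} (hξ : IsTangentFrame Ω ξ) {V N : E3 → E3}
    (hV : ∀ x ∈ frontier Ω, ContDiffAt ℝ ∞ V x) (hN : IsNormalExtension Ω N) {s : E3}
    (hs : s ∈ frontier Ω) (i : Fin 2) :
    dNormalDeriv Ω V ξ i s = shapeVariation (fderiv ℝ V s) (fderiv ℝ (fderiv ℝ V) s (ξ i s)) (N s)
      (fderiv ℝ N s) (fun i => ξ i s) i := by
  have hn := hΩ.isOuterUnitNormal hs
  have hdV (x : E3) (hx : x ∈ frontier Ω) : HasFDerivAt V (fderiv ℝ V x) x :=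
    ((hV x hx).differentiableAt (by simp)).hasFDerivAt
  have hdN : HasFDerivAt N (fderiv ℝ N s) s :=
    (hN.contDiff.contDiffAt.differentiableAt (by simp)).hasFDerivAt
  have hddV : HasFDerivAt (fderiv ℝ V) (fderiv ℝ (fderiv ℝ V) s) s :=
    (((hV s hs).fderiv_right (m := 1) (by rw [one_add_one_eq_two]; exact ENat.LEInfty.out)).differentiableAt
      one_ne_zero).hasFDerivAt
  obtain ⟨Q, hQ, hQv⟩ := hasFDerivAt_normalVariation hddV hdN
  rw [dNormalDeriv, tangentialDeriv_eq hs hn hQ fun x hx => ?_,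
    tangentialDeriv_eq hs hn hdN fun x hx => (hN.eq_outerNormal x hx).symm,
    tangentialDeriv_eq hs hn (hdV s hs) fun _ _ => rfl]
  · simp only [ContinuousLinearMap.comp_apply, tangentProj_of_inner_eq_zero ((hξ s hs).2 i), hQv,
      shapeVariation, tangentProj_apply, hN.eq_outerNormal s hs, dFrame, adjointR_apply]
  · rw [dNormal_eq hx (hΩ.isOuterUnitNormal hx) (hdV x hx), hN.eq_outerNormal x hx, adjointR_apply]

lemma shapeVariation_add_smul (A A' B B' : E3 →L[ℝ] E3) (n : E3) (N' : E3 →L[ℝ] E3)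
    (e : Fin 2 → E3) (i : Fin 2) (c : ℝ) :
    shapeVariation (A + c • B) (A' + c • B') n N' e i =
      shapeVariation A A' n N' e i + c • shapeVariation B B' n N' e i := by
  simp only [shapeVariation, normalVariation]
  generalize hm : N' (e i) = m
  fin_cases i <;>
  · simp only [Fin.zero_eta, Fin.mk_one, Matrix.cons_val_zero, Matrix.cons_val_one, map_add,
      map_smul, map_sub, _root_.add_apply, _root_.smul_apply, inner_add_right, inner_sub_right,
      real_inner_smul_right]
    module

/-- The constant collects `2 + 4C` from `normalVariation`, `2C` from the term with `A (e i)`, and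
`8C` from the frame term, whose argument has norm at most `4M` before projection. Each tangential
projection is estimated crudely by a factor 2. -/
lemma norm_shapeVariation_le {A A' : E3 →L[ℝ] E3} {n : E3} {N' : E3 →L[ℝ] E3} {e : Fin 2 → E3}
    {M C : ℝ} (hA : ‖A‖ ≤ M) (hA' : ‖A'‖ ≤ M) (hn : ‖n‖ = 1) (hN' : ‖N'‖ ≤ C)
    (he : ∀ i, ‖e i‖ = 1) (i : Fin 2) :
    ‖shapeVariation A A' n N' e i‖ ≤ (2 + 14 * C) * M := by
  have hM : 0 ≤ M := (norm_nonneg _).trans hA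
  have hC : 0 ≤ C := (norm_nonneg _).trans hN'
  have key (T : E3 →L[ℝ] E3) (v : E3) (a b : ℝ) (hT : ‖T‖ ≤ a) (hv : ‖v‖ ≤ b) :
      ‖T v‖ ≤ a * b := T.le_of_opNorm_le_of_le hT hv
  have hsm (x v : E3) (a : ℝ) (y : E3) (hx : ‖x‖ = 1) (hy : ‖y‖ = 1) (hv : ‖v‖ ≤ a) :
      ‖(inner ℝ x v : ℝ) • y‖ ≤ a := by
    rw [norm_smul, hy, mul_one]
    exact (norm_inner_le_norm x v).trans (by rw [hx, one_mul]; exact hv)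
  have hAd (B : E3 →L[ℝ] E3) : ‖adjointR B‖ = ‖B‖ := LinearIsometryEquiv.norm_map _ _
  have hm : ‖N' (e i)‖ ≤ C := by simpa using key N' (e i) C 1 hN' (he i).le
  have hAe (j : Fin 2) : ‖A (e j)‖ ≤ M := by simpa using key A (e j) M 1 hA (he j).le
  have hAn : ‖A n‖ ≤ M := by simpa using key A n M 1 hA hn.le
  have hAn' : ‖A' n‖ ≤ M := by simpa using key A' n M 1 hA' hn.le
  have hproj (v : E3) (a : ℝ) (hv : ‖v‖ ≤ a) : ‖N' (v - (inner ℝ n v : ℝ) • n)‖ ≤ C * (a + a) :=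
    key N' _ _ _ hN' (norm_sub_le_of_le hv (hsm n v a n hn hn hv))
  have hsum (j : Fin 2) : ‖(A + adjointR A) (e j)‖ ≤ M + M := by
    simpa using key (A + adjointR A) (e j) (M + M) 1
      (norm_add_le_of_le hA ((hAd A).le.trans hA)) (he j).le
  have hframe : ‖![A (e 0) - (inner ℝ (e 0) (A (e 0)) : ℝ) • e 0,
      A (e 1) - (inner ℝ (e 1) (A (e 1)) : ℝ) • e 1
        - (inner ℝ (e 0) ((A + adjointR A) (e 1)) : ℝ) • e 0] i‖ ≤ M + M + (M + M) := by
    have h (j : Fin 2) := norm_sub_le_of_le (hAe j) (hsm (e j) _ _ (e j) (he j) (he j) (hAe j))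
    fin_cases i
    · exact (h 0).trans (by linarith)
    · exact norm_sub_le_of_le (h 1) (hsm _ _ _ _ (he 0) (he 0) (hsum 1))
  have hv1 : ‖adjointR A' n + adjointR A (N' (e i))‖ ≤ M * 1 + M * C :=
    norm_add_le_of_le (key _ _ _ _ ((hAd A').le.trans hA') hn.le)
      (key _ _ _ _ ((hAd A).le.trans hA) hm)
  have hv2 : ‖(inner ℝ n (A n) : ℝ) • N' (e i)‖ ≤ M * C := by
    rw [norm_smul]
    refine mul_le_mul ((norm_inner_le_norm n _).trans ?_) hm (norm_nonneg _) hM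
    rw [hn, one_mul]; exact hAn
  have hv3 : ‖((inner ℝ n (A' n + A (N' (e i))) : ℝ) + (inner ℝ (N' (e i)) (A n) : ℝ)) • n‖ ≤
      (M + M * C) + C * M := by
    rw [add_smul]
    refine norm_add_le_of_le (hsm n _ _ n hn hn (norm_add_le_of_le hAn' (key _ _ _ _ hA hm))) ?_
    rw [norm_smul, hn, mul_one]
    exact (norm_inner_le_norm _ _).trans (mul_le_mul hm hAn (norm_nonneg _) hC)
  have hnv : ‖normalVariation A A' n (N' (e i))‖ ≤
      (M * 1 + M * C) + (M * C + ((M + M * C) + C * M)) :=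
    norm_add_le_of_le (by rw [norm_neg]; exact hv1) (norm_add_le_of_le hv2 hv3)
  refine (norm_add_le_of_le (norm_sub_le_of_le hnv (hproj _ _ (hAe i))) (hproj _ _ hframe)).trans ?_
  exact le_of_eq (by ring)

section

variable {Ω : Set E3} {ξ : Fin 2 → E3 → E3} {V W : E3 → E3}

lemma fderiv_add_smul {F : Type*} [NormedAddCommGroup F] [NormedSpace ℝ F] {f g : E3 → F} {x : E3}
    (hf : DifferentiableAt ℝ f x) (hg : DifferentiableAt ℝ g x) (c : ℝ) :
    fderiv ℝ (fun y => f y + c • g y) x = fderiv ℝ f x + c • fderiv ℝ g x :=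
  (hf.hasFDerivAt.add (hg.hasFDerivAt.const_smul c)).fderiv

lemma surfaceDiv_add_smul (hΩ : IsSmoothDomain Ω) (hξ : IsTangentFrame Ω ξ) {s : E3}
    (hs : s ∈ frontier Ω) (hV : ContDiffAt ℝ ∞ V s) (hW : ContDiffAt ℝ ∞ W s) (c : ℝ) :
    surfaceDiv Ω (fun x => V x + c • W x) s = surfaceDiv Ω V s + c * surfaceDiv Ω W s := by
  simp only [surfaceDiv_eq (hΩ.isFrameAt hξ hs), fderiv_add_smul (hV.differentiableAt (by simp))
    (hW.differentiableAt (by simp)), _root_.add_apply, _root_.smul_apply, inner_add_right,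
    real_inner_smul_right]
  ring

lemma dNormalDeriv_add_smul (hΩ : IsSmoothDomain Ω) (hξ : IsTangentFrame Ω ξ)
    (hV : ∀ x ∈ frontier Ω, ContDiffAt ℝ ∞ V x) (hW : ∀ x ∈ frontier Ω, ContDiffAt ℝ ∞ W x)
    (c : ℝ) {s : E3} (hs : s ∈ frontier Ω) (i : Fin 2) :
    dNormalDeriv Ω (fun x => V x + c • W x) ξ i s =
      dNormalDeriv Ω V ξ i s + c • dNormalDeriv Ω W ξ i s := by
  obtain ⟨N, hN1, hN2⟩ := hΩ.exists_normal_extension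
  have hN : IsNormalExtension Ω N := ⟨hN1, hN2⟩
  have hdd {U : E3 → E3} (hU : ContDiffAt ℝ ∞ U s) : DifferentiableAt ℝ (fderiv ℝ U) s :=
    (hU.fderiv_right (m := 1) (by rw [one_add_one_eq_two]; exact ENat.LEInfty.out)).differentiableAt one_ne_zero
  have h1 {U : E3 → E3} (hU : ContDiffAt ℝ ∞ U s) : ∀ᶠ x in 𝓝 s, DifferentiableAt ℝ U x :=
    ((hU.of_le (m := 1) ENat.LEInfty.out).eventually (by simp)).mono
      fun x hx => hx.differentiableAt one_ne_zero
  have h2 : fderiv ℝ (fderiv ℝ fun x => V x + c • W x) s =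
      fderiv ℝ (fderiv ℝ V) s + c • fderiv ℝ (fderiv ℝ W) s := by
    rw [← fderiv_add_smul (hdd (hV s hs)) (hdd (hW s hs))]
    refine Filter.EventuallyEq.fderiv_eq ?_
    filter_upwards [h1 (hV s hs), h1 (hW s hs)] with x hx hx'
    exact fderiv_add_smul hx hx' c
  rw [dNormalDeriv_eq_shapeVariation hΩ hξ hV hN hs, dNormalDeriv_eq_shapeVariation hΩ hξ hW hN hs,
    dNormalDeriv_eq_shapeVariation hΩ hξ (fun x hx => (hV x hx).add ((hW x hx).const_smul c)) hN hs,
    h2, fderiv_add_smul (h1 (hV s hs)).self_of_nhds (h1 (hW s hs)).self_of_nhds,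
    ← shapeVariation_add_smul]
  rfl

lemma abs_surfaceDiv_le (hΩ : IsSmoothDomain Ω) (hξ : IsTangentFrame Ω ξ) {s : E3}
    (hs : s ∈ frontier Ω) {M : ℝ} (hM : ‖iteratedFDeriv ℝ 1 V s‖ ≤ M) :
    |surfaceDiv Ω V s| ≤ 2 * M := by
  have hf := hΩ.isFrameAt hξ hs
  rw [norm_iteratedFDeriv_one] at hM
  have h {a : E3} (ha : ‖a‖ = 1) : |(inner ℝ a (fderiv ℝ V s a) : ℝ)| ≤ M := by
    refine (abs_real_inner_le_norm _ _).trans ?_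
    rw [ha, one_mul]
    simpa using (fderiv ℝ V s).le_of_opNorm_le_of_le hM ha.le
  rw [surfaceDiv_eq hf, two_mul]
  exact (abs_add_le _ _).trans (add_le_add (h hf.2) (h hf.3))

lemma exists_norm_dNormalDeriv_le (hΩ : IsSmoothDomain Ω) (hξ : IsTangentFrame Ω ξ) :
    ∃ C : ℝ, 0 ≤ C ∧ ∀ V : E3 → E3, (∀ x ∈ frontier Ω, ContDiffAt ℝ ∞ V x) → ∀ M : ℝ,
      ∀ s ∈ frontier Ω, ‖iteratedFDeriv ℝ 1 V s‖ ≤ M → ‖iteratedFDeriv ℝ 2 V s‖ ≤ M → ∀ i,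
      ‖dNormalDeriv Ω V ξ i s‖ ≤ C * M := by
  obtain ⟨N, hN1, hN2⟩ := hΩ.exists_normal_extension
  have hN : IsNormalExtension Ω N := ⟨hN1, hN2⟩
  obtain ⟨C, hC⟩ := hΩ.isCompact_frontier.exists_bound_of_continuousOn
    (hN1.continuous_fderiv (by simp)).continuousOn
  refine ⟨2 + 14 * max C 0, by positivity, fun V hV M s hs h1 h2 i => ?_⟩
  have hf := hΩ.isFrameAt hξ hs
  have he : ∀ j, ‖ξ j s‖ = 1 := fun j => by
    fin_cases j
    exacts [hf.2, hf.3]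
  rw [norm_iteratedFDeriv_one] at h1
  have h2' : ‖fderiv ℝ (fderiv ℝ V) s‖ ≤ M := by
    rw [← norm_iteratedFDeriv_one, norm_iteratedFDeriv_fderiv]
    exact h2
  rw [dNormalDeriv_eq_shapeVariation hΩ hξ hV hN hs]
  refine norm_shapeVariation_le h1 ?_ (hN.norm_eq_one hΩ hs) ((hC s hs).trans (le_max_left _ _)) he i
  simpa using (fderiv ℝ (fderiv ℝ V) s).le_of_opNorm_le_of_le h2' (he i).le

variable {D : Set E3} {d b : Fin 2 → E3 → E3}

lemma shapeDifferentiable_transformedLagrangian (hΩ : IsSmoothDomain Ω) (hD : IsOpen D)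
    (hΩD : closure Ω ⊆ D) (hξ : IsTangentFrame Ω ξ)
    (hξm : ∀ i, AEStronglyMeasurable (ξ i) (surfaceMeasure Ω))
    (hdm : ∀ i, AEStronglyMeasurable (d i) (surfaceMeasure Ω))
    (hbm : ∀ i, AEStronglyMeasurable (b i) (surfaceMeasure Ω))
    (hint : LagrangianIntegrable Ω d b ξ) (loss : Set E3 → ℝ) (β lam : ℝ)
    (hℓ : ShapeDifferentiable D fun T => loss (T '' Ω)) :
    ShapeDifferentiable D (transformedLagrangian loss β lam Ω d b ξ) := by
  have := hΩ.isFiniteMeasure_surfaceMeasure hξ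
  obtain ⟨N, hN1, hN2⟩ := hΩ.exists_normal_extension
  have hVat (V : E3 → E3) (hV : ContDiffOn ℝ ∞ V D) (x : E3) (hx : x ∈ frontier Ω) :
      ContDiffAt ℝ ∞ V x :=
    hV.contDiffAt (hD.mem_nhds (hΩD (frontier_subset_closure hx)))
  have hI (V : E3 → E3) (hV : ContDiffOn ℝ ∞ V D) := (hasDerivAt_surface_integrals (b := b) hΩ hξ
    hξm hdm hbm hint (hVat V hV) ⟨hN1, hN2⟩).2
  have hK := hΩ.isCompact_frontier
  have hKD : frontier Ω ⊆ D := frontier_subset_closure.trans hΩD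
  have hμ : ∀ᵐ s ∂(surfaceMeasure Ω), s ∈ frontier Ω :=
    ae_restrict_mem (isClosed_frontier (s := Ω)).measurableSet
  obtain ⟨C, hC, hCb⟩ := exists_norm_dNormalDeriv_le hΩ hξ
  have hdiv {f : E3 → ℝ} (hf : Integrable f (surfaceMeasure Ω))
      (hfV : ∀ V, ContDiffOn ℝ ∞ V D →
        Integrable (fun s => surfaceDiv Ω V s * f s) (surfaceMeasure Ω)) :
      IsContinuousLinearFunctional D fun V => ∫ s, surfaceDiv Ω V s * f s ∂(surfaceMeasure Ω) := by
    refine .of_integral (k := 1) (g := fun s => 2 * |f s|) hK hKD hμ hfV ?_ (hf.abs.const_mul 2) ?_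
    · intro V W hV hW c s hs
      rw [surfaceDiv_add_smul hΩ hξ hs (hVat V hV s hs) (hVat W hW s hs)]
      ring
    · intro V hV M hM s hs hVM
      rw [abs_mul, mul_right_comm]
      exact mul_le_mul_of_nonneg_right (abs_surfaceDiv_le hΩ hξ hs (hVM 1 le_rfl)) (abs_nonneg _)
  have hinn (i : Fin 2) : IsContinuousLinearFunctional D fun V => ∫ s, (inner ℝ
      (splitResidual Ω d b ξ i s) (-dNormalDeriv Ω V ξ i s) : ℝ) ∂(surfaceMeasure Ω) := by
    -- Order 2 occurs because `dn[V]` contains `DV` and is differentiated once more. The weight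
    -- comes from `‖r‖ ≤ 1 + ‖r‖²` for the residual `r`, whose square is integrable.
    refine .of_integral (k := 2) (g := fun s => (1 + ‖splitResidual Ω d b ξ i s‖ ^ 2) * C) hK hKD hμ
      (fun V hV => (hI V hV).2.2.1 i) ?_
      (((integrable_const (1 : ℝ)).add (hint.2 i)).mul_const C) ?_
    · intro V W hV hW c s hs
      rw [dNormalDeriv_add_smul hΩ hξ (hVat V hV) (hVat W hW) c hs, neg_add, inner_add_right,
        ← smul_neg, real_inner_smul_right]
    · intro V hV M hM s hs hVM
      refine (abs_real_inner_le_norm _ _).trans ?_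
      rw [norm_neg, mul_assoc]
      refine mul_le_mul ?_ (hCb V (hVat V hV) M s hs (hVM 1 one_le_two) (hVM 2 le_rfl) i)
        (norm_nonneg _) (by positivity)
      nlinarith [sq_nonneg (‖splitResidual Ω d b ξ i s‖ - 1), sq_nonneg ‖splitResidual Ω d b ξ i s‖]
  obtain ⟨L, hL, hLlin, hLb⟩ := hℓ
  have hA := hdiv hint.1 fun V hV => (hI V hV).1
  have hB (i : Fin 2) := hdiv (hint.2 i) fun V hV => (hI V hV).2.1 i
  have hsum := ((IsContinuousLinearFunctional.mk hLlin hLb).add (hA.const_mul β)).add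
    (((hB 0).add (hB 1)).const_mul (lam / 2)) |>.add (((hinn 0).add (hinn 1)).const_mul lam)
  refine ⟨_, fun V hV => ?_, hsum.1, hsum.2⟩
  have h := hasShapeDeriv_transformedLagrangian hΩ hD hΩD hξ hξm hdm hbm hint hV loss β lam (L V)
    (hL V hV)
  simpa only [Fin.sum_univ_two] using h

end

end SplitBregman

end

/-! ### The main theorem -/

theorem mainTheorem3
    (Ω D : Set E3) (hΩ : IsSmoothDomain Ω) (hD : IsOpen D) (hΩD : closure Ω ⊆ D)
    {𝒰 : Set E3 → Type*} (u : (Ω' : Set E3) → 𝒰 Ω') (ℓ : (Ω' : Set E3) → 𝒰 Ω' → ℝ)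
    (β lam : ℝ) (d b ξ : Fin 2 → E3 → E3)
    (hξ : IsTangentFrame Ω ξ)
    (hξm : ∀ i, AEStronglyMeasurable (ξ i) (surfaceMeasure Ω))
    (hd : ∀ i, IsTangentialField Ω (d i)) (hb : ∀ i, IsTangentialField Ω (b i))
    (hdm : ∀ i, AEStronglyMeasurable (d i) (surfaceMeasure Ω))
    (hbm : ∀ i, AEStronglyMeasurable (b i) (surfaceMeasure Ω))
    (hint : LagrangianIntegrable Ω d b ξ)
    (hd0 : ∀ᵐ s ∂(surfaceMeasure Ω), ¬ (d 0 s = 0 ∧ d 1 s = 0)) :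
    -- shape differentiability of the augmented Lagrangian
    (ShapeDifferentiable D (fun T => ℓ (T '' Ω) (u (T '' Ω))) →
      ShapeDifferentiable D
        (transformedLagrangian (fun Ω' => ℓ Ω' (u Ω')) β lam Ω d b ξ)) ∧
    ∀ V : E3 → E3, ContDiffOn ℝ ∞ V D →
      -- the surface integrals in the Lagrangian converge on the perturbed domains as well
      (∀ᶠ ε : ℝ in 𝓝[>] 0, LagrangianIntegrable (perturb V ε '' Ω)
        (fun i => transport Ω (perturb V ε) (d i)) (fun i => transport Ω (perturb V ε) (b i))
        (transportedFrame Ω (perturb V ε) ξ)) ∧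
      -- `dNormalDeriv` is the material derivative of `(D_Γ n) ξ_i`
      (∀ i, ∀ s ∈ frontier Ω,
        HasDerivAt
          (fun ε : ℝ => normalDeriv (perturb V ε '' Ω) (transportedFrame Ω (perturb V ε) ξ i)
            (perturb V ε s))
          (dNormalDeriv Ω V ξ i s) 0) ∧
      -- the surface integrals in the formula for the shape derivative converge
      Integrable (fun s => surfaceDiv Ω V s * splitNorm d s) (surfaceMeasure Ω) ∧
      (∀ i, Integrable (fun s => surfaceDiv Ω V s * ‖splitResidual Ω d b ξ i s‖ ^ 2)
        (surfaceMeasure Ω)) ∧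
      (∀ i, Integrable (fun s => (inner ℝ (splitResidual Ω d b ξ i s) (-dNormalDeriv Ω V ξ i s) : ℝ))
        (surfaceMeasure Ω)) ∧
      -- the formula for the shape derivative in the direction `V`
      ∀ dℓ : ℝ, HasShapeDeriv (fun T => ℓ (T '' Ω) (u (T '' Ω))) V dℓ →
        HasShapeDeriv (transformedLagrangian (fun Ω' => ℓ Ω' (u Ω')) β lam Ω d b ξ) V
          (dℓ
            + β * (∫ s, surfaceDiv Ω V s * splitNorm d s ∂(surfaceMeasure Ω))
            + lam / 2 * (∑ i, ∫ s, surfaceDiv Ω V s * ‖splitResidual Ω d b ξ i s‖ ^ 2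
                ∂(surfaceMeasure Ω))
            + lam * (∑ i, ∫ s,
                (inner ℝ (splitResidual Ω d b ξ i s) (-dNormalDeriv Ω V ξ i s) : ℝ)
                ∂(surfaceMeasure Ω))) := by
  refine ⟨shapeDifferentiable_transformedLagrangian hΩ hD hΩD hξ hξm hdm hbm hint
    (fun Ω' => ℓ Ω' (u Ω')) β lam, fun V hV => ?_⟩
  obtain ⟨N, hN1, hN2⟩ := hΩ.exists_normal_extension
  have hN : IsNormalExtension Ω N := ⟨hN1, hN2⟩
  have hVat (x : E3) (hx : x ∈ frontier Ω) : ContDiffAt ℝ ∞ V x :=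
    hV.contDiffAt (hD.mem_nhds (hΩD (frontier_subset_closure hx)))
  obtain ⟨h1, h2, h3, h4, -, -⟩ :=
    hasDerivAt_surface_integrals (b := b) hΩ hξ hξm hdm hbm hint hVat hN
  refine ⟨nhdsWithin_le_nhds ?_, fun i s hs => hasDerivAt_normalDeriv hΩ hD hΩD hξ hV i hs,
    h2, h3, h4, fun dℓ hℓ => hasShapeDeriv_transformedLagrangian hΩ hD hΩD hξ hξm hdm hbm hint hV
      (fun Ω' => ℓ Ω' (u Ω')) β lam dℓ hℓ⟩
  filter_upwards [h1, eventually_isGoodPerturbation hΩ hD hΩD hV hN] with ε hε ⟨Ψ, hΨ⟩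
  exact (hΨ.lagrangianIntegrable_iff hΩ hN hξ d b).2 hε
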